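/- **Conventions.** On $\mathbb{R}^2$ let $dx$ (also written $dy$, $d\xi$) denote Lebesgue measure divided by $2\pi$, and on $S^1$ let $d\alpha$ denote arc length divided by $2\pi$. Let $M(2)=\mathbb{R}^2\rtimes S^1$ with $(x,e^{i\alpha})(y,e^{i\beta})=(x+e^{i\alpha}y,e^{i(\alpha+\beta)})$, where $e^{i\alpha}$ acts on $\mathbb{R}^2$ as rotation by the angle $\alpha$, and with Haar measure $dx\,d\alpha$. Let $\mathbb{C}^*=\mathbb{C}\setminus\{0\}$. Its complexification is $\mathbb{C}^2\times\mathbb{C}^*$ with the product $(z,w)(z',w')=(z+w\cdot z',ww')$, where $w=e^{i\zeta}$ acts on $\mathbb{C}^2$ by $w\cdot(z_1,z_2)=(z_1\cos\zeta-z_2\sin\zeta,\;z_1\sin\zeta+z_2\cos\zeta)$. Write $y\cdot z=y_1z_1+y_2z_2$ for $y\in\mathbb{R}^2$, $z\in\mathbb{C}^2$. **Data.** Let $\mu:\mathbb{R}^2\to(0,\infty)$ be a radial function that is locally bounded away from zero and satisfies $$\sigma(x)=\int_{\mathbb{R}^2}e^{2x\cdot y}\mu(y)\,dy<\infty\quad\text{for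 all }x\in\mathbb{R}^2 .$$ Let $a:\mathbb{R}^2\to\mathbb{R}$ be measurable and put, for $z\in\mathbb{C}^2$, $$\psi(z)=\int_{\mathbb{R}^2}\frac{e^{ia(y)}}{\sqrt{\sigma(y)}}\,e^{-iy\cdot z}\,dy .$$ Let $\nu$ be an $S^1$-invariant measure on $\mathbb{C}^*$ given by a positive density (with respect to Lebesgue measure) that is locally bounded away from zero, such that $$\delta(n)=\int_{\mathbb{C}^*}|w|^{2n}\,d\nu(w)<\infty\quad\text{for all }n\in\mathbb{Z}.$$ Let $c_n\in\mathbb{C}$ with $|c_n|=1$ for $n\in\mathbb{Z}$ and put, for $w\in\mathbb{C}^*$, $$\chi(w)=\sum_{n\in\mathbb{Z}}\frac{c_n}{\sqrt{\delta(n)}}\,w^n ,\qquad \phi(z,w)=\psi(z)\chi(w).$$ **Theorem.** For every $f\in L^2(M(2))$ and every $(z,w)\in\mathbb{C}^2\times\mathbb{C}^*$ the integral $$C_\phi f(z,w)=\int_{M(2)}f(\xi,e^{i\alpha})\,\phi\big((\xi,e^{i\alpha})^{-1}(z,w)\big)\,d\xi\,d\alpha$$ converges absolutely, and $C_\phi$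 is an isometric isomorphism of $L^2(M(2))$ onto $$\mathcal{O}(\mathbb{C}^2\times\mathbb{C}^*)\cap L^2\big(\mathbb{C}^2\times\mathbb{C}^*,\ \mu(y)\,dx\,dy\,d\nu(w)\big),\qquad z=x+iy .$$ That is, $C_\phi f$ is holomorphic and square integrable, $f\mapsto C_\phi f$ is linear and norm preserving, and each function $F$ in this space equals $C_\phi f$ at every point for exactly one $f\in L^2(M(2))$. -/

import Mathlib

open MeasureTheory
open scoped Topology

noncomputable section

namespace M2SegalBargmann

/-- The Euclidean plane `ℝ²`. -/
abbrev R2 : Type := EuclideanSpace ℝ (Fin 2)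

/-- The complex space `ℂ²`. -/
abbrev C2 : Type := EuclideanSpace ℂ (Fin 2)

/-! ### The group `M(2)` and its complexification `ℂ² × ℂ*` -/

/-- The rotation of `ℝ²` by `e^{iα} ∈ S¹`. -/
def rotR (u : Circle) (x : R2) : R2 :=
  !₂[(u : ℂ).re * x 0 - (u : ℂ).im * x 1, (u : ℂ).im * x 0 + (u : ℂ).re * x 1]

/-- `cos ζ` as a function of `w = e^{iζ}`. -/
def cosC (w : ℂˣ) : ℂ := ((w : ℂ) + (w : ℂ)⁻¹) / 2

/-- `sin ζ` as a function of `w = e^{iζ}`. -/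
def sinC (w : ℂˣ) : ℂ := ((w : ℂ) - (w : ℂ)⁻¹) / (2 * Complex.I)

/-- The action of `ℂ*` on `ℂ²` that extends the rotation action of `S¹` on `ℝ²`:
`w = e^{iζ}` acts by `(z₁ cos ζ - z₂ sin ζ, z₁ sin ζ + z₂ cos ζ)`. -/
def rotC (w : ℂˣ) (z : C2) : C2 :=
  !₂[cosC w * z 0 - sinC w * z 1, sinC w * z 0 + cosC w * z 1]

theorem rotR_one (x : R2) : rotR 1 x = x := by
  ext i; fin_cases i <;> simp [rotR]

theorem rotR_mul (u v : Circle) (x : R2) : rotR (u * v) x = rotR u (rotR v x) := by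
  ext i; fin_cases i <;> simp [rotR] <;> ring

theorem rotR_add (u : Circle) (x y : R2) : rotR u (x + y) = rotR u x + rotR u y := by
  ext i; fin_cases i <;> simp [rotR] <;> ring

theorem rotC_one (z : C2) : rotC 1 z = z := by
  ext i; fin_cases i <;> simp [rotC, cosC, sinC]

theorem cosC_mul (v w : ℂˣ) : cosC (v * w) = cosC v * cosC w - sinC v * sinC w := by
  have hv := v.ne_zero
  have hw := w.ne_zero
  simp only [cosC, sinC, Units.val_mul]
  field_simp
  simp only [Complex.I_sq]
  ring

theorem sinC_mul (v w : ℂˣ) : sinC (v * w) = sinC v * cosC w + cosC v * sinC w := by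
  have hv := v.ne_zero
  have hw := w.ne_zero
  simp only [cosC, sinC, Units.val_mul]
  field_simp
  ring

theorem rotC_mul (v w : ℂˣ) (z : C2) : rotC (v * w) z = rotC v (rotC w z) := by
  ext i; fin_cases i <;> simp [rotC, cosC_mul, sinC_mul] <;> ring

theorem rotC_add (w : ℂˣ) (z z' : C2) : rotC w (z + z') = rotC w z + rotC w z' := by
  ext i; fin_cases i <;> simp [rotC] <;> ring

theorem rotC_zero (w : ℂˣ) : rotC w 0 = 0 := by
  ext i; fin_cases i <;> simp [rotC]

theorem rotR_zero (u : Circle) : rotR u 0 = 0 := by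
  ext i; fin_cases i <;> simp [rotR]

instance : MeasurableSpace Circle := borel Circle

instance : BorelSpace Circle := ⟨rfl⟩

/-- The rigid motion group `M(2) = ℝ² ⋊ S¹`; its elements are the pairs `(x, e^{iα})`. -/
def M2 : Type := R2 × Circle

instance : MeasurableSpace M2 := inferInstanceAs (MeasurableSpace (R2 × Circle))

/-- `(x, e^{iα}) (y, e^{iβ}) = (x + e^{iα} y, e^{i(α + β)})`. -/
instance : Group M2 where
  mul g h := ((g.1 + rotR g.2 h.1, g.2 * h.2) : R2 × Circle)
  one := ((0, 1) : R2 × Circle)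
  inv g := ((-rotR g.2⁻¹ g.1, g.2⁻¹) : R2 × Circle)
  mul_assoc a b c := Prod.ext
    (show (a.1 + rotR a.2 b.1) + rotR (a.2 * b.2) c.1 = a.1 + rotR a.2 (b.1 + rotR b.2 c.1) by
      rw [rotR_mul, rotR_add, add_assoc])
    (mul_assoc a.2 b.2 c.2)
  one_mul a := Prod.ext (show 0 + rotR 1 a.1 = a.1 by rw [rotR_one, zero_add]) (one_mul a.2)
  mul_one a := Prod.ext (show a.1 + rotR a.2 0 = a.1 by rw [rotR_zero, add_zero]) (mul_one a.2)
  inv_mul_cancel a := Prod.ext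
    (show -rotR a.2⁻¹ a.1 + rotR a.2⁻¹ a.1 = 0 from neg_add_cancel _)
    (inv_mul_cancel a.2)

/-- The complexification `ℂ² × ℂ*` of `M(2)`; its elements are the pairs `(z, w)`. -/
def M2C : Type := C2 × ℂˣ

instance : MeasurableSpace M2C := inferInstanceAs (MeasurableSpace (C2 × ℂˣ))

/-- `(z, w) (z', w') = (z + w z', w w')`. -/
instance : Group M2C where
  mul g h := ((g.1 + rotC g.2 h.1, g.2 * h.2) : C2 × ℂˣ)
  one := ((0, 1) : C2 × ℂˣ)
  inv g := ((-rotC g.2⁻¹ g.1, g.2⁻¹) : C2 × ℂˣ)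
  mul_assoc a b c := Prod.ext
    (show (a.1 + rotC a.2 b.1) + rotC (a.2 * b.2) c.1 = a.1 + rotC a.2 (b.1 + rotC b.2 c.1) by
      rw [rotC_mul, rotC_add, add_assoc])
    (mul_assoc a.2 b.2 c.2)
  one_mul a := Prod.ext (show 0 + rotC 1 a.1 = a.1 by rw [rotC_one, zero_add]) (one_mul a.2)
  mul_one a := Prod.ext (show a.1 + rotC a.2 0 = a.1 by rw [rotC_zero, add_zero]) (mul_one a.2)
  inv_mul_cancel a := Prod.ext
    (show -rotC a.2⁻¹ a.1 + rotC a.2⁻¹ a.1 = 0 from neg_add_cancel _)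
    (inv_mul_cancel a.2)

/-- The inclusion `M(2) ⊆ ℂ² × ℂ*`. -/
def toM2C (g : M2) : M2C :=
  ((!₂[((g.1 0 : ℝ) : ℂ), ((g.1 1 : ℝ) : ℂ)], Circle.toUnits g.2) : C2 × ℂˣ)

theorem toM2C_mul (g h : M2) : toM2C (g * h) = toM2C g * toM2C h := by
  have hc : cosC (Circle.toUnits g.2) = (((g.2 : ℂ).re : ℝ) : ℂ) := by
    have := Complex.add_conj (g.2 : ℂ)
    simp only [cosC, Circle.toUnits_apply, Units.val_mk0, ← Circle.coe_inv, Circle.coe_inv_eq_conj,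
      this]
    push_cast
    ring
  have hs : sinC (Circle.toUnits g.2) = (((g.2 : ℂ).im : ℝ) : ℂ) := by
    have := Complex.sub_conj (g.2 : ℂ)
    simp only [sinC, Circle.toUnits_apply, Units.val_mk0, ← Circle.coe_inv, Circle.coe_inv_eq_conj,
      this]
    push_cast
    field_simp
  refine Prod.ext ?_ (map_mul Circle.toUnits g.2 h.2)
  change (!₂[(((g.1 + rotR g.2 h.1) 0 : ℝ) : ℂ), (((g.1 + rotR g.2 h.1) 1 : ℝ) : ℂ)] : C2) =
    !₂[((g.1 0 : ℝ) : ℂ), ((g.1 1 : ℝ) : ℂ)] +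
      rotC (Circle.toUnits g.2) !₂[((h.1 0 : ℝ) : ℂ), ((h.1 1 : ℝ) : ℂ)]
  ext i; fin_cases i <;> simp [rotR, rotC, hc, hs, -Circle.toUnits_apply]

/-! ### Measures -/

/-- The measure `dx` on `ℝ²`: Lebesgue measure divided by `2π`. -/
def dx : Measure R2 := ENNReal.ofReal (2 * Real.pi)⁻¹ • volume

/-- The measure `dα` on `S¹`: arc length divided by `2π`. -/
def dα : Measure Circle :=
  ENNReal.ofReal (2 * Real.pi)⁻¹ •
    (volume.restrict (Set.Ioc (-Real.pi) Real.pi)).map Circle.exp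

/-- The Haar measure `dx dα` on `M(2)`. -/
def haarM2 : Measure M2 := (dx.prod dα : Measure (R2 × Circle))

/-- Lebesgue measure (area) on `ℂ* ⊆ ℂ`. -/
def lebesgueCStar : Measure ℂˣ := (volume : Measure ℂ).comap Units.val

/-- The point `(x + iy, w)` of `ℂ² × ℂ*`. -/
def point (p : (R2 × R2) × ℂˣ) : M2C :=
  ((!₂[(p.1.1 0 : ℂ) + Complex.I * (p.1.2 0 : ℂ), (p.1.1 1 : ℂ) + Complex.I * (p.1.2 1 : ℂ)],
    p.2) : C2 × ℂˣ)

/-- The measure `μ(y) dx dy dν(w)` on `ℂ² × ℂ*`, where `z = x + iy`. -/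
def targetMeasure (μ : R2 → ℝ) (ν : Measure ℂˣ) : Measure M2C :=
  ((dx.prod (dx.withDensity fun y => ENNReal.ofReal (μ y))).prod ν).map point

/-! ### The kernel `φ` and the transform -/

/-- `f` is locally bounded away from zero. -/
def LocallyBoundedAwayFromZero {X : Type*} [TopologicalSpace X] (f : X → ℝ) : Prop :=
  ∀ x, ∃ ε > 0, ∀ᶠ y in 𝓝 x, ε ≤ f y

/-- `σ(x) = ∫ e^{2 x·y} μ(y) dy`. -/
def sigma (μ : R2 → ℝ) (x : R2) : ℝ := ∫ y, Real.exp (2 * inner ℝ x y) * μ y ∂dx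

/-- `ψ(z) = ∫ e^{i a(y)} σ(y)^{-1/2} e^{-i y·z} dy`. -/
def psi (μ a : R2 → ℝ) (z : C2) : ℂ :=
  ∫ y, Complex.exp (Complex.I * (a y : ℂ)) / (Real.sqrt (sigma μ y) : ℂ) *
    Complex.exp (-Complex.I * ∑ j, (y j : ℂ) * z j) ∂dx

/-- `δ(n) = ∫ |w|^{2n} dν(w)`. -/
def delta (ν : Measure ℂˣ) (n : ℤ) : ℝ := ∫ w, ‖(w : ℂ)‖ ^ (2 * n) ∂ν

/-- `χ(w) = ∑ c_n δ(n)^{-1/2} w^n`. -/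
def chi (ν : Measure ℂˣ) (c : ℤ → ℂ) (w : ℂˣ) : ℂ :=
  ∑' n : ℤ, c n / (Real.sqrt (delta ν n) : ℂ) * (w : ℂ) ^ n

/-- `φ(z, w) = ψ(z) χ(w)`. -/
def phi (μ a : R2 → ℝ) (ν : Measure ℂˣ) (c : ℤ → ℂ) (p : M2C) : ℂ := psi μ a p.1 * chi ν c p.2

/-- `(f * φ)(p) = ∫_{M(2)} f(g) φ(g⁻¹ p) dg` for `p ∈ ℂ² × ℂ*`. -/
def groupConvolution (φ : M2C → ℂ) (f : M2 → ℂ) (p : M2C) : ℂ :=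
  ∫ g, f g * φ ((toM2C g)⁻¹ * p) ∂haarM2

/-! ### Holomorphic functions -/

/-- `F` is holomorphic on `ℂ² × ℂ*`, the open set `{w ≠ 0}` of `ℂ² × ℂ`. -/
def IsHolomorphic (F : M2C → ℂ) : Prop :=
  ∃ G : C2 × ℂ → ℂ, DifferentiableOn ℂ G {q | q.2 ≠ 0} ∧ ∀ p : M2C, F p = G (p.1, (p.2 : ℂ))

/-- The space `𝒪(ℂ² × ℂ*) ∩ L²(ℂ² × ℂ*, m)`, with the `L²(m)` norm: the classes in `L²(m)` that
have a holomorphic representative. -/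
def holomorphicL2 (m : Measure M2C) : Submodule ℂ (Lp ℂ 2 m) where
  carrier := {F | ∃ H : M2C → ℂ, IsHolomorphic H ∧ F =ᵐ[m] H}
  zero_mem' := ⟨fun _ => 0, ⟨fun _ => 0, differentiableOn_const 0, fun _ => rfl⟩,
    Lp.coeFn_zero ℂ 2 m⟩
  add_mem' := by
    rintro F F' ⟨H, ⟨G, hG, hHG⟩, hF⟩ ⟨H', ⟨G', hG', hHG'⟩, hF'⟩
    refine ⟨fun p => H p + H' p, ⟨fun q => G q + G' q, hG.add hG', fun p => ?_⟩, ?_⟩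
    · simp only [hHG, hHG']
    · filter_upwards [Lp.coeFn_add F F', hF, hF'] with p h h1 h2
      simp only [h, Pi.add_apply, h1, h2]
  smul_mem' := by
    rintro k F ⟨H, ⟨G, hG, hHG⟩, hF⟩
    refine ⟨fun p => k * H p, ⟨fun q => k * G q, hG.const_mul k, fun p => ?_⟩, ?_⟩
    · simp only [hHG]
    · filter_upwards [Lp.coeFn_smul k F, hF] with p h h1
      simp only [h, Pi.smul_apply, h1, smul_eq_mul]

end M2SegalBargmann

end

open M2SegalBargmann

noncomputable section

namespace M2SegalBargmann

/-! ### The Fourier transform on `L²` -/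

/-! The value `C_φ f(p)` is the scalar product of `f` with the function `k_p(g) = conj φ(g⁻¹p)` on
`M(2)` (`groupKernel`). The proof compares the family `k_p` with the simpler family `m_p(y, n) =
conj (e^{-iy·z} wⁿ) / √(σ(y) δ(n))` in `L²(ℝ² × ℤ)` (`modelKernel`).

The two families have the same Gram matrix. For fixed rotation `u`, the substitution `y ↦ uy` shows
that `ξ ↦ conj ψ(u⁻¹(z - ξ))` is the Fourier transform of `conj (e^{-iy·z}) / √σ(y)` times the phase
`e^{-ia(u⁻¹y)}`. The rotation touches nothing else, because `μ` and hence `σ` is radial. By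
Plancherel the phases cancel and the scalar product of two such functions does not depend on `u`.
The remaining integral over `u` is evaluated by Parseval, where the unimodular `c_n` cancel
(`inner_groupKernel_groupKernel`). Both families are total, so a unitary `J` carries `k_p` to `m_p`,
and `C_φ f = modelT (J f)` at every point.

It remains to treat `modelT`. It is isometric: on the slice `Im z = t` the Fourier-Laplace transform
of `H/√σ` is the Fourier transform of `H(y) e^{y·t}/√σ(y)`. By Plancherel and Tonelli, integrating
over `μ(t) dt` produces `∫ e^{2y·t} μ(t) dt = σ(y)`, which cancels the denominator
(`lintegral_mul_exp_inner`). By rotation invariance of `ν` the monomials `wⁿ` are orthogonal with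
squared norms `δ(n)` (`lintegral_tsum_zpow`).

It is onto: expand a holomorphic `F` in a Laurent series in `w`. Each coefficient is a function of
`z` that is holomorphic on complex lines and square integrable for `μ(t) dx dt`. By Cauchy's theorem
(`integral_cpt_eq_of_lines`) the Fourier transforms of its slices, divided by `e^{y·t}`, do not
depend on `t` (`fourier_slice_eq`), so the coefficient is a Fourier-Laplace transform. The isometry
identity read backwards gives square integrability of the density.

All convergence rests on two growth estimates: `σ(y)` dominates every `e^{R|y|}`, and `δ(n)`
dominates every `R^{2|n|}`. -/

open scoped FourierTransform SchwartzMap in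
/-- On `L¹ ∩ L²` the `L²` Fourier transform is given by the Fourier integral. -/
theorem fourier_toLp_ae_eq {V : Type*} [NormedAddCommGroup V] [InnerProductSpace ℝ V]
    [FiniteDimensional ℝ V] [MeasurableSpace V] [BorelSpace V] {f : V → ℂ} (h1 : Integrable f)
    (h2 : MemLp f 2) : (𝓕 (h2.toLp f) : Lp ℂ 2 (volume : Measure V)) =ᵐ[volume] 𝓕 f := by
  have hcont : Continuous (𝓕 f) := by
    exact VectorFourier.fourierIntegral_continuous Real.continuous_fourierChar
      (by exact continuous_inner) h1
  -- Both sides are tested against smooth compactly supported `g`. The distributional definition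
  -- moves the `L²` transform onto `g`; the multiplication formula for integrable functions moves
  -- the Fourier integral onto `g` in the same way.
  refine ae_eq_of_integral_contDiff_smul_eq
    ((Lp.memLp _).locallyIntegrable (by norm_num)) hcont.locallyIntegrable fun g hg hgc => ?_
  let G : 𝓢(V, ℂ) := (hgc.comp_left (g := fun r : ℝ => (r : ℂ)) (by simp)).toSchwartzMap
    (Complex.ofRealCLM.contDiff.comp hg)
  have hG : ∀ x, G x = (g x : ℂ) := fun x => rfl
  have e1 := Lp.toTemperedDistribution_apply (𝓕 (h2.toLp f) : Lp ℂ 2 (volume : Measure V)) G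
  rw [← Lp.fourier_toTemperedDistribution_eq, TemperedDistribution.fourier_apply,
    Lp.toTemperedDistribution_apply] at e1
  have e2 : ∫ x, (𝓕 G) x • (h2.toLp f) x = ∫ x, (𝓕 G) x • f x :=
    integral_congr_ae (by filter_upwards [h2.coeFn_toLp] with x hx; rw [hx])
  have e3 := VectorFourier.integral_fourierIntegral_smul_eq_flip (L := innerₗ V)
    Real.continuous_fourierChar continuous_inner (G.integrable (μ := volume)) h1
  have e4 : ∫ x, (𝓕 G) x • f x = ∫ x, G x • 𝓕 f x := by
    rw [SchwartzMap.fourier_coe]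
    simpa using! e3
  simp only [hG] at e1 e4
  calc _ = ∫ x, (g x : ℂ) • (𝓕 (h2.toLp f) : Lp ℂ 2 (volume : Measure V)) x := by
        simp only [Complex.real_smul, smul_eq_mul]
    _ = ∫ x, (g x : ℂ) • 𝓕 f x := by rw [← e1, e2, e4]
    _ = _ := by simp only [Complex.real_smul, smul_eq_mul]

/-- The scaling by `√(2π)`. -/
def scaling : R2 ≃ᵐ R2 :=
  (Homeomorph.smulOfNeZero (Real.sqrt (2 * Real.pi)) (by positivity)).toMeasurableEquiv

theorem scaling_apply (x : R2) : scaling x = Real.sqrt (2 * Real.pi) • x := rfl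

/-- In dimension two the factor `√(2π)` has Jacobian `2π`, the normalisation of `dx`. Scaling both
variables also turns the kernel `e^{-2πi x·y}` into `e^{-i x·y}`. -/
theorem measurePreserving_scaling : MeasurePreserving scaling volume dx := by
  refine ⟨scaling.measurable, ?_⟩
  have := Measure.map_addHaar_smul (volume : Measure R2)
    (r := Real.sqrt (2 * Real.pi)) (by positivity)
  have h2 : (volume : Measure R2).map scaling
    = (volume : Measure R2).map (Real.sqrt (2 * Real.pi) • ·) := rfl
  rw [h2, this, dx]
  congr 2
  rw [finrank_euclideanSpace_fin, Real.sq_sqrt (by positivity), abs_of_pos (by positivity)]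

/-- Composition with a measure preserving equivalence as an isometric equivalence of `L²`. -/
def lpCompEquiv {X Y : Type*} [MeasurableSpace X] [MeasurableSpace Y] {m : Measure X}
    {m' : Measure Y} (e : X ≃ᵐ Y) (he : MeasurePreserving e m m') : Lp ℂ 2 m' ≃ₗᵢ[ℂ] Lp ℂ 2 m :=
  LinearIsometryEquiv.ofSurjective (Lp.compMeasurePreservingₗᵢ ℂ e he) fun g => by
    refine ⟨Lp.compMeasurePreserving e.symm (he.symm e) g, ?_⟩
    change Lp.compMeasurePreserving e he _ = g
    refine Lp.ext ?_
    filter_upwards [Lp.coeFn_compMeasurePreserving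
      (Lp.compMeasurePreserving e.symm (he.symm e) g) he,
      he.quasiMeasurePreserving.ae (Lp.coeFn_compMeasurePreserving g (he.symm e))] with x h1 h2
    rw [h1, Function.comp_apply, h2, Function.comp_apply, e.symm_apply_apply]

theorem lpCompEquiv_apply {X Y : Type*} [MeasurableSpace X] [MeasurableSpace Y] {m : Measure X}
    {m' : Measure Y} (e : X ≃ᵐ Y) (he : MeasurePreserving e m m') (f : Lp ℂ 2 m') :
    lpCompEquiv e he f = Lp.compMeasurePreserving e he f := rfl

/-- The Fourier transform with kernel `e^{-i x·y}` as a unitary operator of `L²(ℝ², dx)`. -/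
def fourierDx : Lp ℂ 2 dx ≃ₗᵢ[ℂ] Lp ℂ 2 dx :=
  ((lpCompEquiv scaling measurePreserving_scaling).trans (Lp.fourierTransformₗᵢ R2 ℂ)).trans
    (lpCompEquiv scaling measurePreserving_scaling).symm

open scoped FourierTransform in
theorem fourierDx_toLp {k : R2 → ℂ} (h1 : Integrable k dx) (h2 : MemLp k 2 dx) :
    fourierDx (h2.toLp k) =ᵐ[dx]
      fun x => ∫ y, k y * Complex.exp (-Complex.I * (inner ℝ y x : ℝ)) ∂dx := by
  have hs := measurePreserving_scaling
  have h1' : Integrable (k ∘ scaling) volume :=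
    (hs.integrable_comp_emb scaling.measurableEmbedding).2 h1
  have h2' : MemLp (k ∘ scaling) 2 volume := h2.comp_measurePreserving hs
  have e1 : lpCompEquiv scaling hs (fourierDx (h2.toLp k)) = Lp.fourierTransformₗᵢ R2 ℂ
      (h2'.toLp _) := by
    simp only [fourierDx, LinearIsometryEquiv.trans_apply, LinearIsometryEquiv.apply_symm_apply]
    congr 1
  have e2 : (fun x => fourierDx (h2.toLp k) (scaling x)) =ᵐ[volume] 𝓕 (k ∘ scaling) := by
    filter_upwards [fourier_toLp_ae_eq h1' h2', Lp.coeFn_compMeasurePreserving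
      (fourierDx (h2.toLp k)) hs] with x hx hx'
    rw [← hx]
    change _ = (Lp.fourierTransformₗᵢ R2 ℂ (h2'.toLp _)) x
    rw [← e1, lpCompEquiv_apply, hx', Function.comp_apply]
  suffices h : ∀ᵐ x ∂(volume.map scaling), fourierDx (h2.toLp k) x =
      ∫ y, k y * Complex.exp (-Complex.I * (inner ℝ y x : ℝ)) ∂dx by rwa [hs.map_eq] at h
  refine (scaling.measurableEmbedding.ae_map_iff).2 ?_
  filter_upwards [e2] with x hx
  rw [hx, Real.fourier_eq, ← hs.integral_comp scaling.measurableEmbedding]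
  refine integral_congr_ae (Filter.Eventually.of_forall fun y => ?_)
  simp only [Function.comp_apply, scaling_apply, Circle.smul_def, smul_eq_mul, Real.fourierChar_apply,
    inner_smul_left, inner_smul_right]
  rw [mul_comm]
  congr 2
  have : Real.sqrt (2 * Real.pi) * Real.sqrt (2 * Real.pi) = 2 * Real.pi :=
    Real.mul_self_sqrt (by positivity)
  simp only [conj_trivial]
  rw [← mul_assoc (Real.sqrt _), this]
  push_cast
  ring

/-! ### Square integrability in terms of lower integrals -/

theorem eLpNorm_two_sq {X : Type*} [MeasurableSpace X] {m : Measure X} (f : X → ℂ) :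
    eLpNorm f 2 m ^ 2 = ∫⁻ x, ‖f x‖ₑ ^ 2 ∂m := by
  rw [eLpNorm_eq_lintegral_rpow_enorm_toReal (by norm_num) (by norm_num), ← ENNReal.rpow_natCast,
    ← ENNReal.rpow_mul]
  norm_num

theorem memLp_two_iff {X : Type*} [MeasurableSpace X] {m : Measure X} {f : X → ℂ}
    (hf : AEStronglyMeasurable f m) : MemLp f 2 m ↔ ∫⁻ x, ‖f x‖ₑ ^ 2 ∂m < ⊤ := by
  rw [← eLpNorm_two_sq, ENNReal.pow_lt_top_iff]
  simp [MemLp, hf]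

theorem enorm_sq_eq_lintegral {X : Type*} [MeasurableSpace X] {m : Measure X} (F : Lp ℂ 2 m) :
    ‖F‖ₑ ^ 2 = ∫⁻ x, ‖F x‖ₑ ^ 2 ∂m := by
  rw [← eLpNorm_two_sq, Lp.enorm_def]

/-! ### The measure `dx` -/

theorem dx_const_ne_zero : ENNReal.ofReal (2 * Real.pi)⁻¹ ≠ 0 := by
  simp [Real.pi_pos]

instance : Measure.IsAddHaarMeasure dx :=
  Measure.IsAddHaarMeasure.smul _ dx_const_ne_zero ENNReal.ofReal_ne_top

/-! ### Exponentials and the Fourier-Laplace transform on `ℂ²` -/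

/-- The point `x + i t` of `ℂ²`. -/
def cpt (x t : R2) : C2 := !₂[(x 0 : ℂ) + Complex.I * (t 0 : ℂ), (x 1 : ℂ) + Complex.I * (t 1 : ℂ)]

/-- The real part of a point of `ℂ²`. -/
def rePart (z : C2) : R2 := !₂[(z 0).re, (z 1).re]

/-- The imaginary part of a point of `ℂ²`. -/
def imPart (z : C2) : R2 := !₂[(z 0).im, (z 1).im]

theorem cpt_re_im (z : C2) : cpt (rePart z) (imPart z) = z := by
  ext i
  fin_cases i <;> simp [cpt, rePart, imPart, mul_comm Complex.I, Complex.re_add_im]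

theorem continuous_cpt : Continuous fun p : R2 × R2 => cpt p.1 p.2 := by
  unfold cpt
  refine (PiLp.continuous_toLp 2 _).comp (continuous_pi fun i => ?_)
  fin_cases i <;> simp <;> fun_prop

/-- Moving the real and the imaginary part along the same vector `e` stays inside one complex line,
which reduces shifts of the plane to one complex variable. -/
theorem cpt_add_line (x t e : R2) (r s : ℝ) :
    cpt (x + r • e) (t + s • e) = cpt x t + ((r : ℂ) + s * Complex.I) • cpt e 0 := by
  ext i
  fin_cases i <;> simp [cpt] <;> ring

theorem inner_R2 (x y : R2) : inner ℝ x y = x 0 * y 0 + x 1 * y 1 := by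
  simp [PiLp.inner_apply, Fin.sum_univ_two, mul_comm]

/-- The exponential `e^{-i y·z}`. -/
def expC (y : R2) (z : C2) : ℂ := Complex.exp (-Complex.I * ∑ j, (y j : ℂ) * z j)

theorem expC_cpt (y x t : R2) : expC y (cpt x t) =
    (Real.exp (inner ℝ y t) : ℂ) * Complex.exp (-Complex.I * (inner ℝ y x : ℝ)) := by
  rw [expC, Complex.ofReal_exp, ← Complex.exp_add]
  congr 1
  simp only [Fin.sum_univ_two, cpt, inner_R2]
  simp
  ring_nf
  simp

theorem norm_exp_neg_I_mul (r : ℝ) : ‖Complex.exp (-Complex.I * r)‖ = 1 := by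
  rw [Complex.norm_exp]; simp

theorem norm_expC_cpt (y x t : R2) : ‖expC y (cpt x t)‖ = Real.exp (inner ℝ y t) := by
  rw [expC_cpt, norm_mul, norm_exp_neg_I_mul, mul_one, Complex.norm_real,
    Real.norm_of_nonneg (Real.exp_pos _).le]

theorem norm_imPart_le (z : C2) : ‖imPart z‖ ≤ ‖z‖ := by
  rw [EuclideanSpace.norm_eq, EuclideanSpace.norm_eq]
  refine Real.sqrt_le_sqrt (Finset.sum_le_sum fun i _ => ?_)
  gcongr
  fin_cases i <;> simpa [imPart] using Complex.abs_im_le_norm _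

theorem norm_expC_le (y : R2) (z : C2) : ‖expC y z‖ ≤ Real.exp (‖z‖ * ‖y‖) := by
  rw [← cpt_re_im z, norm_expC_cpt, cpt_re_im]
  refine Real.exp_le_exp.2 ((real_inner_le_norm _ _).trans ?_)
  rw [mul_comm]
  gcongr
  exact norm_imPart_le z

theorem continuous_expC : Continuous fun p : R2 × C2 => expC p.1 p.2 := by
  unfold expC
  fun_prop

theorem differentiable_expC (y : R2) : Differentiable ℂ (expC y) := by
  unfold expC
  fun_prop

/-- The Fourier-Laplace transform `∫ k(y) e^{-i y·z} dy`. -/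
def planeE (k : R2 → ℂ) (z : C2) : ℂ := ∫ y, k y * expC y z ∂dx

theorem planeE_cpt (k : R2 → ℂ) (x t : R2) : planeE k (cpt x t) =
    ∫ y, (k y * (Real.exp (inner ℝ y t) : ℂ)) * Complex.exp (-Complex.I * (inner ℝ y x : ℝ)) ∂dx :=
  integral_congr_ae (.of_forall fun y => by simp only [expC_cpt, mul_assoc])

/-- At height `t` the kernel splits as `e^{y·t} e^{-iy·x}`, so the slice is an ordinary Fourier
transform and Plancherel applies to it. -/
theorem fourierDx_planeE {k : R2 → ℂ} {t : R2}
    (h1 : Integrable (fun y => k y * (Real.exp (inner ℝ y t) : ℂ)) dx)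
    (h2 : MemLp (fun y => k y * (Real.exp (inner ℝ y t) : ℂ)) 2 dx) :
    fourierDx (h2.toLp _) =ᵐ[dx] fun x => planeE k (cpt x t) := by
  filter_upwards [fourierDx_toLp h1 h2] with x hx
  rw [hx, planeE_cpt]

theorem memLp_planeE {k : R2 → ℂ} {t : R2}
    (h1 : Integrable (fun y => k y * (Real.exp (inner ℝ y t) : ℂ)) dx)
    (h2 : MemLp (fun y => k y * (Real.exp (inner ℝ y t) : ℂ)) 2 dx) :
    MemLp (fun x => planeE k (cpt x t)) 2 dx :=
  (memLp_congr_ae (fourierDx_planeE h1 h2)).1 (Lp.memLp _)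

theorem lintegral_planeE {k : R2 → ℂ} {t : R2}
    (h1 : Integrable (fun y => k y * (Real.exp (inner ℝ y t) : ℂ)) dx)
    (h2 : MemLp (fun y => k y * (Real.exp (inner ℝ y t) : ℂ)) 2 dx) :
    ∫⁻ x, ‖planeE k (cpt x t)‖ₑ ^ 2 ∂dx =
      ∫⁻ y, ‖k y * (Real.exp (inner ℝ y t) : ℂ)‖ₑ ^ 2 ∂dx := by
  calc _ = ∫⁻ x, ‖fourierDx (h2.toLp _) x‖ₑ ^ 2 ∂dx :=
        lintegral_congr_ae (by filter_upwards [fourierDx_planeE h1 h2] with x hx; rw [hx])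
    _ = ‖h2.toLp _‖ₑ ^ 2 := by
        rw [← enorm_sq_eq_lintegral, LinearIsometryEquiv.enorm_map]
    _ = _ := by
        rw [enorm_sq_eq_lintegral]
        exact lintegral_congr_ae (by filter_upwards [h2.coeFn_toLp] with x hx; rw [hx])

theorem continuous_planeE {k : R2 → ℂ} (hk : AEStronglyMeasurable k dx)
    (h : ∀ R : ℝ, Integrable (fun y => k y * (Real.exp (R * ‖y‖) : ℂ)) dx) :
    Continuous (planeE k) := by
  refine continuous_iff_continuousAt.2 fun z₀ => ?_
  refine continuousAt_of_dominated (bound := fun y => ‖k y * (Real.exp ((‖z₀‖ + 1) * ‖y‖) : ℂ)‖)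
    (.of_forall fun z => hk.mul (by
      exact (continuous_expC.comp (by fun_prop : Continuous fun y : R2 => (y, z)))
        |>.aestronglyMeasurable))
    ?_ (h _).norm (.of_forall fun y => ?_)
  · filter_upwards [Metric.ball_mem_nhds z₀ one_pos] with z hz
    refine .of_forall fun y => ?_
    rw [norm_mul, norm_mul, Complex.norm_real, Real.norm_of_nonneg (Real.exp_pos _).le]
    gcongr
    refine (norm_expC_le y z).trans (Real.exp_le_exp.2 ?_)
    gcongr
    have : ‖z - z₀‖ < 1 := by simpa [dist_eq_norm] using hz
    linarith [norm_le_norm_add_norm_sub' z z₀]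
  · exact continuousAt_const.mul (differentiable_expC y).continuous.continuousAt

/-! ### Parametric integrals of entire functions -/

/-- A locally dominated integral of entire functions is entire. -/
theorem differentiable_integral_of_dominated {X : Type*} [TopologicalSpace X] [MeasurableSpace X]
    [OpensMeasurableSpace X] [SecondCountableTopologyEither X ℂ] {m : Measure X} {f : X → ℂ → ℂ}
    (hf : Continuous (Function.uncurry f)) (hd : ∀ x, Differentiable ℂ (f x))
    (hb : ∀ R : ℝ, ∃ B : X → ℝ, Integrable B m ∧ ∀ᵐ x ∂m, ∀ ζ, ‖ζ‖ ≤ R → ‖f x ζ‖ ≤ B x) :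
    Differentiable ℂ fun ζ => ∫ x, f x ζ ∂m := by
  intro ζ₀
  -- Unit circles centred in the unit ball around `ζ₀` stay within radius `‖ζ₀‖ + 2`, so Cauchy's
  -- estimate bounds the derivatives by the same `B`.
  obtain ⟨B, hB, hfB⟩ := hb (‖ζ₀‖ + 2)
  have hmeas : ∀ ζ, AEStronglyMeasurable (fun x => f x ζ) m := fun ζ =>
    (hf.comp (by fun_prop : Continuous fun x : X => (x, ζ))).aestronglyMeasurable
  refine (hasDerivAt_integral_of_dominated_loc_of_deriv_le (F := fun ζ x => f x ζ)
    (F' := fun ζ x => deriv (f x) ζ) (bound := B) (Metric.ball_mem_nhds ζ₀ one_pos)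
    (.of_forall hmeas) ?_ ?_ ?_ hB ?_).2.differentiableAt
  · exact hB.mono' (hmeas _) (by filter_upwards [hfB] with x hx; exact hx _ (by linarith))
  · exact ((measurable_deriv_with_param hf).comp
      (measurable_prodMk_right (y := ζ₀))).aestronglyMeasurable
  · filter_upwards [hfB] with x hx ζ hζ
    have h1 : ‖ζ - ζ₀‖ < 1 := by simpa [dist_eq_norm] using hζ
    have := Complex.norm_deriv_le_of_forall_mem_sphere_norm_le (c := ζ) one_pos
      (hd x).diffContOnCl (C := B x) fun w hw => hx w (by
        have h2 : ‖w - ζ‖ = 1 := by simpa [dist_eq_norm] using hw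
        have h3 : w = (w - ζ) + (ζ - ζ₀) + ζ₀ := by ring
        rw [h3]
        refine (norm_add₃_le).trans ?_
        linarith)
    simpa using this
  · exact .of_forall fun x ζ _ => (hd x ζ).hasDerivAt

section

/-! ### The weight `σ` -/

theorem LocallyBoundedAwayFromZero.exists_le_of_isCompact {X : Type*} [TopologicalSpace X]
    {f : X → ℝ} (hf : LocallyBoundedAwayFromZero f) {K : Set X} (hK : IsCompact K) :
    ∃ ε > 0, ∀ y ∈ K, ε ≤ f y := by
  refine hK.induction_on (p := fun s => ∃ ε > 0, ∀ y ∈ s, ε ≤ f y) ⟨1, one_pos, by simp⟩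
    (fun s t hst ⟨ε, h0, h⟩ => ⟨ε, h0, fun y hy => h y (hst hy)⟩) ?_ ?_
  · rintro s t ⟨ε, h0, h⟩ ⟨ε', h0', h'⟩
    refine ⟨min ε ε', lt_min h0 h0', ?_⟩
    rintro y (hy | hy)
    · exact (min_le_left _ _).trans (h y hy)
    · exact (min_le_right _ _).trans (h' y hy)
  · intro x _
    obtain ⟨ε, h0, h⟩ := hf x
    exact ⟨_, mem_nhdsWithin_of_mem_nhds h, ε, h0, fun y hy => hy⟩

/-- The conditions on the weight `μ`. -/
structure Admissible (μ : R2 → ℝ) : Prop where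
  pos : ∀ x, 0 < μ x
  loc : LocallyBoundedAwayFromZero μ
  int : ∀ x : R2, Integrable (fun y : R2 => Real.exp (2 * inner ℝ x y) * μ y) dx

/-- The measure `μ(y) dy`. -/
def weightMeasure (μ : R2 → ℝ) : Measure R2 := dx.withDensity fun y => ENNReal.ofReal (μ y)

namespace Admissible

variable {μ : R2 → ℝ} (hμ : Admissible μ)
include hμ

theorem integrable : Integrable μ dx := by simpa using hμ.int 0

theorem isFiniteMeasure : IsFiniteMeasure (weightMeasure μ) :=
  isFiniteMeasure_withDensity_ofReal hμ.integrable.2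

theorem lintegral_weightMeasure (f : R2 → ENNReal) :
    ∫⁻ y, f y ∂weightMeasure μ = ∫⁻ y, ENNReal.ofReal (μ y) * f y ∂dx :=
  lintegral_withDensity_eq_lintegral_mul_non_measurable₀ _
    hμ.integrable.1.aemeasurable.ennreal_ofReal (.of_forall fun _ => ENNReal.ofReal_lt_top) _

theorem ofReal_sigma (x : R2) : ENNReal.ofReal (sigma μ x) =
    ∫⁻ t, ENNReal.ofReal (Real.exp (2 * inner ℝ x t)) ∂weightMeasure μ := by
  rw [hμ.lintegral_weightMeasure, sigma, ofReal_integral_eq_lintegral_ofReal (hμ.int x)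
    (.of_forall fun y => mul_nonneg (Real.exp_pos _).le (hμ.pos y).le)]
  refine lintegral_congr fun y => ?_
  rw [mul_comm, ENNReal.ofReal_mul (hμ.pos y).le]

theorem measurable_sigma : Measurable (sigma μ) := by
  -- `μ` is only known to be almost everywhere measurable; a measurable representative gives the
  -- same `σ`.
  obtain ⟨μ', h', he⟩ := hμ.integrable.1
  have h1 : sigma μ = fun x => ∫ y, Real.exp (2 * inner ℝ x y) * μ' y ∂dx := by
    funext x
    exact integral_congr_ae (by filter_upwards [he] with y hy; rw [hy])
  rw [h1]
  refine StronglyMeasurable.measurable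
    (StronglyMeasurable.integral_prod_right (f := fun x y => Real.exp (2 * inner ℝ x y) * μ' y) ?_)
  refine StronglyMeasurable.mul (Continuous.stronglyMeasurable ?_)
    (h'.comp_measurable measurable_snd)
  fun_prop

/-- On the unit ball around `(|R| + 1) y/|y|` one has `y·t ≥ |R||y|`. This ball lies in the closed
ball of radius `|R| + 2` about the origin, where `μ` has a positive lower bound independent of `y`.
-/
theorem exists_exp_le_sigma (R : ℝ) : ∃ c > 0, ∀ y, c * Real.exp (R * ‖y‖) ≤ sigma μ y := by
  obtain ⟨ε, hε, h⟩ := hμ.loc.exists_le_of_isCompact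
    (isCompact_closedBall (0 : R2) (|R| + 2))
  have hv : 0 < (dx (Metric.ball 0 1)).toReal :=
    ENNReal.toReal_pos (Metric.measure_ball_pos _ _ one_pos).ne' measure_ball_lt_top.ne
  refine ⟨ε * (dx (Metric.ball 0 1)).toReal, by positivity, fun y => ?_⟩
  obtain ⟨e, he, hey⟩ : ∃ e : R2, ‖e‖ ≤ 1 ∧ inner ℝ y e = ‖y‖ := by
    by_cases hy : y = 0
    · exact ⟨0, by simp, by simp [hy]⟩
    · refine ⟨‖y‖⁻¹ • y, by simp [norm_smul, hy], ?_⟩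
      rw [inner_smul_right, real_inner_self_eq_norm_sq]
      field_simp
  have hy0 := norm_nonneg y
  have hsub : ∀ t ∈ Metric.ball ((|R| + 1) • e) 1, ε * Real.exp (R * ‖y‖) ≤
      Real.exp (2 * inner ℝ y t) * μ t := by
    intro t ht
    have h1 : ‖t - (|R| + 1) • e‖ < 1 := by simpa [dist_eq_norm] using ht
    have h2 : ‖(|R| + 1) • e‖ ≤ |R| + 1 := by
      rw [norm_smul, Real.norm_of_nonneg (by positivity)]
      exact mul_le_of_le_one_right (by positivity) he
    have h3 : inner ℝ y t = inner ℝ y (t - (|R| + 1) • e) + (|R| + 1) * ‖y‖ := by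
      rw [inner_sub_right, inner_smul_right, hey]; ring
    have h4 : -‖y‖ ≤ inner ℝ y (t - (|R| + 1) • e) := by
      have := neg_le_of_abs_le (abs_real_inner_le_norm y (t - (|R| + 1) • e))
      nlinarith
    rw [mul_comm]
    refine mul_le_mul (Real.exp_le_exp.2 ?_) (h t ?_) hε.le (Real.exp_pos _).le
    · have := le_abs_self R
      have := abs_nonneg R
      rw [h3]
      nlinarith
    · rw [mem_closedBall_zero_iff]
      linarith [norm_le_norm_add_norm_sub' t ((|R| + 1) • e)]
  have hb : dx (Metric.ball ((|R| + 1) • e) 1) = dx (Metric.ball 0 1) :=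
    Measure.addHaar_ball_center _ _ _
  calc ε * (dx (Metric.ball 0 1)).toReal * Real.exp (R * ‖y‖)
      = ∫ t in Metric.ball ((|R| + 1) • e) 1, ε * Real.exp (R * ‖y‖) ∂dx := by
        rw [setIntegral_const, Measure.real, hb, smul_eq_mul]; ring
    _ ≤ ∫ t in Metric.ball ((|R| + 1) • e) 1, Real.exp (2 * inner ℝ y t) * μ t ∂dx := by
        refine setIntegral_mono_on ?_ (hμ.int y).integrableOn measurableSet_ball hsub
        exact integrableOn_const measure_ball_lt_top.ne
    _ ≤ sigma μ y := setIntegral_le_integral (hμ.int y)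
        (.of_forall fun t => mul_nonneg (Real.exp_pos _).le (hμ.pos t).le)

theorem sigma_pos (y : R2) : 0 < sigma μ y := by
  obtain ⟨c, hc, h⟩ := hμ.exists_exp_le_sigma 0
  exact lt_of_lt_of_le (by positivity) (h y)

theorem sqrt_sigma_pos (y : R2) : 0 < √(sigma μ y) := Real.sqrt_pos.2 (hμ.sigma_pos y)

theorem sqrt_sigma_ne_zero (y : R2) : (√(sigma μ y) : ℂ) ≠ 0 :=
  Complex.ofReal_ne_zero.2 (hμ.sqrt_sigma_pos y).ne'

theorem exists_exp_div_le (R : ℝ) : ∃ C, ∀ y, Real.exp (R * ‖y‖) / √(sigma μ y) ≤ C := by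
  obtain ⟨c, hc, h⟩ := hμ.exists_exp_le_sigma (2 * R)
  refine ⟨(√c)⁻¹, fun y => ?_⟩
  have h1 : √c * Real.exp (R * ‖y‖) ≤ √(sigma μ y) := by
    refine Real.le_sqrt_of_sq_le ?_
    rw [mul_pow, Real.sq_sqrt hc.le, ← Real.exp_nat_mul]
    convert h y using 3
    push_cast; ring
  rw [div_le_iff₀ (hμ.sqrt_sigma_pos y), ← div_eq_inv_mul, le_div_iff₀ (Real.sqrt_pos.2 hc)]
  linarith

theorem memLp_exp_div (R : ℝ) :
    MemLp (fun y => ((Real.exp (R * ‖y‖) / √(sigma μ y) : ℝ) : ℂ)) 2 dx := by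
  -- The spare `e^{2|y|}` dominates `(1 + |y|)²`, leaving the majorant `(1 + |y|)⁻²`, which is
  -- square integrable in dimension two.
  obtain ⟨C, hC⟩ := hμ.exists_exp_div_le (R + 2)
  have hm : Measurable fun y => ((Real.exp (R * ‖y‖) / √(sigma μ y) : ℝ) : ℂ) := by
    have := hμ.measurable_sigma
    fun_prop
  have h1 : MemLp (fun y : R2 => (1 + ‖y‖) ^ (-(2 : ℝ))) 2 dx := by
    rw [memLp_two_iff_integrable_sq (Measurable.aestronglyMeasurable (by fun_prop))]
    have := integrable_one_add_norm (μ := dx) (r := 4) (by simp; norm_num)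
    refine this.congr (.of_forall fun y => ?_)
    have : 0 ≤ 1 + ‖y‖ := by positivity
    simp only
    rw [← Real.rpow_natCast, ← Real.rpow_mul this]
    norm_num
  refine MemLp.of_le_mul (c := C) h1 hm.aestronglyMeasurable (.of_forall fun y => ?_)
  have hs := hμ.sqrt_sigma_pos y
  have h0 : 0 < 1 + ‖y‖ := by positivity
  rw [Complex.norm_real, Real.norm_of_nonneg (by positivity), Real.norm_of_nonneg (by positivity)]
  have h2 : Real.exp (2 * ‖y‖) ≥ (1 + ‖y‖) ^ 2 := by
    have := Real.add_one_le_exp ‖y‖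
    calc Real.exp (2 * ‖y‖) = Real.exp ‖y‖ ^ 2 := by rw [← Real.exp_nat_mul]; norm_cast
      _ ≥ _ := by gcongr; linarith
  have h3 := hC y
  have h4 : (1 + ‖y‖) ^ (-(2 : ℝ)) = ((1 + ‖y‖) ^ 2)⁻¹ := by
    rw [Real.rpow_neg h0.le]; norm_cast
  rw [h4, ← div_eq_mul_inv, le_div_iff₀ (by positivity)]
  refine le_trans ?_ h3
  rw [add_mul, Real.exp_add, div_mul_eq_mul_div]
  gcongr

end Admissible

end

section

/-! ### Shifting the plane of integration -/

theorem integrable_prod_translate {g : R2 → ℂ} (hg : Continuous g) (hi : Integrable g dx)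
    (e : R2) : Integrable (fun p : R2 × ℝ => g (p.1 + p.2 • e))
      (dx.prod (volume.restrict (Set.Ioc 0 1))) := by
  rw [integrable_prod_iff' (Continuous.aestronglyMeasurable (by fun_prop))]
  refine ⟨.of_forall fun r => hi.comp_add_right (r • e), ?_⟩
  have : ∀ r : ℝ, ∫ x, ‖g (x + r • e)‖ ∂dx = ∫ x, ‖g x‖ ∂dx := fun r =>
    integral_add_right_eq_self (fun x => ‖g x‖) (r • e)
  simp only [this]
  exact integrable_const _

/-- By translation invariance, a horizontal side of a rectangle integrated over all starting points
gives the full plane integral. -/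
theorem integral_intervalIntegral_translate {g : R2 → ℂ} (hg : Continuous g)
    (hi : Integrable g dx) (e : R2) :
    ∫ x, (∫ r in (0 : ℝ)..1, g (x + r • e)) ∂dx = ∫ x, g x ∂dx := by
  simp only [intervalIntegral.integral_of_le zero_le_one]
  rw [integral_integral_swap (integrable_prod_translate hg hi e)]
  have : ∀ r : ℝ, ∫ x, g (x + r • e) ∂dx = ∫ x, g x ∂dx := fun r =>
    integral_add_right_eq_self g (r • e)
  simp [this]

/-- Cauchy's theorem for translates of `ℝ²` in `ℂ²`: it suffices that the function be holomorphic
on complex lines and integrable between the two planes. -/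
theorem integral_cpt_eq_of_lines {F : C2 → ℂ} (hF : Continuous F)
    (hl : ∀ z e : C2, Differentiable ℂ fun ζ : ℂ => F (z + ζ • e)) (t e : R2)
    (h0 : Integrable (fun x => F (cpt x t)) dx) (h1 : Integrable (fun x => F (cpt x (t + e))) dx)
    (hs : ∫⁻ s in Set.Ioc (0 : ℝ) 1, ∫⁻ x, ‖F (cpt x (t + s • e))‖ₑ ∂dx < ⊤) :
    ∫ x, F (cpt x t) ∂dx = ∫ x, F (cpt x (t + e)) ∂dx := by
  have hcont : ∀ t, Continuous fun x => F (cpt x t) := fun t =>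
    hF.comp (continuous_cpt.comp (by fun_prop : Continuous fun x : R2 => (x, t)))
  -- Cauchy's theorem on the unit square in the complex line through `cpt x t` with direction `cpt e
  -- 0`.
  have hrect : ∀ x, (∫ r in (0 : ℝ)..1, F (cpt (x + r • e) t)) -
      (∫ r in (0 : ℝ)..1, F (cpt (x + r • e) (t + e))) +
      Complex.I • (∫ s in (0 : ℝ)..1, F (cpt (x + e) (t + s • e))) -
      Complex.I • (∫ s in (0 : ℝ)..1, F (cpt x (t + s • e))) = 0 := by
    intro x
    have := Complex.integral_boundary_rect_eq_zero_of_differentiableOn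
      (fun ζ => F (cpt x t + ζ • cpt e 0)) 0 (1 + Complex.I) (hl _ _).differentiableOn
    have a1 : ∀ r : ℝ, cpt x t + r • cpt e 0 = cpt (x + r • e) t := fun r => by
      simpa using (cpt_add_line x t e r 0).symm
    have a2 : ∀ r : ℝ, cpt x t + ((r : ℂ) + Complex.I) • cpt e 0 = cpt (x + r • e) (t + e) :=
      fun r => by simpa using (cpt_add_line x t e r 1).symm
    have a3 : ∀ s : ℝ, cpt x t + (1 + (s : ℂ) * Complex.I) • cpt e 0 =
      cpt (x + e) (t + s • e) := fun s => by simpa using (cpt_add_line x t e 1 s).symm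
    have a4 : ∀ s : ℝ, cpt x t + ((s : ℂ) * Complex.I) • cpt e 0 =
      cpt x (t + s • e) := fun s => by simpa using (cpt_add_line x t e 0 s).symm
    simpa [a1, a2, a3, a4] using this
  have hV : Integrable (fun x => ∫ s in (0 : ℝ)..1, F (cpt x (t + s • e))) dx := by
    simp only [intervalIntegral.integral_of_le zero_le_one]
    refine Integrable.integral_prod_left (f := fun p : R2 × ℝ => F (cpt p.1 (t + p.2 • e)))
      ⟨Continuous.aestronglyMeasurable ?_, ?_⟩
    · exact hF.comp (continuous_cpt.comp (by fun_prop :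
        Continuous fun p : R2 × ℝ => (p.1, t + p.2 • e)))
    · rw [HasFiniteIntegral, lintegral_prod_symm]
      · exact hs
      · exact (Continuous.aemeasurable (hF.comp (continuous_cpt.comp (by fun_prop :
          Continuous fun p : R2 × ℝ => (p.1, t + p.2 • e)))).enorm)
  have hH : ∀ t, Integrable (fun x => F (cpt x t)) dx →
      Integrable (fun x => ∫ r in (0 : ℝ)..1, F (cpt (x + r • e) t)) dx := fun t h => by
    simp only [intervalIntegral.integral_of_le zero_le_one]
    exact (integrable_prod_translate (hcont t) h e).integral_prod_left
  -- After integration over `x` the horizontal sides become the two plane integrals. The vertical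
  -- sides are translates of each other by `e` and cancel, so integrability replaces decay at
  -- infinity.
  have key := integral_congr_ae (μ := dx) (.of_forall hrect)
  rw [integral_sub, integral_add, integral_sub (hH _ h0) (hH _ h1), integral_smul, integral_smul,
    integral_add_right_eq_self (fun x => ∫ s in (0 : ℝ)..1, F (cpt x (t + s • e))) e,
    integral_intervalIntegral_translate (hcont t) h0,
    integral_intervalIntegral_translate (hcont (t + e)) h1] at key
  · simpa [sub_eq_zero] using key
  · exact (hH _ h0).sub (hH _ h1)
  · exact (hV.comp_add_right e).smul Complex.I
  · exact ((hH _ h0).sub (hH _ h1)).add ((hV.comp_add_right e).smul Complex.I)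
  · exact hV.smul Complex.I

/-! ### The Fourier-Laplace transform as an isometry -/

namespace Admissible

variable {μ : R2 → ℝ} (hμ : Admissible μ) {H : R2 → ℂ}

section

variable (hH : AEStronglyMeasurable H dx)
include hμ hH

theorem aestronglyMeasurable_div : AEStronglyMeasurable (fun y => H y / (√(sigma μ y) : ℂ)) dx := by
  have h := hμ.measurable_sigma
  have h1 : AEStronglyMeasurable (fun y => (√(sigma μ y) : ℂ)⁻¹) dx :=
    (by fun_prop : Measurable fun y => (√(sigma μ y) : ℂ)⁻¹).aestronglyMeasurable
  simp only [div_eq_mul_inv]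
  exact hH.mul h1

/-- By Tonelli the integral over `t` comes first and equals `σ(y)`, which cancels `|√σ(y)|²`. Only
measurability of `H` is assumed, so that the identity can also prove `H` square integrable. -/
theorem lintegral_mul_exp_inner :
    ∫⁻ t, ∫⁻ y, ‖H y / (√(sigma μ y) : ℂ) * (Real.exp (inner ℝ y t) : ℂ)‖ₑ ^ 2 ∂dx
      ∂weightMeasure μ = ∫⁻ y, ‖H y‖ₑ ^ 2 ∂dx := by
  have := hμ.isFiniteMeasure
  rw [lintegral_lintegral_swap]
  · refine lintegral_congr fun y => ?_
    have hs := hμ.sigma_pos y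
    have h1 : ∀ t : R2, ‖H y / (√(sigma μ y) : ℂ) * (Real.exp (inner ℝ y t) : ℂ)‖ₑ ^ 2 =
        ‖H y / (√(sigma μ y) : ℂ)‖ₑ ^ 2 * ENNReal.ofReal (Real.exp (2 * inner ℝ y t)) := by
      intro t
      rw [enorm_mul, mul_pow, ← ofReal_norm (Real.exp _ : ℂ), Complex.norm_real,
        Real.norm_of_nonneg (Real.exp_pos _).le, ← ENNReal.ofReal_pow (Real.exp_pos _).le, ← Real.exp_nat_mul]
      norm_cast
    simp only [h1]
    rw [lintegral_const_mul _ (by fun_prop), ← hμ.ofReal_sigma, ← enorm_pow, div_pow, ← ofReal_norm,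
      ← ENNReal.ofReal_mul (norm_nonneg _), norm_div, norm_pow, ← Complex.ofReal_pow,
      Real.sq_sqrt hs.le, Complex.norm_real, Real.norm_of_nonneg hs.le, div_mul_cancel₀ _ hs.ne',
      ENNReal.ofReal_pow (norm_nonneg _), ofReal_norm]
  · have h1 : AEStronglyMeasurable (fun p : R2 × R2 => H p.2 / (√(sigma μ p.2) : ℂ))
        ((weightMeasure μ).prod dx) := (hμ.aestronglyMeasurable_div hH).comp_snd
    have h2 : AEStronglyMeasurable (fun p : R2 × R2 => (Real.exp (inner ℝ p.2 p.1) : ℂ))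
        ((weightMeasure μ).prod dx) := Continuous.aestronglyMeasurable (by fun_prop)
    exact (h1.mul h2).enorm.pow_const 2

end

variable (hH : MemLp H 2 dx)
include hμ hH

theorem integrable_mul_exp (R : ℝ) :
    Integrable (fun y => H y / (√(sigma μ y) : ℂ) * (Real.exp (R * ‖y‖) : ℂ)) dx := by
  refine (hH.integrable_mul (hμ.memLp_exp_div R)).congr (.of_forall fun y => ?_)
  simp only [Pi.mul_apply]
  push_cast
  ring

theorem continuous_planeE_div : Continuous (planeE fun y => H y / (√(sigma μ y) : ℂ)) :=
  continuous_planeE (hμ.aestronglyMeasurable_div hH.1) (hμ.integrable_mul_exp hH)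

theorem aestronglyMeasurable_mul_exp_inner (t : R2) : AEStronglyMeasurable
    (fun y => H y / (√(sigma μ y) : ℂ) * (Real.exp (inner ℝ y t) : ℂ)) dx :=
  (hμ.aestronglyMeasurable_div hH.1).mul (Continuous.aestronglyMeasurable (by fun_prop))

theorem integrable_mul_exp_inner (t : R2) :
    Integrable (fun y => H y / (√(sigma μ y) : ℂ) * (Real.exp (inner ℝ y t) : ℂ)) dx := by
  refine (hμ.integrable_mul_exp hH ‖t‖).mono (hμ.aestronglyMeasurable_mul_exp_inner hH t)
    (.of_forall fun y => ?_)
  simp only [norm_mul, Complex.norm_real, Real.norm_of_nonneg (Real.exp_pos _).le]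
  gcongr
  exact (real_inner_le_norm _ _).trans (mul_comm _ _).le

theorem memLp_mul_exp_inner (t : R2) :
    MemLp (fun y => H y / (√(sigma μ y) : ℂ) * (Real.exp (inner ℝ y t) : ℂ)) 2 dx := by
  obtain ⟨C, hC⟩ := hμ.exists_exp_div_le ‖t‖
  refine MemLp.of_le_mul (c := C) hH (hμ.aestronglyMeasurable_mul_exp_inner hH t)
    (.of_forall fun y => ?_)
  have hs := hμ.sqrt_sigma_pos y
  simp only [norm_mul, norm_div, Complex.norm_real, Real.norm_of_nonneg (Real.exp_pos _).le,
    Real.norm_of_nonneg hs.le]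
  calc ‖H y‖ / √(sigma μ y) * Real.exp (inner ℝ y t)
      = Real.exp (inner ℝ y t) / √(sigma μ y) * ‖H y‖ := by ring
    _ ≤ Real.exp (‖t‖ * ‖y‖) / √(sigma μ y) * ‖H y‖ := by
        gcongr
        exact (real_inner_le_norm _ _).trans (mul_comm _ _).le
    _ ≤ C * ‖H y‖ := by gcongr; exact hC y

/-- The Fourier-Laplace transform is isometric from `L²(σ(y) dy)` to `L²(μ(t) dx dt)`. -/
theorem lintegral_planeE_div :
    ∫⁻ t, ∫⁻ x, ‖planeE (fun y => H y / (√(sigma μ y) : ℂ)) (cpt x t)‖ₑ ^ 2 ∂dx ∂weightMeasure μ =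
      ∫⁻ y, ‖H y‖ₑ ^ 2 ∂dx := by
  rw [← hμ.lintegral_mul_exp_inner hH.1]
  exact lintegral_congr fun t =>
    lintegral_planeE (hμ.integrable_mul_exp_inner hH t) (hμ.memLp_mul_exp_inner hH t)

end Admissible

end

section

/-! ### Entire functions that are square integrable with weight `μ` -/

/-- By Tonelli, the path integrals integrated over `t` in a ball are at most the integral of `M`
over the ball enlarged by `‖e‖`. This supplies the finiteness along the segment that Cauchy's
theorem needs. -/
theorem ae_lintegral_path_lt_top {M : R2 → ENNReal} (hM : Measurable M)
    (hfin : ∀ R : ℝ, ∫⁻ t in Metric.ball 0 R, M t ∂dx < ⊤) (e : R2) :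
    ∀ᵐ t ∂dx, ∫⁻ s in Set.Ioc (0 : ℝ) 1, M (t + s • e) < ⊤ := by
  have hmeas : Measurable fun p : R2 × ℝ => M (p.1 + p.2 • e) := hM.comp (by fun_prop)
  have h1 : ∀ n : ℕ, ∀ᵐ t ∂dx.restrict (Metric.ball 0 n),
      ∫⁻ s in Set.Ioc (0 : ℝ) 1, M (t + s • e) < ⊤ := by
    intro n
    refine ae_lt_top hmeas.lintegral_prod_right' (ne_of_lt ?_)
    rw [lintegral_lintegral_swap hmeas.aemeasurable]
    calc ∫⁻ s in Set.Ioc (0 : ℝ) 1, ∫⁻ t in Metric.ball 0 n, M (t + s • e) ∂dx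
        ≤ ∫⁻ s in Set.Ioc (0 : ℝ) 1, ∫⁻ t in Metric.ball 0 (n + ‖e‖), M t ∂dx := by
          refine setLIntegral_mono' measurableSet_Ioc fun s hs => ?_
          rw [← lintegral_indicator measurableSet_ball, ← lintegral_indicator measurableSet_ball,
            
            ← lintegral_add_right_eq_self ((Metric.ball 0 (n + ‖e‖)).indicator M) (s • e)]
          refine lintegral_mono fun t => ?_
          by_cases ht : t ∈ Metric.ball (0 : R2) n
          · have h3 : t + s • e ∈ Metric.ball (0 : R2) (n + ‖e‖) := by
              rw [mem_ball_zero_iff] at ht ⊢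
              have h4 : ‖s • e‖ ≤ ‖e‖ := by
                rw [norm_smul, Real.norm_of_nonneg hs.1.le]
                exact mul_le_of_le_one_left (norm_nonneg e) hs.2
              linarith [norm_add_le t (s • e)]
            simp only [ht, h3, Set.indicator_of_mem, le_refl]
          · simp [ht]
      _ = ∫⁻ t in Metric.ball 0 (n + ‖e‖), M t ∂dx := by simp
      _ < ⊤ := hfin _
  have h2 := (ae_restrict_iUnion_iff (fun n : ℕ => Metric.ball (0 : R2) n) _).2 h1
  rwa [Metric.iUnion_ball_nat, Measure.restrict_univ] at h2

theorem mul_le_sq_add_sq (a b : ENNReal) : a * b ≤ a ^ 2 + b ^ 2 := by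
  rcases le_total a b with h | h
  · exact (mul_le_mul_left h b).trans (by rw [← sq]; exact le_add_self)
  · exact (mul_le_mul_right h a).trans (by rw [← sq]; exact le_self_add)

theorem continuous_expC_comp {X : Type*} [TopologicalSpace X] {f : X → R2} {g : X → C2}
    (hf : Continuous f) (hg : Continuous g) : Continuous fun x => expC (f x) (g x) :=
  continuous_expC.comp (hf.prodMk hg)

/-! ### Entire test functions from indicators of compact sets -/

/-- The Fourier-Laplace transform of the indicator of `K`, reflected. -/
def testE (K : Set R2) (z : C2) : ℂ := ∫ y in K, expC y (-z) ∂dx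

theorem neg_cpt (x t : R2) : -cpt x t = cpt (-x) (-t) := by
  ext i
  fin_cases i <;> simp [cpt] <;> ring

theorem conj_expC_neg (y x t : R2) :
    (starRingEnd ℂ) (expC y (-cpt x t)) = expC y (cpt x (-t)) := by
  rw [neg_cpt, expC_cpt, expC_cpt, map_mul, Complex.conj_ofReal, ← Complex.exp_conj]
  simp

variable {K : Set R2} (hK : IsCompact K)
include hK

/-- The reflection makes `testE` holomorphic in `z`, while its conjugate on the slice at height `t`
is a Fourier-Laplace transform at height `-t`. Hence an `L²` pairing with that transform is the
integral of a holomorphic product, to which Cauchy's theorem applies. -/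
theorem conj_testE (x t : R2) :
    (starRingEnd ℂ) (testE K (cpt x t)) = planeE (K.indicator 1) (cpt x (-t)) := by
  rw [testE, ← integral_conj, planeE, ← integral_indicator hK.measurableSet]
  refine integral_congr_ae (.of_forall fun y => ?_)
  by_cases hy : y ∈ K <;> simp [hy, conj_expC_neg]

theorem memLp_indicator_exp (t : R2) (p : ENNReal) :
    MemLp (fun y => K.indicator (1 : R2 → ℂ) y * (Real.exp (inner ℝ y t) : ℂ)) p dx := by
  have : (fun y => K.indicator (1 : R2 → ℂ) y * (Real.exp (inner ℝ y t) : ℂ)) =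
      K.indicator fun y => (Real.exp (inner ℝ y t) : ℂ) := by
    ext y
    by_cases hy : y ∈ K <;> simp [hy]
  rw [this, memLp_indicator_iff_restrict hK.measurableSet]
  have := isFiniteMeasure_restrict.2 (hK.measure_lt_top (μ := dx)).ne
  have hc : Continuous fun y : R2 => (Real.exp (inner ℝ y t) : ℂ) := by fun_prop
  obtain ⟨C, hC⟩ := hK.exists_bound_of_continuousOn hc.continuousOn
  exact MemLp.of_bound hc.aestronglyMeasurable C
    ((ae_restrict_iff' hK.measurableSet).2 (.of_forall hC))

theorem memLp_conj_testE (t : R2) :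
    MemLp (fun x => (starRingEnd ℂ) (testE K (cpt x t))) 2 dx := by
  simp only [conj_testE hK]
  exact memLp_planeE (memLp_one_iff_integrable.1 (memLp_indicator_exp hK _ 1))
    (memLp_indicator_exp hK _ 2)

theorem exists_expC_le (R : ℝ) : ∃ C, ∀ y ∈ K, ∀ z, ‖z‖ ≤ R → ‖expC y z‖ ≤ C := by
  obtain ⟨C, hC⟩ := hK.exists_bound_of_continuousOn (continuous_norm.continuousOn (s := K))
  refine ⟨Real.exp (R * C), fun y hy z hz => (norm_expC_le y z).trans (Real.exp_le_exp.2 ?_)⟩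
  have := hC y hy
  rw [norm_norm] at this
  have := norm_nonneg y
  gcongr
  exact (norm_nonneg z).trans hz

theorem continuous_testE : Continuous (testE K) := by
  have := isFiniteMeasure_restrict.2 (hK.measure_lt_top (μ := dx)).ne
  refine continuous_iff_continuousAt.2 fun z₀ => ?_
  obtain ⟨C, hC⟩ := exists_expC_le hK (‖z₀‖ + 1)
  refine continuousAt_of_dominated (bound := fun _ => C) (.of_forall fun z =>
    (continuous_expC.comp (by fun_prop : Continuous fun y : R2 => (y, -z))).aestronglyMeasurable)
    ?_ (integrable_const _) (.of_forall fun y =>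
      ((differentiable_expC y).continuous.comp continuous_neg).continuousAt)
  filter_upwards [Metric.ball_mem_nhds z₀ one_pos] with z hz
  refine (ae_restrict_iff' hK.measurableSet).2 (.of_forall fun y hy => hC y hy _ ?_)
  have : ‖z - z₀‖ < 1 := by simpa [dist_eq_norm] using hz
  rw [norm_neg]
  linarith [norm_le_norm_add_norm_sub' z z₀]

theorem memLp_testE (t : R2) : MemLp (fun x => testE K (cpt x t)) 2 dx := by
  refine (memLp_conj_testE hK t).star.congr_norm ?_ (.of_forall fun x => by simp)
  exact ((continuous_testE hK).comp (continuous_cpt.comp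
    (by fun_prop : Continuous fun x : R2 => (x, t)))).aestronglyMeasurable

theorem differentiable_testE_line (z e : C2) :
    Differentiable ℂ fun ζ : ℂ => testE K (z + ζ • e) := by
  have := isFiniteMeasure_restrict.2 (hK.measure_lt_top (μ := dx)).ne
  refine differentiable_integral_of_dominated (f := fun y ζ => expC y (-(z + ζ • e))) ?_ ?_ ?_
  · exact continuous_expC_comp continuous_fst (by fun_prop)
  · intro y
    unfold expC
    simp only [PiLp.neg_apply, PiLp.add_apply, PiLp.smul_apply, smul_eq_mul]
    fun_prop
  · intro R
    obtain ⟨C, hC⟩ := exists_expC_le hK (‖z‖ + R * ‖e‖)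
    refine ⟨fun _ => C, integrable_const _, (ae_restrict_iff' hK.measurableSet).2
      (.of_forall fun y hy ζ hζ => hC y hy _ ?_)⟩
    rw [norm_neg]
    refine (norm_add_le _ _).trans ?_
    rw [norm_smul]
    have := norm_nonneg e
    gcongr

/-- Plancherel turns the slice norm into the integral of `e^{-2y·t}` over the compact set `K`,
bounded uniformly for bounded `t`. -/
theorem exists_lintegral_testE_le (R : ℝ) : ∃ C : ENNReal, C < ⊤ ∧ ∀ t : R2, ‖t‖ ≤ R →
    ∫⁻ x, ‖testE K (cpt x t)‖ₑ ^ 2 ∂dx ≤ C := by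
  obtain ⟨C, hC⟩ := hK.exists_bound_of_continuousOn (continuous_norm.continuousOn (s := K))
  refine ⟨∫⁻ y in K, ENNReal.ofReal (Real.exp (C * R)) ^ 2 ∂dx, ?_, fun t ht => ?_⟩
  · rw [setLIntegral_const]
    exact ENNReal.mul_lt_top (ENNReal.pow_lt_top ENNReal.ofReal_lt_top) hK.measure_lt_top
  · have h1 : ∀ x, ‖testE K (cpt x t)‖ₑ = ‖planeE (K.indicator 1) (cpt x (-t))‖ₑ := fun x => by
      rw [← conj_testE hK, ← ofReal_norm, ← ofReal_norm, RCLike.norm_conj]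
    simp only [h1]
    rw [lintegral_planeE (memLp_one_iff_integrable.1 (memLp_indicator_exp hK _ 1))
      (memLp_indicator_exp hK _ 2), ← lintegral_indicator hK.measurableSet]
    refine lintegral_mono fun y => ?_
    by_cases hy : y ∈ K
    · have h2 := hC y hy
      rw [norm_norm] at h2
      simp only [hy, Set.indicator_of_mem, Pi.one_apply, one_mul]
      rw [← ofReal_norm, Complex.norm_real, Real.norm_of_nonneg (Real.exp_pos _).le]
      gcongr
      refine (real_inner_le_norm _ _).trans ?_
      rw [norm_neg]
      exact mul_le_mul h2 ht (norm_nonneg t) ((norm_nonneg y).trans h2)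
    · simp [hy]

/-- Plancherel's formula for the pairing with `testE`. -/
theorem integral_mul_testE {g : R2 → ℂ} (hg : MemLp g 2 dx) (t : R2) :
    ∫ x, g x * testE K (cpt x t) ∂dx =
      ∫ y in K, fourierDx.symm (hg.toLp g) y * (Real.exp (-inner ℝ y t) : ℂ) ∂dx := by
  have hI := memLp_indicator_exp hK (-t) 2
  have e1 : inner ℂ (fourierDx (hI.toLp _)) (hg.toLp g) = ∫ x, g x * testE K (cpt x t) ∂dx := by
    rw [L2.inner_def]
    refine integral_congr_ae ?_
    filter_upwards [fourierDx_planeE (memLp_one_iff_integrable.1 (memLp_indicator_exp hK _ 1)) hI,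
      hg.coeFn_toLp] with x hx hx'
    rw [hx, hx', ← conj_testE hK, RCLike.inner_apply, RCLike.conj_conj]
  have e2 : inner ℂ (fourierDx (hI.toLp _)) (hg.toLp g) =
      inner ℂ (hI.toLp _) (fourierDx.symm (hg.toLp g)) := by
    rw [← LinearIsometryEquiv.inner_map_map fourierDx (hI.toLp _),
      LinearIsometryEquiv.apply_symm_apply]
  rw [← e1, e2, L2.inner_def, ← integral_indicator hK.measurableSet]
  refine integral_congr_ae ?_
  filter_upwards [hI.coeFn_toLp] with y hy
  rw [hy, RCLike.inner_apply]
  by_cases hyK : y ∈ K <;> simp [hyK, -Complex.ofReal_exp, Complex.conj_ofReal]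

end

/-! ### Comparison of slices and the Paley-Wiener type representation -/

/-- The square of the `L²` norm of the slice `x ↦ G(x + i t)`. -/
def sliceNorm (G : C2 → ℂ) (t : R2) : ENNReal := ∫⁻ x, ‖G (cpt x t)‖ₑ ^ 2 ∂dx

theorem continuous_slice {G : C2 → ℂ} (hG : Continuous G) (t : R2) :
    Continuous fun x => G (cpt x t) :=
  hG.comp (continuous_cpt.comp (by fun_prop : Continuous fun x : R2 => (x, t)))

theorem memLp_slice {G : C2 → ℂ} (hG : Continuous G) {t : R2} (ht : sliceNorm G t < ⊤) :
    MemLp (fun x => G (cpt x t)) 2 dx :=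
  (memLp_two_iff (continuous_slice hG t).aestronglyMeasurable).2 ht

theorem measurable_sliceNorm {G : C2 → ℂ} (hG : Continuous G) : Measurable (sliceNorm G) := by
  refine Measurable.lintegral_prod_right' (f := fun p : R2 × R2 => ‖G (cpt p.2 p.1)‖ₑ ^ 2) ?_
  exact ((hG.comp (continuous_cpt.comp continuous_swap)).enorm.measurable.pow_const 2)

theorem Admissible.lintegral_ball_lt_top {μ : R2 → ℝ} (hμ : Admissible μ) {M : R2 → ENNReal}
    (h : ∫⁻ t, M t ∂weightMeasure μ < ⊤) (R : ℝ) : ∫⁻ t in Metric.ball 0 R, M t ∂dx < ⊤ := by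
  obtain ⟨ε, hε, hle⟩ := hμ.loc.exists_le_of_isCompact (isCompact_closedBall (0 : R2) R)
  rw [hμ.lintegral_weightMeasure] at h
  have h1 : ENNReal.ofReal ε * ∫⁻ t in Metric.ball 0 R, M t ∂dx < ⊤ := by
    rw [← lintegral_const_mul' _ _ ENNReal.ofReal_ne_top]
    refine lt_of_le_of_lt ?_ h
    refine (setLIntegral_mono' measurableSet_ball fun t ht => ?_).trans
      (setLIntegral_le_lintegral _ _)
    gcongr
    exact hle t (Metric.ball_subset_closedBall ht)
  by_contra hcon
  rw [not_lt, top_le_iff] at hcon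
  rw [hcon, ENNReal.mul_top (by simpa using hε)] at h1
  exact lt_irrefl _ h1

/-- The Fourier transforms of two slices of a line-holomorphic function differ by an exponential
factor. -/
theorem fourier_slice_eq {G : C2 → ℂ} (hG : Continuous G)
    (hl : ∀ z e : C2, Differentiable ℂ fun ζ : ℂ => G (z + ζ • e)) {t e : R2}
    (h0 : MemLp (fun x => G (cpt x t)) 2 dx) (h1 : MemLp (fun x => G (cpt x (t + e))) 2 dx)
    (hs : ∫⁻ s in Set.Ioc (0 : ℝ) 1, sliceNorm G (t + s • e) < ⊤) :
    (fun y => fourierDx.symm (h0.toLp _) y * (Real.exp (-inner ℝ y t) : ℂ)) =ᵐ[dx]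
      fun y => fourierDx.symm (h1.toLp _) y * (Real.exp (-inner ℝ y (t + e)) : ℂ) := by
  have hli : ∀ (g : Lp ℂ 2 dx) (t : R2),
      LocallyIntegrable (fun y => g y * (Real.exp (-inner ℝ y t) : ℂ)) dx := fun g t =>
    ((Lp.memLp g).locallyIntegrable (by norm_num)).mul_continuous (by fun_prop)
  rw [← sub_ae_eq_zero]
  -- Equality is tested by integrating over compact sets `K`. Plancherel turns each side into the
  -- integral of `G · testE K` over a slice, and these two integrals agree by Cauchy's theorem.
  refine ae_eq_zero_of_forall_setIntegral_isCompact_eq_zero' ((hli _ t).sub (hli _ (t + e)))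
    fun K hK => ?_
  have hi : ∀ (g : Lp ℂ 2 dx) (t : R2),
      Integrable (fun y => g y * (Real.exp (-inner ℝ y t) : ℂ)) (dx.restrict K) := fun g t =>
    (hli g t).integrableOn_isCompact hK
  simp only [Pi.sub_apply]
  rw [integral_sub (hi _ _) (hi _ _), ← integral_mul_testE hK, ← integral_mul_testE hK, sub_eq_zero]
  refine integral_cpt_eq_of_lines (F := fun z => G z * testE K z) (hG.mul (continuous_testE hK))
    (fun z e => (hl z e).mul (differentiable_testE_line hK z e)) t e
    (h0.integrable_mul (memLp_testE hK t)) (h1.integrable_mul (memLp_testE hK (t + e))) ?_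
  -- Integrability over the strip: the product is at most the sum of the squares, one controlled by
  -- `hs`, the other by the uniform bound `C`.
  obtain ⟨C, hC, hCle⟩ := exists_lintegral_testE_le hK (‖t‖ + ‖e‖)
  calc ∫⁻ s in Set.Ioc (0 : ℝ) 1, ∫⁻ x, ‖G (cpt x (t + s • e)) * testE K (cpt x (t + s • e))‖ₑ ∂dx
      ≤ ∫⁻ s in Set.Ioc (0 : ℝ) 1, (sliceNorm G (t + s • e) + C) := by
        refine setLIntegral_mono' measurableSet_Ioc fun s hs => ?_
        have hb : ‖t + s • e‖ ≤ ‖t‖ + ‖e‖ := by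
          refine (norm_add_le _ _).trans ?_
          rw [norm_smul, Real.norm_of_nonneg hs.1.le]
          linarith [mul_le_of_le_one_left (norm_nonneg e) hs.2]
        refine le_trans ?_ (add_le_add_right (hCle _ hb) _)
        rw [sliceNorm, ← lintegral_add_left
          (((continuous_slice hG _).enorm.measurable).pow_const 2)]
        refine lintegral_mono fun x => ?_
        rw [enorm_mul]
        exact mul_le_sq_add_sq _ _
    _ = (∫⁻ s in Set.Ioc (0 : ℝ) 1, sliceNorm G (t + s • e)) + C := by
        rw [lintegral_add_right _ measurable_const]
        simp
    _ < ⊤ := ENNReal.add_lt_top.2 ⟨hs, hC⟩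

/-- A line-holomorphic function on `ℂ²` in `L²(μ(t) dx dt)` is the Fourier-Laplace transform of a
function in `L²(σ(y) dy)`. -/
theorem Admissible.exists_planeE_eq {μ : R2 → ℝ} (hμ : Admissible μ) {G : C2 → ℂ}
    (hG : Continuous G) (hl : ∀ z e : C2, Differentiable ℂ fun ζ : ℂ => G (z + ζ • e))
    (hfin : ∫⁻ t, sliceNorm G t ∂weightMeasure μ < ⊤) :
    ∃ H : R2 → ℂ, MemLp H 2 dx ∧ G = planeE fun y => H y / (√(sigma μ y) : ℂ) := by
  have hM := measurable_sliceNorm hG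
  have hball := hμ.lintegral_ball_lt_top hfin
  have hpath := ae_lintegral_path_lt_top hM hball
  have hae : ∀ᵐ t ∂dx, sliceNorm G t < ⊤ := by
    -- For `e = 0` the path is constant, and the path integral is the slice norm itself.
    filter_upwards [hpath 0] with t ht
    simpa using ht
  -- Exchanging the quantifiers yields one base height `t₀` from which almost every displacement is
  -- admissible.
  have hswap : ∀ᵐ t ∂dx, ∀ᵐ e ∂dx,
      ∫⁻ s in Set.Ioc (0 : ℝ) 1, sliceNorm G (t + s • e) < ⊤ := by
    refine (Measure.ae_ae_comm ?_).1 (.of_forall hpath)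
    refine measurableSet_lt ?_ measurable_const
    exact Measurable.lintegral_prod_right'
      (f := fun p : (R2 × R2) × ℝ => sliceNorm G (p.1.2 + p.2 • p.1.1)) (hM.comp (by fun_prop))
  obtain ⟨t₀, ht₀, hpath₀⟩ := (hae.and hswap).exists
  have h₀ := memLp_slice hG ht₀
  -- The candidate density: the inverse Fourier transform of the slice at `t₀`, stripped of the
  -- factor `e^{y·t₀}`. The comparison of slices shows that almost every other height gives the same
  -- function.
  set k : R2 → ℂ := fun y => fourierDx.symm (h₀.toLp _) y * (Real.exp (-inner ℝ y t₀) : ℂ) with hk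
  have hkm : AEStronglyMeasurable k dx :=
    (Lp.aestronglyMeasurable _).mul (Continuous.aestronglyMeasurable (by fun_prop))
  set H : R2 → ℂ := fun y => k y * (√(sigma μ y) : ℂ) with hH
  have hHk : ∀ y, H y / (√(sigma μ y) : ℂ) = k y := fun y =>
    mul_div_cancel_right₀ _ (hμ.sqrt_sigma_ne_zero y)
  have hHm : AEStronglyMeasurable H dx := by
    have := hμ.measurable_sigma
    exact hkm.mul (by fun_prop : Measurable fun y => (√(sigma μ y) : ℂ)).aestronglyMeasurable
  have hslice : ∀ᵐ t ∂dx, ∃ h : MemLp (fun x => G (cpt x t)) 2 dx,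
      fourierDx.symm (h.toLp _) =ᵐ[dx] fun y => k y * (Real.exp (inner ℝ y t) : ℂ) := by
    have h1 : ∀ᵐ e ∂dx, ∃ h : MemLp (fun x => G (cpt x (t₀ + e))) 2 dx,
        fourierDx.symm (h.toLp _) =ᵐ[dx] fun y => k y * (Real.exp (inner ℝ y (t₀ + e)) : ℂ) := by
      filter_upwards [hpath₀, (measurePreserving_add_left dx t₀).quasiMeasurePreserving.ae hae]
        with e he hm
      have h := memLp_slice hG hm
      refine ⟨h, ?_⟩
      filter_upwards [fourier_slice_eq hG hl h₀ h he] with y hy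
      rw [hk]
      simp only
      rw [hy, mul_assoc, ← Complex.ofReal_mul, ← Real.exp_add]
      simp
    have h2 := (measurePreserving_add_left dx (-t₀)).quasiMeasurePreserving.ae h1
    filter_upwards [h2] with t ht
    rwa [add_neg_cancel_left] at ht
  have hac : weightMeasure μ ≪ dx := withDensity_absolutelyContinuous _ _
  have hHL : MemLp H 2 dx := by
    -- The isometry identity is read backwards: the norm of `H` becomes the weighted integral of the
    -- slice norms of `G`.
    rw [memLp_two_iff hHm, ← hμ.lintegral_mul_exp_inner hHm]
    refine lt_of_le_of_lt (lintegral_mono_ae ?_) hfin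
    filter_upwards [hac.ae_le hslice] with t ⟨h, ht⟩
    refine le_of_eq ?_
    calc ∫⁻ y, ‖H y / (√(sigma μ y) : ℂ) * (Real.exp (inner ℝ y t) : ℂ)‖ₑ ^ 2 ∂dx
        = ∫⁻ y, ‖fourierDx.symm (h.toLp _) y‖ₑ ^ 2 ∂dx := by
          refine lintegral_congr_ae ?_
          filter_upwards [ht] with y hy
          rw [hHk, hy]
      _ = ‖h.toLp _‖ₑ ^ 2 := by
          rw [← enorm_sq_eq_lintegral, LinearIsometryEquiv.enorm_map]
      _ = sliceNorm G t := by
          rw [enorm_sq_eq_lintegral]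
          exact lintegral_congr_ae (by filter_upwards [h.coeFn_toLp] with x hx; rw [hx])
  refine ⟨H, hHL, ?_⟩
  have hEc := hμ.continuous_planeE_div hHL
  have hx : ∀ᵐ t ∂dx, ∀ x, G (cpt x t) = planeE (fun y => H y / (√(sigma μ y) : ℂ)) (cpt x t) := by
    filter_upwards [hslice] with t ⟨h, ht⟩
    have e1 : h.toLp _ = fourierDx ((hμ.memLp_mul_exp_inner hHL t).toLp _) := by
      rw [← LinearIsometryEquiv.symm_apply_eq]
      refine Lp.ext ?_
      filter_upwards [ht, (hμ.memLp_mul_exp_inner hHL t).coeFn_toLp] with y hy hy'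
      rw [hy, hy', hHk]
    have e2 : (fun x => G (cpt x t)) =ᵐ[dx]
        fun x => planeE (fun y => H y / (√(sigma μ y) : ℂ)) (cpt x t) := by
      filter_upwards [h.coeFn_toLp, fourierDx_planeE (hμ.integrable_mul_exp_inner hHL t)
        (hμ.memLp_mul_exp_inner hHL t)] with x hx hx'
      rw [← hx, e1, hx']
    exact fun x => congrFun ((Continuous.ae_eq_iff_eq dx (continuous_slice hG t)
      (continuous_slice hEc t)).1 e2) x
  funext z
  have e3 : (fun t => G (cpt (rePart z) t)) =ᵐ[dx]
      fun t => planeE (fun y => H y / (√(sigma μ y) : ℂ)) (cpt (rePart z) t) := by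
    filter_upwards [hx] with t ht using ht _
  have hc : Continuous fun t => cpt (rePart z) t :=
    continuous_cpt.comp (by fun_prop : Continuous fun t : R2 => (rePart z, t))
  have e4 := (Continuous.ae_eq_iff_eq dx (hG.comp hc) (hEc.comp hc)).1 e3
  simpa [cpt_re_im] using congrFun e4 (imPart z)

/-! ### Fourier series on the circle -/

instance fact_two_pi_pos : Fact (0 < 2 * Real.pi) := ⟨Real.two_pi_pos⟩

/-- The identification of `ℝ / 2πℤ` with the circle. -/
def circleEquiv : AddCircle (2 * Real.pi) ≃ₜ Circle :=
  AddCircle.homeomorphCircle Real.two_pi_pos.ne'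

theorem circleEquiv_apply (x : AddCircle (2 * Real.pi)) : circleEquiv x = AddCircle.toCircle x :=
  AddCircle.homeomorphCircle_apply _ x

theorem circleEquiv_coe (x : ℝ) : circleEquiv (x : AddCircle (2 * Real.pi)) = Circle.exp x := by
  rw [circleEquiv_apply, AddCircle.toCircle_apply_mk, div_self Real.two_pi_pos.ne', one_mul]

theorem measurePreserving_circleEquiv :
    MeasurePreserving circleEquiv AddCircle.haarAddCircle dα := by
  refine ⟨circleEquiv.continuous.measurable, ?_⟩
  have h1 := (AddCircle.measurePreserving_mk (2 * Real.pi) (-Real.pi)).map_eq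
  have h2 : -Real.pi + 2 * Real.pi = Real.pi := by ring
  have h3 : (Circle.exp : ℝ → Circle) = circleEquiv ∘ ((↑) : ℝ → AddCircle (2 * Real.pi)) := by
    funext x; exact (circleEquiv_coe x).symm
  rw [h2] at h1
  rw [dα, h3, ← Measure.map_map circleEquiv.continuous.measurable AddCircle.measurable_mk']
  change _ = _ • Measure.map circleEquiv (Measure.map QuotientAddGroup.mk _)
  rw [h1, AddCircle.volume_eq_smul_haarAddCircle, Measure.map_smul, smul_smul,
    ← ENNReal.ofReal_mul (by positivity), inv_mul_cancel₀ Real.two_pi_pos.ne', ENNReal.ofReal_one,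
    one_smul]

instance : IsProbabilityMeasure dα := by
  rw [← measurePreserving_circleEquiv.map_eq]
  exact Measure.isProbabilityMeasure_map circleEquiv.continuous.aemeasurable

instance : dα.IsOpenPosMeasure := by
  rw [← measurePreserving_circleEquiv.map_eq]
  exact circleEquiv.continuous.isOpenPosMeasure_map circleEquiv.surjective

theorem integral_dα (f : Circle → ℂ) :
    ∫ u, f u ∂dα = ∫ x, f (circleEquiv x) ∂AddCircle.haarAddCircle :=
  (measurePreserving_circleEquiv.integral_comp circleEquiv.measurableEmbedding f).symm

theorem integral_dα_eq_intervalIntegral (f : Circle → ℂ) :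
    ∫ u, f u ∂dα = (2 * Real.pi : ℂ)⁻¹ * ∫ θ in (0 : ℝ)..2 * Real.pi, f (Circle.exp θ) := by
  have := AddCircle.intervalIntegral_preimage (2 * Real.pi) 0 fun x => f (circleEquiv x)
  rw [integral_dα, AddCircle.integral_haarAddCircle, ← this, zero_add]
  simp only [circleEquiv_coe, Complex.real_smul]
  push_cast
  rfl

theorem circleEquiv_zpow (x : AddCircle (2 * Real.pi)) (n : ℤ) :
    ((circleEquiv x : Circle) : ℂ) ^ n = fourier n x := by
  rw [fourier_apply, AddCircle.toCircle_zsmul, circleEquiv_apply, Circle.coe_zpow]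

theorem continuous_circle_zpow (n : ℤ) : Continuous fun u : Circle => (u : ℂ) ^ n := by
  have h : Continuous fun u : Circle => (u : ℂ) := by fun_prop
  exact h.zpow₀ n fun u => Or.inl u.coe_ne_zero

theorem norm_circle_zpow (u : Circle) (n : ℤ) : ‖(u : ℂ) ^ n‖ = 1 := by
  rw [← Circle.coe_zpow, Circle.norm_coe]

/-- A square integrable function on the circle with vanishing Fourier coefficients vanishes. -/
theorem ae_eq_zero_of_integral_zpow {A : Circle → ℂ} (hA : MemLp A 2 dα)
    (h : ∀ n : ℤ, ∫ u, (u : ℂ) ^ (-n) * A u ∂dα = 0) : A =ᵐ[dα] 0 := by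
  have hA' := hA.comp_measurePreserving measurePreserving_circleEquiv
  have h0 : hA'.toLp _ = 0 := by
    rw [← fourierBasis.repr.map_eq_zero_iff]
    ext n
    rw [fourierBasis_repr, fourierCoeff_congr_ae hA'.coeFn_toLp]
    simp only [fourierCoeff, ← circleEquiv_zpow, smul_eq_mul]
    exact (integral_dα fun u => (u : ℂ) ^ (-n) * A u).symm.trans (h n)
  have h1 : A ∘ circleEquiv =ᵐ[AddCircle.haarAddCircle] 0 := by
    exact (hA'.toLp_eq_toLp_iff MemLp.zero).1 (h0.trans (MemLp.toLp_zero _).symm)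
  have h2 : ∀ᵐ u ∂(AddCircle.haarAddCircle.map circleEquiv), A u = 0 :=
    (circleEquiv.measurableEmbedding.ae_map_iff).2 h1
  rwa [measurePreserving_circleEquiv.map_eq] at h2

theorem integral_circle_zpow (n : ℤ) : ∫ u : Circle, (u : ℂ) ^ n ∂dα = if n = 0 then 1 else 0 := by
  have := fourierCoeff_fourier (T := 2 * Real.pi) n
  have h2 := congrFun this 0
  rw [fourierCoeff] at h2
  rw [integral_dα]
  simp only [circleEquiv_zpow]
  simp only [neg_zero, fourier_zero, one_smul] at h2
  rw [h2, Pi.single_apply]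
  simp only [eq_comm]

theorem integrable_continuous_dα {f : Circle → ℂ} (hf : Continuous f) : Integrable f dα :=
  hf.integrable_of_hasCompactSupport (HasCompactSupport.of_compactSpace f)

theorem memLp_continuous_dα {f : Circle → ℂ} (hf : Continuous f) : MemLp f 2 dα :=
  hf.memLp_of_hasCompactSupport (HasCompactSupport.of_compactSpace f)

theorem continuous_tsum_zpow {b : ℤ → ℂ} (hb : Summable fun n => ‖b n‖) :
    Continuous fun u : Circle => ∑' n, b n * (u : ℂ) ^ n :=
  continuous_tsum (fun n => continuous_const.mul (continuous_circle_zpow n)) hb fun n u => by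
    rw [norm_mul, norm_circle_zpow, mul_one]

theorem summable_mul_zpow {b : ℤ → ℂ} (hb : Summable fun n => ‖b n‖) (u : Circle) :
    Summable fun n => b n * (u : ℂ) ^ n :=
  Summable.of_norm (by simpa only [norm_mul, norm_circle_zpow, mul_one] using hb)

/-- Termwise integration of an absolutely convergent Fourier series against an integrable
function. -/
theorem hasSum_integral_tsum_mul {b : ℤ → ℂ} (hb : Summable fun n => ‖b n‖) {g : Circle → ℂ}
    (hg : Integrable g dα) :
    HasSum (fun n => b n * ∫ u, (u : ℂ) ^ n * g u ∂dα)
      (∫ u, (∑' n, b n * (u : ℂ) ^ n) * g u ∂dα) := by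
  have hint : ∀ n, Integrable (fun u : Circle => b n * (u : ℂ) ^ n * g u) dα := fun n => by
    refine hg.bdd_mul (c := ‖b n‖)
      (continuous_const.mul (continuous_circle_zpow n)).aestronglyMeasurable (.of_forall fun u => ?_)
    rw [norm_mul, norm_circle_zpow, mul_one]
  have := hasSum_integral_of_summable_integral_norm (μ := dα)
    (F := fun n (u : Circle) => b n * (u : ℂ) ^ n * g u) hint ?_
  · simpa only [mul_assoc, integral_const_mul, tsum_mul_right, ← (summable_mul_zpow hb _).tsum_mul_right]
      using this
  · refine (hb.mul_right (∫ u, ‖g u‖ ∂dα)).congr fun n => ?_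
    simp only [norm_mul, norm_circle_zpow, mul_one]
    rw [integral_const_mul]

theorem integral_tsum_mul_zpow {b : ℤ → ℂ} (hb : Summable fun n => ‖b n‖) (m : ℤ) :
    ∫ u : Circle, (u : ℂ) ^ (-m) * ∑' n, b n * (u : ℂ) ^ n ∂dα = b m := by
  have h := hasSum_integral_tsum_mul hb (integrable_continuous_dα (continuous_circle_zpow (-m)))
  have h1 : ∀ n, b n * ∫ u : Circle, (u : ℂ) ^ n * (u : ℂ) ^ (-m) ∂dα = if n = m then b m else 0 := by
    intro n
    have : ∀ u : Circle, (u : ℂ) ^ n * (u : ℂ) ^ (-m) = (u : ℂ) ^ (n - m) := fun u => by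
      rw [← zpow_add₀ u.coe_ne_zero, sub_eq_add_neg]
    simp only [this, integral_circle_zpow, sub_eq_zero]
    split_ifs with hn <;> simp [hn]
  simp only [h1] at h
  simp only [mul_comm (_ ^ (-m))]
  exact h.unique (hasSum_ite_eq m (b m))

/-- Parseval's formula for absolutely convergent Fourier series. -/
theorem hasSum_parseval {b d : ℤ → ℂ} (hb : Summable fun n => ‖b n‖)
    (hd : Summable fun n => ‖d n‖) :
    HasSum (fun n => b n * (starRingEnd ℂ) (d n))
      (∫ u : Circle, (∑' n, b n * (u : ℂ) ^ n) * (starRingEnd ℂ) (∑' n, d n * (u : ℂ) ^ n) ∂dα) := by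
  have hg : Continuous fun u : Circle => (starRingEnd ℂ) (∑' n, d n * (u : ℂ) ^ n) :=
    Complex.continuous_conj.comp (continuous_tsum_zpow hd)
  have e : ∀ n, ∫ u : Circle, (u : ℂ) ^ n * (starRingEnd ℂ) (∑' m, d m * (u : ℂ) ^ m) ∂dα =
      (starRingEnd ℂ) (d n) := fun n => by
    rw [← integral_tsum_mul_zpow hd n]
    refine Eq.trans (integral_congr_ae (.of_forall fun u => ?_)) integral_conj
    simp only [map_mul, map_zpow₀, ← Circle.coe_inv_eq_conj, Circle.coe_inv, inv_zpow', neg_neg]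
  simpa only [e] using hasSum_integral_tsum_mul hb (integrable_continuous_dα hg)

theorem lintegral_parseval {b : ℤ → ℂ} (hb : Summable fun n => ‖b n‖) :
    ∫⁻ u : Circle, ‖∑' n, b n * (u : ℂ) ^ n‖ₑ ^ 2 ∂dα = ∑' n, ‖b n‖ₑ ^ 2 := by
  have h := hasSum_parseval hb hb
  simp only [Complex.mul_conj, Complex.normSq_eq_norm_sq] at h
  rw [integral_complex_ofReal, Complex.hasSum_ofReal] at h
  have h1 : ∀ z : ℂ, ‖z‖ₑ ^ 2 = ENNReal.ofReal (‖z‖ ^ 2) := fun z => by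
    rw [ENNReal.ofReal_pow (norm_nonneg _), ofReal_norm]
  simp only [h1]
  rw [← ENNReal.ofReal_tsum_of_nonneg (fun n => by positivity) h.summable, h.tsum_eq,
    ofReal_integral_eq_lintegral_ofReal _ (.of_forall fun u => by positivity)]
  have hc := ((continuous_tsum_zpow hb).norm.pow 2)
  exact hc.integrable_of_hasCompactSupport (HasCompactSupport.of_compactSpace _)

section

/-! ### Laurent series on `ℂ*` -/

theorem summable_two_inv_pow_natAbs : Summable fun n : ℤ => ((2 : ℝ)⁻¹) ^ n.natAbs := by
  have h : Summable fun n : ℕ => ((2 : ℝ)⁻¹) ^ n :=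
    summable_geometric_of_lt_one (by norm_num) (by norm_num)
  exact Summable.of_nat_of_neg (by simpa using h) (by simpa using h)

/-- Treats both signs of `n` at once; at a single point it is applied with `A = max ‖w‖ ‖w‖⁻¹`. -/
theorem zpow_le_pow_natAbs {x A : ℝ} (hx : 0 < x) (h1 : x ≤ A) (h2 : x⁻¹ ≤ A) (n : ℤ) :
    x ^ n ≤ A ^ n.natAbs := by
  rcases Int.natAbs_eq n with h | h
  · conv_lhs => rw [h]
    rw [zpow_natCast]
    gcongr
  · conv_lhs => rw [h]
    rw [zpow_neg, zpow_natCast, ← inv_pow]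
    gcongr

/-- The Laurent coefficients of a function on `ℂ*`. -/
def laurentCoeff (g : ℂ → ℂ) (n : ℤ) : ℂ := ∫ u : Circle, (u : ℂ) ^ (-n) * g u ∂dα

section Laurent

variable {g : ℂ → ℂ} (hg : DifferentiableOn ℂ g {0}ᶜ)

theorem circleIntegral_zpow_mul (g : ℂ → ℂ) {r : ℝ} (hr : 0 < r) (n : ℤ) :
    (∮ z in C(0, r), z ^ (-n - 1) * g z) =
      2 * Real.pi * Complex.I * ((r : ℂ) ^ (-n) * ∫ u : Circle, (u : ℂ) ^ (-n) * g (r * u) ∂dα) := by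
  have hr' : (r : ℂ) ≠ 0 := Complex.ofReal_ne_zero.2 hr.ne'
  have hpi : (2 * Real.pi : ℂ) ≠ 0 := by exact_mod_cast Real.two_pi_pos.ne'
  have h : ∀ θ : ℝ, deriv (circleMap 0 r) θ • (circleMap 0 r θ ^ (-n - 1) * g (circleMap 0 r θ)) =
      Complex.I * (r : ℂ) ^ (-n) * ((Circle.exp θ : ℂ) ^ (-n) * g (r * Circle.exp θ)) := by
    intro θ
    have h1 : circleMap 0 r θ = r * Circle.exp θ := by simp [circleMap]
    have h2 : (r * Circle.exp θ : ℂ) ≠ 0 := mul_ne_zero hr' (Circle.coe_ne_zero _)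
    rw [deriv_circleMap, h1, zpow_sub_one₀ h2, mul_zpow, smul_eq_mul]
    field_simp
  rw [circleIntegral, integral_dα_eq_intervalIntegral]
  simp only [h]
  rw [intervalIntegral.integral_const_mul]
  field_simp

include hg

theorem continuous_circle_dilate {r : ℝ} (hr : 0 < r) :
    Continuous fun u : Circle => g (r * u) :=
  hg.continuousOn.comp_continuous (by fun_prop) fun u =>
    mul_ne_zero (Complex.ofReal_ne_zero.2 hr.ne') (Circle.coe_ne_zero _)

/-- `z^{-n-1} g(z)` is holomorphic on every annulus about `0`, so its contour integral does not
depend on the radius; the circle of radius `r` is compared with the unit circle. -/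
theorem integral_circle_dilate {r : ℝ} (hr : 0 < r) (n : ℤ) :
    ∫ u : Circle, (u : ℂ) ^ (-n) * g (r * u) ∂dα = laurentCoeff g n * (r : ℂ) ^ n := by
  have hd : DifferentiableOn ℂ (fun z : ℂ => z ^ (-n - 1) * g z) {0}ᶜ := fun z hz =>
    (differentiableAt_zpow.2 (Or.inl hz)).differentiableWithinAt.mul (hg z hz)
  have key : ∀ a b : ℝ, 0 < a → a ≤ b →
      (∮ z in C(0, b), z ^ (-n - 1) * g z) = ∮ z in C(0, a), z ^ (-n - 1) * g z := by
    intro a b ha hab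
    refine Complex.circleIntegral_eq_of_differentiable_on_annulus_off_countable ha hab
      Set.countable_empty (hd.continuousOn.mono fun z hz => ?_) fun z hz => ?_
    · rintro rfl
      exact hz.2 (by simpa using ha)
    · refine hd.differentiableAt (isOpen_compl_singleton.mem_nhds ?_)
      rintro rfl
      exact hz.1.2 (by simpa using ha.le)
  have h1 : (∮ z in C(0, r), z ^ (-n - 1) * g z) = ∮ z in C(0, 1), z ^ (-n - 1) * g z := by
    rcases le_total r 1 with h | h
    · exact (key _ _ hr h).symm
    · exact key _ _ one_pos h
  rw [circleIntegral_zpow_mul g hr, circleIntegral_zpow_mul g one_pos] at h1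
  have h2 := mul_left_cancel₀ Complex.two_pi_I_ne_zero h1
  simp only [Complex.ofReal_one, one_zpow, one_mul] at h2
  have hr' : (r : ℂ) ≠ 0 := Complex.ofReal_ne_zero.2 hr.ne'
  rw [laurentCoeff, ← h2, zpow_neg]
  field_simp

theorem exists_norm_laurentCoeff_le {r : ℝ} (hr : 0 < r) :
    ∃ C, ∀ n, ‖laurentCoeff g n‖ * r ^ n ≤ C := by
  obtain ⟨C, hC⟩ := isCompact_univ.exists_bound_of_continuousOn
    (continuous_circle_dilate hg hr).continuousOn
  refine ⟨C, fun n => ?_⟩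
  calc ‖laurentCoeff g n‖ * r ^ n = ‖∫ u : Circle, (u : ℂ) ^ (-n) * g (r * u) ∂dα‖ := by
        rw [integral_circle_dilate hg hr, norm_mul, norm_zpow, Complex.norm_real,
          Real.norm_of_nonneg hr.le]
    _ ≤ C * dα.real Set.univ := norm_integral_le_of_norm_le_const (.of_forall fun u => by
        rw [norm_mul, norm_circle_zpow, one_mul]; exact hC u trivial)
    _ = C := by simp

theorem summable_laurent {r : ℝ} (hr : 0 < r) : Summable fun n => ‖laurentCoeff g n‖ * r ^ n := by
  -- The coefficient bound at radius `2r` serves `n ≥ 0`, the one at radius `r/2` serves `n ≤ 0`;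
  -- each gains a factor `2^{-|n|}`.
  obtain ⟨C₁, h₁⟩ := exists_norm_laurentCoeff_le hg (r := 2 * r) (by positivity)
  obtain ⟨C₂, h₂⟩ := exists_norm_laurentCoeff_le hg (r := r / 2) (by positivity)
  refine Summable.of_nonneg_of_le (fun n => by positivity) (fun n => ?_)
    (summable_two_inv_pow_natAbs.mul_left (max C₁ C₂))
  rcases Int.natAbs_eq n with h | h
  · have := h₁ n
    have h3 : ‖laurentCoeff g n‖ * r ^ n =
        (‖laurentCoeff g n‖ * (2 * r) ^ n) * (2⁻¹) ^ n.natAbs := by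
      conv_rhs => rw [mul_zpow, ← zpow_natCast, ← h, inv_zpow]
      field_simp
    rw [h3]
    gcongr
    exact this.trans (le_max_left _ _)
  · have := h₂ n
    have h3 : ‖laurentCoeff g n‖ * r ^ n =
        (‖laurentCoeff g n‖ * (r / 2) ^ n) * (2⁻¹) ^ n.natAbs := by
      have h4 : ((2 : ℝ)⁻¹) ^ n.natAbs = 2 ^ n := by
        conv_rhs => rw [h]
        rw [zpow_neg, zpow_natCast, inv_pow]
      rw [h4, div_zpow]
      field_simp
    rw [h3]
    gcongr
    exact this.trans (le_max_right _ _)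

theorem summable_norm_laurent {w : ℂ} (hw : w ≠ 0) :
    Summable fun n => ‖laurentCoeff g n * w ^ n‖ := by
  simpa only [norm_mul, norm_zpow] using summable_laurent hg (norm_pos_iff.2 hw)

/-- A holomorphic function on `ℂ*` is the sum of its Laurent series. -/
theorem tsum_laurent {w : ℂ} (hw : w ≠ 0) : ∑' n, laurentCoeff g n * w ^ n = g w := by
  have hr : 0 < ‖w‖ := norm_pos_iff.2 hw
  have hr' : (‖w‖ : ℂ) ≠ 0 := Complex.ofReal_ne_zero.2 hr.ne'
  have hb := summable_norm_laurent hg hr'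
  have hc1 := continuous_circle_dilate hg hr
  have hc2 := continuous_tsum_zpow hb
  -- On the circle through `w` the function and its series have the same Fourier coefficients; being
  -- continuous, they agree at every point.
  have hae : (fun u : Circle => g (‖w‖ * u) -
      ∑' n, laurentCoeff g n * (‖w‖ : ℂ) ^ n * (u : ℂ) ^ n) =ᵐ[dα] 0 := by
    refine ae_eq_zero_of_integral_zpow (memLp_continuous_dα (hc1.sub hc2)) fun n => ?_
    simp only [mul_sub]
    rw [integral_sub, integral_circle_dilate hg hr, integral_tsum_mul_zpow hb, sub_self]
    · exact integrable_continuous_dα ((continuous_circle_zpow _).mul hc1)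
    · exact integrable_continuous_dα ((continuous_circle_zpow _).mul hc2)
  have heq := (Continuous.ae_eq_iff_eq dα (hc1.sub hc2) continuous_const).1 hae
  have h1 : ‖w / ‖w‖‖ = 1 := by simp [hw]
  have := congrFun heq ⟨w / ‖w‖, by simpa [Submonoid.unitSphere] using h1⟩
  simp only [mul_assoc, ← mul_zpow] at this
  have h2 : (‖w‖ : ℂ) * (w / ‖w‖) = w := by field_simp
  have h3 : g ((‖w‖ : ℂ) * (w / ‖w‖)) - ∑' n, laurentCoeff g n * ((‖w‖ : ℂ) * (w / ‖w‖)) ^ n = 0 :=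
    this
  rw [h2, sub_eq_zero] at h3
  exact h3.symm

end Laurent

/-! ### Laurent coefficients of a holomorphic function on `ℂ² × ℂ*` -/

section Coefficients

variable {G : C2 × ℂ → ℂ} (hG : DifferentiableOn ℂ G {q | q.2 ≠ 0})
include hG

theorem differentiableOn_fiber (z : C2) : DifferentiableOn ℂ (fun w => G (z, w)) {0}ᶜ :=
  hG.comp (by fun_prop : Differentiable ℂ fun w : ℂ => (z, w)).differentiableOn fun _ hw => hw

theorem continuous_zpow_mul_fiber (n : ℤ) :
    Continuous fun p : Circle × C2 => ((p.1 : Circle) : ℂ) ^ (-n) * G (p.2, (p.1 : ℂ)) :=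
  ((continuous_circle_zpow (-n)).comp continuous_fst).mul
    (hG.continuousOn.comp_continuous (by fun_prop) fun p => p.1.coe_ne_zero)

theorem exists_fiber_le (n : ℤ) (R : ℝ) : ∃ C, ∀ (u : Circle) (z : C2), ‖z‖ ≤ R →
    ‖(u : ℂ) ^ (-n) * G (z, (u : ℂ))‖ ≤ C := by
  obtain ⟨C, hC⟩ := (isCompact_univ.prod (isCompact_closedBall (0 : C2) R)).exists_bound_of_continuousOn
    (continuous_zpow_mul_fiber hG n).continuousOn
  exact ⟨C, fun u z hz => hC (u, z) ⟨trivial, mem_closedBall_zero_iff.2 hz⟩⟩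

theorem continuous_laurentCoeff_fiber (n : ℤ) :
    Continuous fun z => laurentCoeff (fun w => G (z, w)) n := by
  refine continuous_iff_continuousAt.2 fun z₀ => ?_
  obtain ⟨C, hC⟩ := exists_fiber_le hG n (‖z₀‖ + 1)
  have hc := continuous_zpow_mul_fiber hG n
  refine continuousAt_of_dominated (bound := fun _ => C) (.of_forall fun z => ?_) ?_
    (integrable_const _) (.of_forall fun u => ?_)
  · exact (hc.comp (by fun_prop : Continuous fun u : Circle => (u, z))).aestronglyMeasurable
  · filter_upwards [Metric.ball_mem_nhds z₀ one_pos] with z hz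
    refine .of_forall fun u => hC u z ?_
    have : ‖z - z₀‖ < 1 := by simpa [dist_eq_norm] using hz
    linarith [norm_le_norm_add_norm_sub' z z₀]
  · exact (hc.comp (by fun_prop : Continuous fun z : C2 => (u, z))).continuousAt

theorem differentiable_laurentCoeff_line (n : ℤ) (z e : C2) :
    Differentiable ℂ fun ζ : ℂ => laurentCoeff (fun w => G (z + ζ • e, w)) n := by
  have hline : Continuous fun p : Circle × ℂ => ((p.1, z + p.2 • e) : Circle × C2) := by fun_prop
  refine differentiable_integral_of_dominated
    (f := fun (u : Circle) ζ => (u : ℂ) ^ (-n) * G (z + ζ • e, (u : ℂ))) ?_ ?_ ?_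
  · exact (continuous_zpow_mul_fiber hG n).comp hline
  · intro u ζ
    have h1 : DifferentiableAt ℂ G (z + ζ • e, (u : ℂ)) :=
      hG.differentiableAt ((isOpen_ne_fun continuous_snd continuous_const).mem_nhds u.coe_ne_zero)
    have h2 : DifferentiableAt ℂ (fun ζ : ℂ => ((z + ζ • e, (u : ℂ)) : C2 × ℂ)) ζ := by fun_prop
    exact (DifferentiableAt.comp ζ h1 h2).const_mul _
  · intro R
    obtain ⟨C, hC⟩ := exists_fiber_le hG n (‖z‖ + R * ‖e‖)
    refine ⟨fun _ => C, integrable_const _, .of_forall fun u ζ hζ => hC u _ ?_⟩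
    refine (norm_add_le _ _).trans ?_
    rw [norm_smul]
    have := norm_nonneg e
    gcongr

end Coefficients

end

section

/-! ### The measure `ν` on `ℂ*` -/

theorem measurableEmbedding_unitsVal : MeasurableEmbedding (Units.val : ℂˣ → ℂ) where
  injective := Units.val_injective
  measurable := comap_measurable _
  measurableSet_image' := by
    rintro _ ⟨t, ht, rfl⟩
    have : Units.val '' (Units.val ⁻¹' t : Set ℂˣ) = t ∩ {0}ᶜ := by
      ext z
      constructor
      · rintro ⟨w, hw, rfl⟩
        exact ⟨hw, w.ne_zero⟩
      · rintro ⟨hz, hz0⟩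
        exact ⟨Units.mk0 z hz0, hz, rfl⟩
    rw [this]
    exact ht.inter (measurableSet_singleton 0).compl

theorem measurable_unitsVal : Measurable (Units.val : ℂˣ → ℂ) :=
  measurableEmbedding_unitsVal.measurable

theorem measurable_units_iff {X : Type*} [MeasurableSpace X] {f : X → ℂˣ} :
    Measurable f ↔ Measurable fun x => (f x : ℂ) :=
  measurableEmbedding_unitsVal.measurable_comp_iff.symm

/-- The conditions on the measure `ν`. -/
structure AdmissibleMeasure (ν : Measure ℂˣ) : Prop where
  inv : ∀ u : Circle, ν.map (fun w => Circle.toUnits u * w) = ν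
  density : ∃ ρ : ℂˣ → ℝ, Measurable ρ ∧ (∀ w, 0 < ρ w) ∧
    ν = lebesgueCStar.withDensity fun w => ENNReal.ofReal (ρ w)
  int : ∀ n : ℤ, Integrable (fun w : ℂˣ => ‖(w : ℂ)‖ ^ (2 * n)) ν

theorem measurable_units_zpow (n : ℤ) : Measurable fun w : ℂˣ => (w : ℂ) ^ n := by
  cases n with
  | ofNat k => simpa using measurable_unitsVal.pow_const k
  | negSucc k =>
    simp only [zpow_negSucc]
    exact (measurable_unitsVal.pow_const (k + 1)).inv

theorem measurable_tsum_zpow {b : ℤ → ℂ} (hb : ∀ w : ℂˣ, Summable fun n => ‖b n * (w : ℂ) ^ n‖) :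
    Measurable fun w : ℂˣ => ∑' n, b n * (w : ℂ) ^ n := by
  refine measurable_of_tendsto_metrizable' (u := (Filter.atTop : Filter (Finset ℤ)))
    (f := fun s (w : ℂˣ) => ∑ n ∈ s, b n * (w : ℂ) ^ n) (fun s => ?_)
    (tendsto_pi_nhds.2 fun w => (hb w).of_norm.hasSum)
  exact Finset.measurable_fun_sum s fun n _ => (measurable_units_zpow n).const_mul _

theorem measurable_rotate : Measurable fun p : ℂˣ × Circle => Circle.toUnits p.2 * p.1 := by
  rw [measurable_units_iff]
  have : Measurable fun u : Circle => (u : ℂ) :=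
    Continuous.measurable (by fun_prop : Continuous fun u : Circle => (u : ℂ))
  simp only [Units.val_mul, Circle.toUnits_apply, Units.val_mk0]
  exact (this.comp measurable_snd).mul (measurable_unitsVal.comp measurable_fst)

namespace AdmissibleMeasure

variable {ν : Measure ℂˣ} (hν : AdmissibleMeasure ν)
include hν

theorem isFiniteMeasure : IsFiniteMeasure ν := by
  have := hν.int 0
  simp only [mul_zero, zpow_zero] at this
  rw [integrable_const_iff] at this
  simpa using this

/-- A positive density makes Lebesgue measure absolutely continuous with respect to `ν`, so a
`ν`-null open set would be Lebesgue null. -/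
theorem measure_preimage_pos {U : Set ℂ} (hU : IsOpen U) (h : (U ∩ {0}ᶜ).Nonempty) :
    0 < ν (Units.val ⁻¹' U) := by
  obtain ⟨ρ, hρm, hρ, rfl⟩ := hν.density
  have hac : lebesgueCStar ≪ lebesgueCStar.withDensity fun w => ENNReal.ofReal (ρ w) :=
    withDensity_absolutelyContinuous' (hρm.ennreal_ofReal.aemeasurable)
      (.of_forall fun w => by simpa using hρ w)
  refine pos_iff_ne_zero.2 fun h0 => ?_
  have h1 := hac h0
  rw [lebesgueCStar, measurableEmbedding_unitsVal.comap_apply] at h1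
  have h2 : Units.val '' (Units.val ⁻¹' U : Set ℂˣ) = U ∩ {0}ᶜ := by
    ext z
    constructor
    · rintro ⟨w, hw, rfl⟩
      exact ⟨hw, w.ne_zero⟩
    · rintro ⟨hz, hz0⟩
      exact ⟨Units.mk0 z hz0, hz, rfl⟩
  rw [h2] at h1
  exact ((hU.inter isOpen_compl_singleton).measure_pos volume h).ne' h1

theorem mul_measure_le_delta {s : Set ℂˣ} (hs : MeasurableSet s) {C : ℝ} {n : ℤ}
    (h : ∀ w ∈ s, C ≤ ‖(w : ℂ)‖ ^ (2 * n)) : (ν s).toReal * C ≤ delta ν n := by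
  have := hν.isFiniteMeasure
  calc (ν s).toReal * C = ∫ w in s, C ∂ν := by
        rw [setIntegral_const, Measure.real, smul_eq_mul]
    _ ≤ ∫ w in s, ‖(w : ℂ)‖ ^ (2 * n) ∂ν :=
        setIntegral_mono_on (integrable_const _).integrableOn (hν.int n).integrableOn hs h
    _ ≤ delta ν n := setIntegral_le_integral (hν.int n)
        (.of_forall fun w => by positivity)

/-- The counterpart of the growth of `σ`. The integrand is at least `R^{2|n|}` on `|w| > R` if `n ≥
0` and on `|w| < 1/R` if `n ≤ 0`, and both regions have positive measure. -/
theorem exists_pow_le_delta {R : ℝ} (hR : 0 < R) :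
    ∃ c > 0, ∀ n : ℤ, c * R ^ (2 * n.natAbs) ≤ delta ν n := by
  have := hν.isFiniteMeasure
  have hU : IsOpen {z : ℂ | R < ‖z‖} := isOpen_lt continuous_const continuous_norm
  have hV : IsOpen {z : ℂ | ‖z‖ < R⁻¹} := isOpen_lt continuous_norm continuous_const
  have hR1 : ((R + 1 : ℝ) : ℂ) ≠ 0 := Complex.ofReal_ne_zero.2 (by positivity)
  have hR2 : ((R⁻¹ / 2 : ℝ) : ℂ) ≠ 0 := Complex.ofReal_ne_zero.2 (by positivity)
  have h1 := hν.measure_preimage_pos hU ⟨((R + 1 : ℝ) : ℂ), by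
    rw [Set.mem_ofPred_eq, Complex.norm_real, Real.norm_of_nonneg (by positivity)]; linarith, hR1⟩
  have h2 := hν.measure_preimage_pos hV ⟨((R⁻¹ / 2 : ℝ) : ℂ), by
    rw [Set.mem_ofPred_eq, Complex.norm_real, Real.norm_of_nonneg (by positivity)]
    exact half_lt_self (by positivity), hR2⟩
  have h1' := ENNReal.toReal_pos h1.ne' (measure_ne_top _ _)
  have h2' := ENNReal.toReal_pos h2.ne' (measure_ne_top _ _)
  refine ⟨min _ _, lt_min h1' h2', fun n => ?_⟩
  have hp : 0 ≤ R ^ (2 * n.natAbs) := by positivity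
  rcases Int.natAbs_eq n with h | h
  · refine (mul_le_mul_of_nonneg_right (min_le_left _ _) hp).trans
      (hν.mul_measure_le_delta (measurable_unitsVal hU.measurableSet) fun w hw => ?_)
    conv_rhs => rw [h]
    have hw' : R < ‖(w : ℂ)‖ := hw
    have : (2 * (n.natAbs : ℤ)) = ((2 * n.natAbs : ℕ) : ℤ) := by push_cast; rfl
    rw [this, zpow_natCast]
    gcongr
  · refine (mul_le_mul_of_nonneg_right (min_le_right _ _) hp).trans
      (hν.mul_measure_le_delta (measurable_unitsVal hV.measurableSet) fun w hw => ?_)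
    conv_rhs => rw [h]
    have hw' : ‖(w : ℂ)‖ < R⁻¹ := hw
    have : (2 * -(n.natAbs : ℤ)) = -((2 * n.natAbs : ℕ) : ℤ) := by push_cast; ring
    rw [this, zpow_neg, zpow_natCast, ← inv_pow]
    have hw0 : 0 < ‖(w : ℂ)‖ := norm_pos_iff.2 w.ne_zero
    gcongr
    rw [le_inv_comm₀ hR hw0]
    exact hw'.le

theorem delta_pos (n : ℤ) : 0 < delta ν n := by
  obtain ⟨c, hc, h⟩ := hν.exists_pow_le_delta one_pos
  exact lt_of_lt_of_le (by positivity) (h n)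

theorem sqrt_delta_pos (n : ℤ) : 0 < √(delta ν n) := Real.sqrt_pos.2 (hν.delta_pos n)

theorem sqrt_delta_ne_zero (n : ℤ) : (√(delta ν n) : ℂ) ≠ 0 :=
  Complex.ofReal_ne_zero.2 (hν.sqrt_delta_pos n).ne'

theorem summable_pow_div {A : ℝ} (hA : 0 < A) :
    Summable fun n : ℤ => A ^ n.natAbs / √(delta ν n) := by
  -- Doubling `A` leaves the summable factor `2^{-|n|}`.
  obtain ⟨c, hc, h⟩ := hν.exists_pow_le_delta (R := 2 * A) (by positivity)
  refine Summable.of_nonneg_of_le (fun n => by positivity) (fun n => ?_)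
    (summable_two_inv_pow_natAbs.mul_left (√c)⁻¹)
  have h1 : √c * (2 * A) ^ n.natAbs ≤ √(delta ν n) := by
    refine Real.le_sqrt_of_sq_le ?_
    rw [mul_pow, Real.sq_sqrt hc.le, ← pow_mul, mul_comm n.natAbs]
    exact h n
  have h2 := Real.sqrt_pos.2 hc
  rw [div_le_iff₀ (hν.sqrt_delta_pos n)]
  calc A ^ n.natAbs = (√c)⁻¹ * 2⁻¹ ^ n.natAbs * (√c * (2 * A) ^ n.natAbs) := by
        rw [mul_pow, inv_pow]; field_simp
    _ ≤ _ := by gcongr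

theorem summable_zpow_div {b : ℤ → ℂ} {C : ℝ} (hb : ∀ n, ‖b n‖ ≤ C) {w : ℂ} (hw : w ≠ 0) :
    Summable fun n : ℤ => ‖b n / (√(delta ν n) : ℂ) * w ^ n‖ := by
  have hw0 := norm_pos_iff.2 hw
  have hA : 0 < max ‖w‖ ‖w‖⁻¹ := lt_max_of_lt_left hw0
  refine Summable.of_nonneg_of_le (fun n => norm_nonneg _) (fun n => ?_)
    ((hν.summable_pow_div hA).mul_left C)
  rw [norm_mul, norm_div, norm_zpow, Complex.norm_real,
    Real.norm_of_nonneg (hν.sqrt_delta_pos n).le, div_mul_eq_mul_div, mul_div_assoc']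
  have := zpow_le_pow_natAbs hw0 (le_max_left _ ‖w‖⁻¹) (le_max_right _ _) n
  have hC : 0 ≤ C := (norm_nonneg _).trans (hb n)
  gcongr
  · exact hb n

theorem ofReal_delta (n : ℤ) :
    ENNReal.ofReal (delta ν n) = ∫⁻ w : ℂˣ, ENNReal.ofReal (‖(w : ℂ)‖ ^ (2 * n)) ∂ν :=
  ofReal_integral_eq_lintegral_ofReal (hν.int n) (.of_forall fun w => by positivity)

/-- Integrals against `ν` may be averaged over rotations. -/
theorem lintegral_rotate {f : ℂˣ → ENNReal} (hf : Measurable f) :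
    ∫⁻ w, ∫⁻ u, f (Circle.toUnits u * w) ∂dα ∂ν = ∫⁻ w, f w ∂ν := by
  have := hν.isFiniteMeasure
  have hm : AEMeasurable (Function.uncurry fun (w : ℂˣ) (u : Circle) =>
      f (Circle.toUnits u * w)) (ν.prod dα) := (hf.comp measurable_rotate).aemeasurable
  rw [lintegral_lintegral_swap hm]
  have h : ∀ u : Circle, ∫⁻ w, f (Circle.toUnits u * w) ∂ν = ∫⁻ w, f w ∂ν := fun u => by
    conv_rhs => rw [← hν.inv u]
    have hu : Measurable fun w : ℂˣ => Circle.toUnits u * w :=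
      measurable_rotate.comp (measurable_prodMk_right (y := u))
    rw [lintegral_map hf hu]
  simp only [h, lintegral_const, measure_univ, mul_one]

/-- The monomials are orthogonal in `L²(ν)`, with squared norms `δ(n)`. -/
theorem lintegral_tsum_zpow {b : ℤ → ℂ} (hb : ∀ w : ℂˣ, Summable fun n => ‖b n * (w : ℂ) ^ n‖) :
    ∫⁻ w : ℂˣ, ‖∑' n, b n * (w : ℂ) ^ n‖ₑ ^ 2 ∂ν =
      ∑' n, ‖b n‖ₑ ^ 2 * ENNReal.ofReal (delta ν n) := by
  rw [← hν.lintegral_rotate ((measurable_tsum_zpow hb).enorm.pow_const 2)]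
  have h : ∀ w : ℂˣ, ∫⁻ u, ‖∑' n, b n * ((Circle.toUnits u * w : ℂˣ) : ℂ) ^ n‖ₑ ^ 2 ∂dα =
      ∑' n, ‖b n‖ₑ ^ 2 * ENNReal.ofReal (‖(w : ℂ)‖ ^ (2 * n)) := by
    intro w
    have h1 : ∀ (u : Circle) (n : ℤ), b n * ((Circle.toUnits u * w : ℂˣ) : ℂ) ^ n =
        b n * (w : ℂ) ^ n * (u : ℂ) ^ n := fun u n => by
      rw [Units.val_mul, mul_zpow, Circle.toUnits_apply, Units.val_mk0]; ring
    simp only [h1]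
    rw [lintegral_parseval (hb w)]
    refine tsum_congr fun n => ?_
    have h2 : ‖(w : ℂ)‖ ^ (2 * n) = (‖(w : ℂ)‖ ^ n) ^ 2 := by
      rw [mul_comm, zpow_mul]; norm_cast
    rw [enorm_mul, mul_pow, ← ofReal_norm ((w : ℂ) ^ n), ← ENNReal.ofReal_pow (norm_nonneg _),
      norm_zpow, h2]
  simp only [h]
  rw [lintegral_tsum]
  · refine tsum_congr fun n => ?_
    rw [lintegral_const_mul', ← hν.ofReal_delta]
    exact ENNReal.pow_ne_top enorm_ne_top
  · intro n
    have h2 : Measurable fun w : ℂˣ => ENNReal.ofReal (‖(w : ℂ)‖ ^ (2 * n)) := by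
      simp only [← norm_zpow]
      exact (measurable_units_zpow _).norm.ennreal_ofReal
    exact (h2.const_mul _).aemeasurable

end AdmissibleMeasure

end

/-! ### The model space `L²(ℝ² × ℤ)` and its kernel -/

/-- The product of `dx` and the counting measure on `ℤ`. -/
def modelMeasure : Measure (R2 × ℤ) := dx.prod Measure.count

theorem lintegral_model {f : R2 × ℤ → ENNReal} (hf : AEMeasurable f modelMeasure) :
    ∫⁻ q, f q ∂modelMeasure = ∑' n : ℤ, ∫⁻ y, f (y, n) ∂dx := by
  rw [modelMeasure, lintegral_prod_symm _ hf, lintegral_count]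

theorem ae_model_iff_of_slices {P : R2 × ℤ → Prop} (h : ∀ᵐ q ∂modelMeasure, P q) (n : ℤ) :
    ∀ᵐ y ∂dx, P (y, n) := by
  have h1 : ∀ᵐ q ∂(Measure.count : Measure ℤ).prod dx, P (q.2, q.1) := by
    have := Measure.measurePreserving_swap (μ := (Measure.count : Measure ℤ)) (ν := dx)
    exact this.quasiMeasurePreserving.ae h
  have h2 := Measure.ae_ae_of_ae_prod h1
  rw [Measure.ae_count_iff] at h2
  exact h2 n

/-! ### Holomorphic dependence on the parameter of the kernel -/

/-- The linear functional `z ↦ y·z`. -/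
def dotC (y : R2) : C2 →L[ℂ] ℂ := ∑ j, (y j : ℂ) • EuclideanSpace.proj j

theorem dotC_apply (y : R2) (z : C2) : dotC y z = ∑ j, (y j : ℂ) * z j := by
  simp [dotC]

theorem continuous_dotC : Continuous dotC := by
  unfold dotC
  fun_prop

theorem norm_dotC_le (y : R2) : ‖dotC y‖ ≤ 2 * ‖y‖ := by
  refine ContinuousLinearMap.opNorm_le_bound _ (by positivity) fun z => ?_
  rw [dotC_apply]
  refine (norm_sum_le _ _).trans ?_
  have h : ∀ j, ‖(y j : ℂ) * z j‖ ≤ ‖y‖ * ‖z‖ := fun j => by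
    rw [norm_mul, Complex.norm_real]
    exact mul_le_mul (PiLp.norm_apply_le y j) (PiLp.norm_apply_le z j) (norm_nonneg _)
      (norm_nonneg _)
  calc ∑ j, ‖(y j : ℂ) * z j‖ ≤ ∑ _j : Fin 2, ‖y‖ * ‖z‖ := Finset.sum_le_sum fun j _ => h j
    _ = 2 * ‖y‖ * ‖z‖ := by simp; ring

theorem hasFDerivAt_expC (y : R2) (z : C2) :
    HasFDerivAt (expC y) (expC y z • (-Complex.I • dotC y)) z := by
  have h : expC y = fun z => Complex.exp ((-Complex.I • dotC y) z) := by
    funext z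
    simp [expC, dotC_apply]
  rw [h]
  exact (ContinuousLinearMap.hasFDerivAt (-Complex.I • dotC y)).cexp

/-- The derivative of `(z, w) ↦ e^{-i y·z} w^n`. -/
def kernelDeriv (q : R2 × ℤ) (p : C2 × ℂ) : C2 × ℂ →L[ℂ] ℂ :=
  expC q.1 p.1 • ((q.2 : ℂ) * p.2 ^ (q.2 - 1)) • ContinuousLinearMap.snd ℂ C2 ℂ +
    p.2 ^ q.2 • (expC q.1 p.1 • (-Complex.I • dotC q.1)).comp (ContinuousLinearMap.fst ℂ C2 ℂ)

theorem hasFDerivAt_kernel (q : R2 × ℤ) {p : C2 × ℂ} (hp : p.2 ≠ 0) :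
    HasFDerivAt (fun p : C2 × ℂ => expC q.1 p.1 * p.2 ^ q.2) (kernelDeriv q p) p := by
  have h1 : HasFDerivAt (fun p : C2 × ℂ => expC q.1 p.1)
      ((expC q.1 p.1 • (-Complex.I • dotC q.1)).comp (ContinuousLinearMap.fst ℂ C2 ℂ)) p :=
    (hasFDerivAt_expC q.1 p.1).comp p hasFDerivAt_fst
  have h2 : HasFDerivAt (fun p : C2 × ℂ => p.2 ^ q.2)
      (((q.2 : ℂ) * p.2 ^ (q.2 - 1)) • ContinuousLinearMap.snd ℂ C2 ℂ) p :=
    (hasDerivAt_zpow q.2 p.2 (Or.inl hp)).comp_hasFDerivAt p hasFDerivAt_snd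
  exact h1.mul h2

/-- The factors `|y|` and `|n|` produced by differentiation are absorbed by `e^{|y|}` and `2^{|n|}`.
The derivative thus has a bound of the same type as the kernel, with `R + 1` and `2A`. -/
theorem norm_kernelDeriv_le {R A : ℝ} (hA : 0 < A) (q : R2 × ℤ) {p : C2 × ℂ} (hp : p.2 ≠ 0)
    (h1 : ‖p.1‖ ≤ R) (h2 : ‖p.2‖ ≤ A) (h3 : ‖p.2‖⁻¹ ≤ A) : ‖kernelDeriv q p‖ ≤
      (A + 2) * (Real.exp ((R + 1) * ‖q.1‖) * (2 * A) ^ q.2.natAbs) := by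
  obtain ⟨y, n⟩ := q
  simp only at *
  have hp0 := norm_pos_iff.2 hp
  have e1 : ‖expC y p.1‖ ≤ Real.exp (R * ‖y‖) :=
    (norm_expC_le y p.1).trans (Real.exp_le_exp.2 (by gcongr))
  have e2 : ‖p.2 ^ n‖ ≤ A ^ n.natAbs := by
    rw [norm_zpow]; exact zpow_le_pow_natAbs hp0 h2 h3 n
  have e3 : ‖p.2 ^ (n - 1)‖ ≤ A ^ n.natAbs * A := by
    rw [zpow_sub_one₀ hp, norm_mul, norm_inv]
    gcongr
  have e4 : ‖(n : ℂ)‖ ≤ 2 ^ n.natAbs := by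
    rw [Complex.norm_intCast, ← Int.cast_abs, Int.abs_eq_natAbs, Int.cast_natCast]
    exact_mod_cast Nat.lt_two_pow_self.le
  have e5 : ‖y‖ ≤ Real.exp ‖y‖ := by linarith [Real.add_one_le_exp ‖y‖]
  have e6 : Real.exp ((R + 1) * ‖y‖) = Real.exp (R * ‖y‖) * Real.exp ‖y‖ := by
    rw [← Real.exp_add]; ring_nf
  have e7 : (1 : ℝ) ≤ Real.exp ‖y‖ := Real.one_le_exp (norm_nonneg _)
  have e8 : (1 : ℝ) ≤ 2 ^ n.natAbs := one_le_pow₀ (by norm_num)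
  calc ‖kernelDeriv (y, n) p‖
      ≤ Real.exp (R * ‖y‖) * (2 ^ n.natAbs * (A ^ n.natAbs * A)) * 1 +
        A ^ n.natAbs * (Real.exp (R * ‖y‖) * (1 * (2 * ‖y‖)) * 1) := by
        refine (norm_add_le _ _).trans (add_le_add ?_ ?_)
        · rw [smul_smul, norm_smul, norm_mul, norm_mul]
          gcongr
          exact ContinuousLinearMap.norm_snd_le ..
        · rw [norm_smul]
          gcongr
          refine (ContinuousLinearMap.opNorm_comp_le _ _).trans ?_
          rw [norm_smul, norm_smul, norm_neg, Complex.norm_I]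
          gcongr
          · exact norm_dotC_le y
          · exact ContinuousLinearMap.norm_fst_le ..
    _ = (A * 1 * 2 ^ n.natAbs + 2 * ‖y‖ * 1) * (Real.exp (R * ‖y‖) * A ^ n.natAbs) := by ring
    _ ≤ (A * Real.exp ‖y‖ * 2 ^ n.natAbs + 2 * Real.exp ‖y‖ * 2 ^ n.natAbs) *
        (Real.exp (R * ‖y‖) * A ^ n.natAbs) := by gcongr
    _ = _ := by rw [e6, mul_pow]; ring

theorem measurable_kernel (z : C2) (w : ℂ) :
    Measurable fun q : R2 × ℤ => expC q.1 z * w ^ q.2 := by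
  refine measurable_from_prod_countable_left fun n => ?_
  have h : Continuous fun y : R2 => expC y z * w ^ n :=
    (continuous_expC_comp continuous_id continuous_const).mul continuous_const
  exact h.measurable

theorem stronglyMeasurable_kernelDeriv (p : C2 × ℂ) :
    StronglyMeasurable fun q : R2 × ℤ => kernelDeriv q p := by
  refine Measurable.stronglyMeasurable (measurable_from_prod_countable_left fun n => ?_)
  refine Continuous.measurable ?_
  have h1 : Continuous fun y : R2 => expC y p.1 :=
    continuous_expC_comp continuous_id continuous_const
  have h2 := continuous_dotC
  unfold kernelDeriv
  fun_prop

/-- Integrals of `e^{-i y·z} w^n` against rapidly decreasing densities are holomorphic. -/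
theorem differentiableOn_integral_kernel {h : R2 × ℤ → ℂ}
    (hm : AEStronglyMeasurable h modelMeasure)
    (hi : ∀ R A : ℝ, 0 < A → Integrable
      (fun q : R2 × ℤ => h q * ((Real.exp (R * ‖q.1‖) * A ^ q.2.natAbs : ℝ) : ℂ)) modelMeasure) :
    DifferentiableOn ℂ (fun p : C2 × ℂ => ∫ q, h q * (expC q.1 p.1 * p.2 ^ q.2) ∂modelMeasure)
      {p | p.2 ≠ 0} := by
  intro p₀ hp₀
  have hw : 0 < ‖p₀.2‖ := norm_pos_iff.2 hp₀
  -- On the neighbourhood `U` below, where `‖p₀.2‖ / 2 < ‖w‖ < ‖p₀.2‖ + 1`, this bounds both `‖w‖`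
  -- and `‖w‖⁻¹`.
  set A : ℝ := max (‖p₀.2‖ + 1) (2 / ‖p₀.2‖) with hAdef
  have hA : 0 < A := lt_max_of_lt_left (by positivity)
  set R : ℝ := ‖p₀.1‖ + 1 with hR
  set U : Set (C2 × ℂ) := {p | ‖p.1‖ < R ∧ ‖p.2‖ < ‖p₀.2‖ + 1 ∧ ‖p₀.2‖ / 2 < ‖p.2‖} with hU
  have hUo : IsOpen U := by
    have c1 : Continuous fun p : C2 × ℂ => ‖p.1‖ := by fun_prop
    have c2 : Continuous fun p : C2 × ℂ => ‖p.2‖ := by fun_prop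
    exact (isOpen_lt c1 continuous_const).inter
      ((isOpen_lt c2 continuous_const).inter (isOpen_lt continuous_const c2))
  have hUm : U ∈ 𝓝 p₀ := hUo.mem_nhds ⟨by simp [hR], by simp, half_lt_self hw⟩
  have hUne : ∀ p ∈ U, p.2 ≠ 0 := fun p hp => norm_pos_iff.1 (lt_trans (by positivity) hp.2.2)
  have hU2 : ∀ p ∈ U, ‖p.2‖ ≤ A := fun p hp => hp.2.1.le.trans (le_max_left _ _)
  have hU3 : ∀ p ∈ U, ‖p.2‖⁻¹ ≤ A := fun p hp => by
    refine le_trans ?_ (le_max_right _ _)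
    rw [← inv_div]
    exact inv_anti₀ (by positivity) hp.2.2.le
  refine (hasFDerivAt_integral_of_dominated_of_fderiv_le (𝕜 := ℂ) (s := U)
    (F := fun p q => h q * (expC q.1 p.1 * p.2 ^ q.2))
    (F' := fun p q => h q • kernelDeriv q p)
    (bound := fun q => (A + 2) * ‖h q * ((Real.exp ((R + 1) * ‖q.1‖) * (2 * A) ^ q.2.natAbs : ℝ) : ℂ)‖)
    hUm (.of_forall fun p => hm.mul (measurable_kernel _ _).aestronglyMeasurable) ?_ ?_ ?_ ?_
    ?_).differentiableAt.differentiableWithinAt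
  · refine (hi R A hA).mono (hm.mul (measurable_kernel _ _).aestronglyMeasurable)
      (.of_forall fun q => ?_)
    rw [norm_mul, norm_mul, norm_mul (h q), Complex.norm_real, Real.norm_of_nonneg (by positivity)]
    gcongr
    · exact (norm_expC_le _ _).trans (Real.exp_le_exp.2 (by gcongr; simp [hR]))
    · rw [norm_zpow]
      exact zpow_le_pow_natAbs hw (hU2 _ (mem_of_mem_nhds hUm)) (hU3 _ (mem_of_mem_nhds hUm)) _
  · exact hm.smul (stronglyMeasurable_kernelDeriv _).aestronglyMeasurable
  · refine .of_forall fun q p hp => ?_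
    rw [norm_smul, norm_mul, Complex.norm_real, Real.norm_of_nonneg (by positivity)]
    have := norm_kernelDeriv_le hA q (hUne p hp) hp.1.le (hU2 p hp) (hU3 p hp)
    rw [mul_left_comm]
    gcongr
  · exact (hi (R + 1) (2 * A) (by positivity)).norm.const_mul _
  · exact .of_forall fun q p hp => (hasFDerivAt_kernel q (hUne p hp)).const_mul (h q)

section

/-! ### Integration over `ℂ² × ℂ*` -/

/-- The point `(z, w)` of `ℂ² × ℂ*`. -/
def pairC (z : C2) (w : ℂˣ) : M2C := ((z, w) : C2 × ℂˣ)

theorem measurable_point : Measurable point := by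
  have h1 : Measurable fun p : (R2 × R2) × ℂˣ => cpt p.1.1 p.1.2 :=
    continuous_cpt.measurable.comp measurable_fst
  exact h1.prodMk measurable_snd

theorem lintegral_targetMeasure {μ : R2 → ℝ} (hμ : Admissible μ) {ν : Measure ℂˣ}
    (hν : AdmissibleMeasure ν) {f : M2C → ENNReal} (hf : Measurable f) :
    ∫⁻ p, f p ∂targetMeasure μ ν =
      ∫⁻ t, ∫⁻ x, ∫⁻ w, f (pairC (cpt x t) w) ∂ν ∂dx ∂weightMeasure μ := by
  have := hμ.isFiniteMeasure
  have := hν.isFiniteMeasure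
  have hfp : Measurable fun p : (R2 × R2) × ℂˣ => f (point p) := hf.comp measurable_point
  rw [targetMeasure, lintegral_map hf measurable_point]
  change ∫⁻ p, f (point p) ∂(dx.prod (weightMeasure μ)).prod ν = _
  rw [lintegral_prod _ hfp.aemeasurable, lintegral_prod_symm _ hfp.lintegral_prod_right'.aemeasurable]
  rfl

theorem IsHolomorphic.measurable {F : M2C → ℂ} (hF : IsHolomorphic F) : Measurable F := by
  obtain ⟨G, hG, hFG⟩ := hF
  have h1 : Measurable ({q : C2 × ℂ | q.2 ≠ 0}.domRestrict G) :=
    (continuousOn_iff_continuous_domRestrict.1 hG.continuousOn).measurable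
  have h2 : Measurable fun p : C2 × ℂˣ =>
      (⟨(p.1, (p.2 : ℂ)), p.2.ne_zero⟩ : {q : C2 × ℂ | q.2 ≠ 0}) :=
    (measurable_fst.prodMk (measurable_unitsVal.comp measurable_snd)).subtype_mk
  have h3 : F = fun p : C2 × ℂˣ => {q : C2 × ℂ | q.2 ≠ 0}.domRestrict G
      ⟨(p.1, (p.2 : ℂ)), p.2.ne_zero⟩ := by
    funext p; exact hFG p
  rw [h3]
  exact h1.comp h2

/-- The square norm of a function given by its Laurent series. -/
theorem lintegral_target_laurent {μ : R2 → ℝ} (hμ : Admissible μ) {ν : Measure ℂˣ}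
    (hν : AdmissibleMeasure ν) {F : M2C → ℂ} (hF : Measurable F) {b : ℤ → C2 → ℂ}
    (hb : ∀ n, Continuous (b n))
    (hs : ∀ (z : C2) (w : ℂˣ), Summable fun n => ‖b n z * (w : ℂ) ^ n‖)
    (hFb : ∀ p : M2C, F p = ∑' n, b n p.1 * (p.2 : ℂ) ^ n) :
    ∫⁻ p, ‖F p‖ₑ ^ 2 ∂targetMeasure μ ν =
      ∑' n, ENNReal.ofReal (delta ν n) * ∫⁻ t, sliceNorm (b n) t ∂weightMeasure μ := by
  have := hμ.isFiniteMeasure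
  rw [lintegral_targetMeasure hμ hν (hF.enorm.pow_const 2)]
  have h1 : ∀ t x, ∫⁻ w, ‖F (pairC (cpt x t) w)‖ₑ ^ 2 ∂ν =
      ∑' n, ‖b n (cpt x t)‖ₑ ^ 2 * ENNReal.ofReal (delta ν n) := fun t x => by
    rw [← hν.lintegral_tsum_zpow (hs (cpt x t))]
    exact lintegral_congr fun w => by rw [hFb]; rfl
  have h2 : ∀ t, ∫⁻ x, ∑' n, ‖b n (cpt x t)‖ₑ ^ 2 * ENNReal.ofReal (delta ν n) ∂dx =
      ∑' n, sliceNorm (b n) t * ENNReal.ofReal (delta ν n) := fun t => by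
    rw [lintegral_tsum fun n => ((((continuous_slice (hb n) t).enorm.measurable).pow_const
      2).mul_const _).aemeasurable]
    refine tsum_congr fun n => ?_
    rw [lintegral_mul_const' _ _ ENNReal.ofReal_ne_top]
    rfl
  simp only [h1, h2]
  rw [lintegral_tsum fun n => ((measurable_sliceNorm (hb n)).mul_const _).aemeasurable]
  refine tsum_congr fun n => ?_
  rw [lintegral_mul_const' _ _ ENNReal.ofReal_ne_top, mul_comm]

/-! ### The model of the transform on `L²(ℝ² × ℤ)` -/

/-- The transform `h ↦ ∑ₙ ∫ h(y, n) e^{-i y·z} w^n / √(σ(y) δ(n)) dy`. -/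
def modelT (μ : R2 → ℝ) (ν : Measure ℂˣ) (h : R2 × ℤ → ℂ) (p : C2 × ℂ) : ℂ :=
  ∫ q, h q / ((√(sigma μ q.1) : ℂ) * (√(delta ν q.2) : ℂ)) * (expC q.1 p.1 * p.2 ^ q.2) ∂modelMeasure

section Model

/-- The Laurent coefficients of `modelT`. -/
theorem integral_model_slice (μ : R2 → ℝ) (ν : Measure ℂˣ) (h : R2 × ℤ → ℂ) (z : C2) (w : ℂ) (n : ℤ) :
    ∫ y, h (y, n) / ((√(sigma μ y) : ℂ) * (√(delta ν n) : ℂ)) * (expC y z * w ^ n) ∂dx =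
      planeE (fun y => h (y, n) / (√(sigma μ y) : ℂ)) z / (√(delta ν n) : ℂ) * w ^ n := by
  have h1 : ∀ y, h (y, n) / ((√(sigma μ y) : ℂ) * (√(delta ν n) : ℂ)) * (expC y z * w ^ n) =
      h (y, n) / (√(sigma μ y) : ℂ) * expC y z * (w ^ n / (√(delta ν n) : ℂ)) := fun y => by
    field_simp
  simp only [h1]
  rw [integral_mul_const, planeE]
  ring

variable {μ : R2 → ℝ} (hμ : Admissible μ) {ν : Measure ℂˣ} (hν : AdmissibleMeasure ν)

theorem Summable.sq_of_nonneg {ι : Type*} {f : ι → ℝ} (hf : Summable f) (h : ∀ i, 0 ≤ f i) :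
    Summable fun i => f i ^ 2 := by
  refine Summable.of_nonneg_of_le (fun i => by positivity) (fun i => ?_)
    (hf.mul_left (∑' i, f i))
  rw [sq]
  exact mul_le_mul_of_nonneg_right (hf.le_tsum i fun j _ => h j) (h i)

include hμ hν

/-- The common majorant of the model kernels. Being square integrable, it makes the model integral
converge at every point for every `h` in `L²`. -/
theorem memLp_model_weight (R : ℝ) {A : ℝ} (hA : 0 < A) :
    MemLp (fun q : R2 × ℤ => ((Real.exp (R * ‖q.1‖) / √(sigma μ q.1) *
      (A ^ q.2.natAbs / √(delta ν q.2)) : ℝ) : ℂ)) 2 modelMeasure := by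
  have hm : Measurable (fun q : R2 × ℤ => ((Real.exp (R * ‖q.1‖) / √(sigma μ q.1) *
      (A ^ q.2.natAbs / √(delta ν q.2)) : ℝ) : ℂ)) := by
    refine measurable_from_prod_countable_left fun n => ?_
    have := hμ.measurable_sigma
    simp only
    fun_prop
  rw [memLp_two_iff hm.aestronglyMeasurable, lintegral_model (hm.enorm.pow_const 2).aemeasurable]
  have h1 := (memLp_two_iff (hμ.memLp_exp_div R).1).1 (hμ.memLp_exp_div R)
  have h2 : ∀ n : ℤ, ∫⁻ y, ‖((Real.exp (R * ‖y‖) / √(sigma μ y) *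
      (A ^ n.natAbs / √(delta ν n)) : ℝ) : ℂ)‖ₑ ^ 2 ∂dx =
      (∫⁻ y, ‖((Real.exp (R * ‖y‖) / √(sigma μ y) : ℝ) : ℂ)‖ₑ ^ 2 ∂dx) *
        ENNReal.ofReal ((A ^ n.natAbs / √(delta ν n)) ^ 2) := fun n => by
    rw [← lintegral_mul_const' _ _ ENNReal.ofReal_ne_top]
    refine lintegral_congr fun y => ?_
    have : 0 ≤ A ^ n.natAbs / √(delta ν n) := by positivity
    rw [Complex.ofReal_mul, enorm_mul, mul_pow, ENNReal.ofReal_pow this,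
      ← ofReal_norm ((A ^ n.natAbs / √(delta ν n) : ℝ) : ℂ), Complex.norm_real,
      Real.norm_of_nonneg this]
  simp only [h2]
  rw [ENNReal.tsum_mul_left]
  refine ENNReal.mul_lt_top h1 ?_
  have hs := Summable.sq_of_nonneg (hν.summable_pow_div hA) fun n => by positivity
  rw [← ENNReal.ofReal_tsum_of_nonneg (fun n => by positivity) hs]
  exact ENNReal.ofReal_lt_top

variable {h : R2 × ℤ → ℂ} (hh : MemLp h 2 modelMeasure)

omit hν in
theorem measurable_model_denominator :
    Measurable fun q : R2 × ℤ => ((√(sigma μ q.1) : ℂ) * (√(delta ν q.2) : ℂ))⁻¹ := by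
  refine measurable_from_prod_countable_left fun n => ?_
  have := hμ.measurable_sigma
  simp only
  fun_prop

include hh

omit hν in
theorem aestronglyMeasurable_model_div :
    AEStronglyMeasurable (fun q => h q / ((√(sigma μ q.1) : ℂ) * (√(delta ν q.2) : ℂ)))
      modelMeasure := by
  simp only [div_eq_mul_inv]
  exact hh.1.mul (measurable_model_denominator hμ).aestronglyMeasurable

theorem integrable_model_mul (R A : ℝ) (hA : 0 < A) : Integrable (fun q : R2 × ℤ =>
    h q / ((√(sigma μ q.1) : ℂ) * (√(delta ν q.2) : ℂ)) *
      ((Real.exp (R * ‖q.1‖) * A ^ q.2.natAbs : ℝ) : ℂ)) modelMeasure := by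
  refine (hh.integrable_mul (memLp_model_weight hμ hν R hA)).congr (.of_forall fun q => ?_)
  simp only [Pi.mul_apply]
  push_cast
  field_simp

theorem differentiableOn_modelT : DifferentiableOn ℂ (modelT μ ν h) {p | p.2 ≠ 0} :=
  differentiableOn_integral_kernel (aestronglyMeasurable_model_div hμ hh)
    (integrable_model_mul hμ hν hh)

theorem isHolomorphic_modelT : IsHolomorphic fun p : M2C => modelT μ ν h (p.1, (p.2 : ℂ)) :=
  ⟨modelT μ ν h, differentiableOn_modelT hμ hν hh, fun _ => rfl⟩

theorem integrable_modelT (z : C2) {w : ℂ} (hw : w ≠ 0) : Integrable (fun q : R2 × ℤ =>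
    h q / ((√(sigma μ q.1) : ℂ) * (√(delta ν q.2) : ℂ)) * (expC q.1 z * w ^ q.2))
      modelMeasure := by
  have hw0 := norm_pos_iff.2 hw
  have hA : 0 < max ‖w‖ ‖w‖⁻¹ := lt_max_of_lt_left hw0
  refine (integrable_model_mul hμ hν hh ‖z‖ _ hA).mono
    ((aestronglyMeasurable_model_div hμ hh).mul (measurable_kernel z w).aestronglyMeasurable)
    (.of_forall fun q => ?_)
  rw [norm_mul, norm_mul (h q / _), norm_mul (expC _ _), Complex.norm_real,
    Real.norm_of_nonneg (by positivity), norm_zpow]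
  gcongr
  · exact norm_expC_le _ _
  · exact zpow_le_pow_natAbs hw0 (le_max_left _ _) (le_max_right _ _) _

omit hμ hν in
theorem memLp_model_slice (n : ℤ) : MemLp (fun y => h (y, n)) 2 dx := by
  have hm : AEStronglyMeasurable (fun y => h (y, n)) dx :=
    ⟨fun y => hh.1.mk h (y, n), hh.1.stronglyMeasurable_mk.comp_measurable
      (measurable_id.prodMk measurable_const), ae_model_iff_of_slices hh.1.ae_eq_mk n⟩
  rw [memLp_two_iff hm]
  have h1 := (memLp_two_iff hh.1).1 hh
  rw [lintegral_model (hh.1.enorm.pow_const 2)] at h1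
  exact lt_of_le_of_lt (ENNReal.le_tsum n) h1

theorem summable_modelT (z : C2) {w : ℂ} (hw : w ≠ 0) : Summable fun n : ℤ =>
    ‖planeE (fun y => h (y, n) / (√(sigma μ y) : ℂ)) z / (√(delta ν n) : ℂ) * w ^ n‖ := by
  have h1 := (integrable_modelT hμ hν hh z hw).swap.integral_prod_left
  rw [integrable_count_iff] at h1
  refine h1.congr fun n => ?_
  rw [← integral_model_slice μ ν h]
  rfl

theorem modelT_eq_tsum (z : C2) {w : ℂ} (hw : w ≠ 0) : modelT μ ν h (z, w) =
    ∑' n : ℤ, planeE (fun y => h (y, n) / (√(sigma μ y) : ℂ)) z / (√(delta ν n) : ℂ) * w ^ n := by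
  have hi := integrable_modelT hμ hν hh z hw
  have h2 : Integrable (fun n : ℤ => ∫ y, h (y, n) / ((√(sigma μ y) : ℂ) * (√(delta ν n) : ℂ)) *
      (expC y z * w ^ n) ∂dx) Measure.count := hi.swap.integral_prod_left
  rw [modelT, modelMeasure, integral_prod_symm _ hi, integral_countable h2]
  refine tsum_congr fun n => ?_
  simp only [Measure.real, Measure.count_singleton, ENNReal.toReal_one, one_smul]
  exact integral_model_slice μ ν h z w n

/-- `modelT` is isometric. -/
theorem lintegral_modelT :
    ∫⁻ p : M2C, ‖modelT μ ν h (p.1, (p.2 : ℂ))‖ₑ ^ 2 ∂targetMeasure μ ν =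
      ∫⁻ q, ‖h q‖ₑ ^ 2 ∂modelMeasure := by
  rw [lintegral_target_laurent hμ hν (isHolomorphic_modelT hμ hν hh).measurable
    (b := fun n z => planeE (fun y => h (y, n) / (√(sigma μ y) : ℂ)) z / (√(delta ν n) : ℂ))
    (fun n => (hμ.continuous_planeE_div (memLp_model_slice hh n)).div_const _)
    (fun z w => summable_modelT hμ hν hh z w.ne_zero)
    (fun p => modelT_eq_tsum hμ hν hh p.1 p.2.ne_zero), lintegral_model (hh.1.enorm.pow_const 2)]
  refine tsum_congr fun n => ?_
  have hδ := hν.delta_pos n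
  have h1 : ∀ t, sliceNorm (fun z => planeE (fun y => h (y, n) / (√(sigma μ y) : ℂ)) z /
      (√(delta ν n) : ℂ)) t = ENNReal.ofReal (delta ν n)⁻¹ *
        ∫⁻ x, ‖planeE (fun y => h (y, n) / (√(sigma μ y) : ℂ)) (cpt x t)‖ₑ ^ 2 ∂dx := fun t => by
    rw [sliceNorm, ← lintegral_const_mul' _ _ ENNReal.ofReal_ne_top]
    refine lintegral_congr fun x => ?_
    rw [div_eq_mul_inv, enorm_mul, mul_pow, mul_comm, ← ofReal_norm (_⁻¹ : ℂ),
      ← ENNReal.ofReal_pow (norm_nonneg _), norm_inv, Complex.norm_real,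
      Real.norm_of_nonneg (Real.sqrt_nonneg _), inv_pow, Real.sq_sqrt hδ.le]
  simp only [h1]
  -- The squared norm `δ(n)` of `wⁿ` cancels the normalisation `δ(n)⁻¹` of the coefficient, leaving
  -- the norm of `h(·, n)`.
  rw [lintegral_const_mul' _ _ ENNReal.ofReal_ne_top, hμ.lintegral_planeE_div (memLp_model_slice hh n),
    ← mul_assoc, ← ENNReal.ofReal_mul hδ.le, mul_inv_cancel₀ hδ.ne', ENNReal.ofReal_one, one_mul]

end Model

/-- `modelT` is onto the holomorphic square integrable functions. -/
theorem exists_modelT_eq {μ : R2 → ℝ} (hμ : Admissible μ) {ν : Measure ℂˣ}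
    (hν : AdmissibleMeasure ν) {F : M2C → ℂ} (hF : IsHolomorphic F)
    (hfin : ∫⁻ p, ‖F p‖ₑ ^ 2 ∂targetMeasure μ ν < ⊤) :
    ∃ h, MemLp h 2 modelMeasure ∧ ∀ p : M2C, F p = modelT μ ν h (p.1, (p.2 : ℂ)) := by
  have hFm := hF.measurable
  obtain ⟨G, hG, hFG⟩ := hF
  have hsum : ∀ (z : C2) (w : ℂˣ),
      Summable fun n => ‖laurentCoeff (fun w => G (z, w)) n * (w : ℂ) ^ n‖ := fun z w =>
    summable_norm_laurent (differentiableOn_fiber hG z) w.ne_zero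
  have hFb : ∀ p : M2C, F p = ∑' n, laurentCoeff (fun w => G (p.1, w)) n * (p.2 : ℂ) ^ n := fun p =>
    (hFG p).trans (tsum_laurent (differentiableOn_fiber hG p.1) p.2.ne_zero).symm
  -- Orthogonality of the monomials: the norm of `F` is a sum over its Laurent coefficients, so each
  -- of them has finite weighted slice norm.
  have hnorm := lintegral_target_laurent hμ hν hFm
    (b := fun n z => laurentCoeff (fun w => G (z, w)) n) (continuous_laurentCoeff_fiber hG) hsum hFb
  rw [hnorm] at hfin
  have hn : ∀ n, ∃ H : R2 → ℂ, Measurable H ∧ MemLp H 2 dx ∧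
      (fun z => laurentCoeff (fun w => G (z, w)) n) =
        planeE fun y => H y / (√(sigma μ y) : ℂ) := by
    intro n
    have h1 : ∫⁻ t, sliceNorm (fun z => laurentCoeff (fun w => G (z, w)) n) t ∂weightMeasure μ < ⊤ := by
      have h2 := lt_of_le_of_lt (ENNReal.le_tsum n) hfin
      by_contra hcon
      rw [not_lt, top_le_iff] at hcon
      rw [hcon, ENNReal.mul_top (by simpa using hν.delta_pos n)] at h2
      exact lt_irrefl _ h2
    obtain ⟨H, hH, hHe⟩ := hμ.exists_planeE_eq (continuous_laurentCoeff_fiber hG n)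
      (differentiable_laurentCoeff_line hG n) h1
    -- Genuinely measurable densities are chosen so that they assemble to a measurable function on
    -- `ℝ² × ℤ`.
    refine ⟨hH.1.mk H, hH.1.stronglyMeasurable_mk.measurable, hH.ae_eq hH.1.ae_eq_mk, ?_⟩
    rw [hHe]
    funext z
    refine integral_congr_ae ?_
    filter_upwards [hH.1.ae_eq_mk] with y hy
    rw [← hy]
  choose H hHm hHL hHe using hn
  have hm : Measurable fun q : R2 × ℤ => H q.2 q.1 * (√(delta ν q.2) : ℂ) :=
    measurable_from_prod_countable_left fun n => (hHm n).mul_const (√(delta ν n) : ℂ)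
  -- The factor `√δ(n)` undoes the normalisation in `modelT`; the squared norm of the assembled
  -- function is the sum obtained in `hnorm`.
  have hh : MemLp (fun q : R2 × ℤ => H q.2 q.1 * (√(delta ν q.2) : ℂ)) 2 modelMeasure := by
    rw [memLp_two_iff hm.aestronglyMeasurable, lintegral_model (hm.enorm.pow_const 2).aemeasurable]
    refine lt_of_le_of_lt (le_of_eq (tsum_congr fun n => ?_)) hfin
    have hδ := hν.delta_pos n
    rw [hHe n]
    have h1 : ∀ t, sliceNorm (planeE fun y => H n y / (√(sigma μ y) : ℂ)) t =
        ∫⁻ x, ‖planeE (fun y => H n y / (√(sigma μ y) : ℂ)) (cpt x t)‖ₑ ^ 2 ∂dx := fun t => rfl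
    simp only [h1]
    rw [hμ.lintegral_planeE_div (hHL n), ← lintegral_const_mul' _ _ ENNReal.ofReal_ne_top]
    refine lintegral_congr fun y => ?_
    rw [enorm_mul, mul_pow, mul_comm, ← ofReal_norm (√(delta ν n) : ℂ),
      ← ENNReal.ofReal_pow (norm_nonneg _), Complex.norm_real,
      Real.norm_of_nonneg (Real.sqrt_nonneg _), Real.sq_sqrt hδ.le]
  refine ⟨_, hh, fun p => ?_⟩
  rw [modelT_eq_tsum hμ hν hh p.1 p.2.ne_zero, hFb]
  refine tsum_congr fun n => ?_
  have h1 := congrFun (hHe n) p.1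
  simp only at h1 ⊢
  rw [h1]
  congr 1
  rw [eq_div_iff (hν.sqrt_delta_ne_zero n), planeE, planeE, ← integral_mul_const]
  exact integral_congr_ae (.of_forall fun y => by simp only; ring)

end

section

/-! ### Rotations -/

theorem norm_rotR (u : Circle) (x : R2) : ‖rotR u x‖ = ‖x‖ := by
  have h : (u : ℂ).re ^ 2 + (u : ℂ).im ^ 2 = 1 := by
    have := Circle.normSq_coe u
    rw [Complex.normSq_apply] at this
    linarith
  rw [EuclideanSpace.norm_eq, EuclideanSpace.norm_eq]
  congr 1
  simp only [Fin.sum_univ_two, Real.norm_eq_abs, sq_abs, rotR]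
  simp
  linear_combination (x 0 ^ 2 + x 1 ^ 2) * h

/-- Rotation as a linear isometry. -/
def rotIso (u : Circle) : R2 ≃ₗᵢ[ℝ] R2 where
  toFun := rotR u
  invFun := rotR u⁻¹
  map_add' := rotR_add u
  map_smul' r x := by ext i; fin_cases i <;> simp [rotR] <;> ring
  left_inv x := by rw [← rotR_mul, inv_mul_cancel, rotR_one]
  right_inv x := by rw [← rotR_mul, mul_inv_cancel, rotR_one]
  norm_map' := norm_rotR u

theorem measurePreserving_rotR (u : Circle) : MeasurePreserving (rotR u) dx dx :=
  (rotIso u).measurePreserving.smul_measure _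

theorem measurableEmbedding_rotR (u : Circle) : MeasurableEmbedding (rotR u) :=
  (rotIso u).toHomeomorph.measurableEmbedding

theorem inner_rotR (u : Circle) (x y : R2) : inner ℝ (rotR u x) (rotR u y) = inner ℝ x y :=
  (rotIso u).inner_map_map x y

/-- Radiality of `μ` enters here: it keeps the weight fixed when a rotation is moved to the
frequency variable. -/
theorem sigma_rotR {μ : R2 → ℝ} (hrad : ∀ x y : R2, ‖x‖ = ‖y‖ → μ x = μ y) (u : Circle) (x : R2) :
    sigma μ (rotR u x) = sigma μ x := by
  rw [sigma, ← (measurePreserving_rotR u).integral_comp (measurableEmbedding_rotR u)]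
  simp only [inner_rotR, hrad _ _ (norm_rotR u _), sigma]

theorem cosC_toUnits (u : Circle) : cosC (Circle.toUnits u) = ((u : ℂ).re : ℂ) := by
  have := Complex.add_conj (u : ℂ)
  simp only [cosC, Circle.toUnits_apply, Units.val_mk0, ← Circle.coe_inv, Circle.coe_inv_eq_conj,
    this]
  push_cast
  ring

theorem sinC_toUnits (u : Circle) : sinC (Circle.toUnits u) = ((u : ℂ).im : ℂ) := by
  have := Complex.sub_conj (u : ℂ)
  simp only [sinC, Circle.toUnits_apply, Units.val_mk0, ← Circle.coe_inv, Circle.coe_inv_eq_conj,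
    this]
  push_cast
  field_simp

theorem rotC_toUnits_inv (u : Circle) (z : C2) : rotC (Circle.toUnits u)⁻¹ z =
    !₂[((u : ℂ).re : ℂ) * z 0 + ((u : ℂ).im : ℂ) * z 1,
      -((u : ℂ).im : ℂ) * z 0 + ((u : ℂ).re : ℂ) * z 1] := by
  rw [← map_inv, rotC, cosC_toUnits, sinC_toUnits, Circle.coe_inv_eq_conj, Complex.conj_re,
    Complex.conj_im, Complex.ofReal_neg, neg_mul, sub_neg_eq_add, neg_mul]

/-- The bilinear form `y·z` is invariant under simultaneous real rotations, so `u⁻¹` acting on `z`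
becomes `u` acting on `y`. -/
theorem expC_rotC_inv (u : Circle) (y : R2) (z : C2) :
    expC y (rotC (Circle.toUnits u)⁻¹ z) = expC (rotR u y) z := by
  rw [rotC_toUnits_inv, expC, expC]
  congr 2
  simp only [Fin.sum_univ_two, rotR]
  simp
  ring

theorem continuous_rotC_inv {X : Type*} [TopologicalSpace X] {f : X → Circle} {g : X → C2}
    (hf : Continuous f) (hg : Continuous g) :
    Continuous fun x => rotC (Circle.toUnits (f x))⁻¹ (g x) := by
  simp only [rotC_toUnits_inv]
  refine (PiLp.continuous_toLp 2 _).comp (continuous_pi fun i => ?_)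
  fin_cases i <;> simp <;> fun_prop

theorem expC_sub_cpt (y x : R2) (z : C2) : expC y (z - cpt x 0) =
    expC y z * (starRingEnd ℂ) (Complex.exp (-Complex.I * (inner ℝ y x : ℝ))) := by
  rw [expC, expC, ← Complex.exp_conj, ← Complex.exp_add]
  congr 1
  simp [Fin.sum_univ_two, cpt, inner_R2]
  ring

/-! ### The kernel `φ(g⁻¹p)` -/

theorem Admissible.integrable_exp_div {μ : R2 → ℝ} (hμ : Admissible μ) (R : ℝ) :
    Integrable (fun y => ((Real.exp (R * ‖y‖) / √(sigma μ y) : ℝ) : ℂ)) dx := by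
  -- The spare `e^{3|y|}` dominates `(1 + |y|)³`, and `(1 + |y|)⁻³` is integrable in dimension two.
  obtain ⟨C, hC⟩ := hμ.exists_exp_div_le (R + 3)
  have hm : Measurable fun y => ((Real.exp (R * ‖y‖) / √(sigma μ y) : ℝ) : ℂ) := by
    have := hμ.measurable_sigma
    fun_prop
  have h1 : Integrable (fun y : R2 => C * (1 + ‖y‖) ^ (-(3 : ℝ))) dx :=
    (integrable_one_add_norm (by simp; norm_num)).const_mul C
  refine h1.mono' hm.aestronglyMeasurable (.of_forall fun y => ?_)
  have hs := hμ.sqrt_sigma_pos y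
  have h0 : 0 < 1 + ‖y‖ := by positivity
  rw [Complex.norm_real, Real.norm_of_nonneg (by positivity)]
  have h2 : (1 + ‖y‖) ^ 3 ≤ Real.exp (3 * ‖y‖) := by
    have := Real.add_one_le_exp ‖y‖
    calc (1 + ‖y‖) ^ 3 ≤ Real.exp ‖y‖ ^ 3 := by gcongr; linarith
      _ = Real.exp (3 * ‖y‖) := by rw [← Real.exp_nat_mul]; norm_cast
  have h4 : (1 + ‖y‖) ^ (-(3 : ℝ)) = ((1 + ‖y‖) ^ 3)⁻¹ := by
    rw [Real.rpow_neg h0.le]; norm_cast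
  rw [h4, ← div_eq_mul_inv, le_div_iff₀ (by positivity)]
  refine le_trans ?_ (hC y)
  rw [add_mul, Real.exp_add, div_mul_eq_mul_div]
  gcongr

/-- The unimodular factor `e^{-i a(u⁻¹y)}`. -/
def phase (a : R2 → ℝ) (u : Circle) (y : R2) : ℂ :=
  Complex.exp (-Complex.I * (a (rotR u⁻¹ y) : ℂ))

theorem norm_phase (a : R2 → ℝ) (u : Circle) (y : R2) : ‖phase a u y‖ = 1 :=
  norm_exp_neg_I_mul _

theorem measurable_phase {a : R2 → ℝ} (ha : Measurable a) (u : Circle) : Measurable (phase a u) := by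
  have := (measurePreserving_rotR u⁻¹).measurable
  unfold phase
  fun_prop

/-- The function of `y` whose Fourier transform is `ξ ↦ conj (ψ (u⁻¹ (z - ξ)))`. -/
def planeKernel (μ a : R2 → ℝ) (u : Circle) (z : C2) (y : R2) : ℂ :=
  phase a u y * ((starRingEnd ℂ) (expC y z) / (√(sigma μ y) : ℂ))

/-- The function `(ξ, u) ↦ conj (ψ (u⁻¹ (z - ξ)))`. -/
def planePart (μ a : R2 → ℝ) (z : C2) (g : R2 × Circle) : ℂ :=
  (starRingEnd ℂ) (psi μ a (rotC (Circle.toUnits g.2)⁻¹ (z - cpt g.1 0)))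

/-- The substitution `y ↦ uy` collects the whole influence of `u` in the unimodular factor `phase a
u`. -/
theorem planePart_eq {μ a : R2 → ℝ} (hrad : ∀ x y : R2, ‖x‖ = ‖y‖ → μ x = μ y) (z : C2)
    (ξ : R2) (u : Circle) : planePart μ a z (ξ, u) =
      ∫ y, planeKernel μ a u z y * Complex.exp (-Complex.I * (inner ℝ y ξ : ℝ)) ∂dx := by
  rw [planePart, psi, ← integral_conj,
    ← (measurePreserving_rotR u).integral_comp (measurableEmbedding_rotR u) fun y =>
      planeKernel μ a u z y * Complex.exp (-Complex.I * (inner ℝ y ξ : ℝ))]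
  refine integral_congr_ae (.of_forall fun y => ?_)
  have h1 : Complex.exp (-Complex.I * ∑ j, (y j : ℂ) *
      (rotC (Circle.toUnits u)⁻¹ (z - cpt ξ 0)) j) = _ :=
    (expC_rotC_inv u y (z - cpt ξ 0)).trans (expC_sub_cpt _ _ _)
  have h2 : rotR u⁻¹ (rotR u y) = y := (rotIso u).left_inv y
  have h3 : (starRingEnd ℂ) (Complex.exp (Complex.I * (a y : ℂ))) =
      Complex.exp (-Complex.I * (a y : ℂ)) := by
    rw [← Complex.exp_conj, map_mul, Complex.conj_I, Complex.conj_ofReal]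
  simp only [h1, planeKernel, phase, sigma_rotR hrad, h2, map_mul, map_div₀, Complex.conj_ofReal,
    Complex.conj_conj, h3]
  ring

section

variable {μ a : R2 → ℝ} (hμ : Admissible μ) (ha : Measurable a)
include hμ ha

theorem continuous_psi : Continuous (psi μ a) := by
  have hs := hμ.measurable_sigma
  have hm : Measurable fun y => Complex.exp (Complex.I * (a y : ℂ)) / (√(sigma μ y) : ℂ) := by
    fun_prop
  have hp : psi μ a =
      planeE fun y => Complex.exp (Complex.I * (a y : ℂ)) / (√(sigma μ y) : ℂ) := rfl
  rw [hp]
  refine continuous_planeE hm.aestronglyMeasurable fun R => ?_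
  refine (hμ.integrable_exp_div R).mono
    (hm.mul (Continuous.measurable (by fun_prop) :
      Measurable fun y : R2 => (Real.exp (R * ‖y‖) : ℂ))).aestronglyMeasurable (.of_forall fun y => le_of_eq ?_)
  have h := norm_exp_neg_I_mul (-a y)
  rw [Complex.ofReal_neg, neg_mul_neg] at h
  rw [norm_mul, norm_div, h, Complex.ofReal_div, norm_div]
  ring

theorem continuous_planePart (z : C2) : Continuous (planePart μ a z) := by
  have h1 : Continuous fun g : R2 × Circle => z - cpt g.1 0 := continuous_const.sub
    (continuous_cpt.comp (by fun_prop : Continuous fun g : R2 × Circle => (g.1, (0 : R2))))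
  exact Complex.continuous_conj.comp
    ((continuous_psi hμ ha).comp (continuous_rotC_inv continuous_snd h1))

theorem measurable_planeKernel (u : Circle) (z : C2) : Measurable (planeKernel μ a u z) := by
  have h1 := measurable_phase ha u
  have h2 := hμ.measurable_sigma
  have h3 : Measurable fun y => expC y z :=
    (continuous_expC_comp continuous_id continuous_const).measurable
  unfold planeKernel
  refine h1.mul (Measurable.div ?_ (by fun_prop))
  exact Complex.continuous_conj.measurable.comp h3

omit hμ ha in
theorem norm_planeKernel (u : Circle) (z : C2) (y : R2) :
    ‖planeKernel μ a u z y‖ = ‖expC y z‖ / √(sigma μ y) := by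
  rw [planeKernel, norm_mul, norm_phase, one_mul, norm_div, RCLike.norm_conj, Complex.norm_real,
    Real.norm_of_nonneg (Real.sqrt_nonneg _)]

omit hμ ha in
theorem norm_planeKernel_le (u : Circle) (z : C2) (y : R2) : ‖planeKernel μ a u z y‖ ≤
    ‖((Real.exp (‖z‖ * ‖y‖) / √(sigma μ y) : ℝ) : ℂ)‖ := by
  rw [norm_planeKernel, Complex.norm_real, Real.norm_of_nonneg (by positivity)]
  gcongr
  exact norm_expC_le y z

theorem integrable_planeKernel (u : Circle) (z : C2) : Integrable (planeKernel μ a u z) dx :=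
  (hμ.integrable_exp_div ‖z‖).mono (measurable_planeKernel hμ ha u z).aestronglyMeasurable
    (.of_forall (norm_planeKernel_le u z))

theorem memLp_planeKernel (u : Circle) (z : C2) : MemLp (planeKernel μ a u z) 2 dx :=
  (hμ.memLp_exp_div ‖z‖).mono (measurable_planeKernel hμ ha u z).aestronglyMeasurable
    (.of_forall (norm_planeKernel_le u z))

variable (hrad : ∀ x y : R2, ‖x‖ = ‖y‖ → μ x = μ y)
include hrad

theorem fourierDx_planeKernel (u : Circle) (z : C2) :
    fourierDx ((memLp_planeKernel hμ ha u z).toLp _) =ᵐ[dx] fun ξ => planePart μ a z (ξ, u) := by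
  filter_upwards [fourierDx_toLp (integrable_planeKernel hμ ha u z)
    (memLp_planeKernel hμ ha u z)] with ξ hξ
  rw [hξ, planePart_eq hrad]

theorem memLp_planePart (u : Circle) (z : C2) : MemLp (fun ξ => planePart μ a z (ξ, u)) 2 dx :=
  (memLp_congr_ae (fourierDx_planeKernel hμ ha hrad u z)).1 (Lp.memLp _)

/-- Plancherel's formula for the plane parts. -/
theorem integral_planePart (u : Circle) (z z' : C2) :
    ∫ ξ, planePart μ a z' (ξ, u) * (starRingEnd ℂ) (planePart μ a z (ξ, u)) ∂dx =
      ∫ y, expC y z * (starRingEnd ℂ) (expC y z') / (sigma μ y : ℂ) ∂dx := by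
  have h := fourierDx.inner_map_map ((memLp_planeKernel hμ ha u z).toLp _)
    ((memLp_planeKernel hμ ha u z').toLp _)
  rw [L2.inner_def, L2.inner_def] at h
  simp only [RCLike.inner_apply] at h
  rw [integral_congr_ae (g := fun ξ => planePart μ a z' (ξ, u) *
    (starRingEnd ℂ) (planePart μ a z (ξ, u)))] at h
  · rw [h]
    refine integral_congr_ae ?_
    filter_upwards [(memLp_planeKernel hμ ha u z).coeFn_toLp,
      (memLp_planeKernel hμ ha u z').coeFn_toLp] with y h1 h2
    rw [h1, h2]
    -- The phase carries all dependence on `u` and `a`, so the scalar product depends on neither.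
    have e1 : phase a u y * (starRingEnd ℂ) (phase a u y) = 1 := by
      rw [Complex.mul_conj, Complex.normSq_eq_norm_sq, norm_phase]; norm_num
    have e2 : (√(sigma μ y) : ℂ) * (√(sigma μ y) : ℂ) = (sigma μ y : ℂ) := by
      rw [← Complex.ofReal_mul, Real.mul_self_sqrt (hμ.sigma_pos y).le]
    simp only [planeKernel, map_mul, map_div₀, Complex.conj_conj, Complex.conj_ofReal]
    calc _ = (phase a u y * (starRingEnd ℂ) (phase a u y)) *
          (expC y z * (starRingEnd ℂ) (expC y z') /
            ((√(sigma μ y) : ℂ) * (√(sigma μ y) : ℂ))) := by ring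
      _ = _ := by rw [e1, e2, one_mul]
  · filter_upwards [fourierDx_planeKernel hμ ha hrad u z, fourierDx_planeKernel hμ ha hrad u z']
      with ξ h1 h2
    rw [h1, h2]

theorem lintegral_planePart (u : Circle) (z : C2) :
    ∫⁻ ξ, ‖planePart μ a z (ξ, u)‖ₑ ^ 2 ∂dx =
      ∫⁻ y, ‖expC y z / (√(sigma μ y) : ℂ)‖ₑ ^ 2 ∂dx := by
  calc _ = ∫⁻ ξ, ‖fourierDx ((memLp_planeKernel hμ ha u z).toLp _) ξ‖ₑ ^ 2 ∂dx :=
        lintegral_congr_ae (by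
          filter_upwards [fourierDx_planeKernel hμ ha hrad u z] with x hx; rw [hx])
    _ = ‖(memLp_planeKernel hμ ha u z).toLp _‖ₑ ^ 2 := by
        rw [← enorm_sq_eq_lintegral, LinearIsometryEquiv.enorm_map]
    _ = _ := by
        rw [enorm_sq_eq_lintegral]
        refine lintegral_congr_ae ?_
        filter_upwards [(memLp_planeKernel hμ ha u z).coeFn_toLp] with y hy
        rw [hy, ← ofReal_norm, norm_planeKernel, ← ofReal_norm, norm_div, Complex.norm_real,
          Real.norm_of_nonneg (Real.sqrt_nonneg _)]

theorem lintegral_planePart_lt_top (z : C2) :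
    ∫⁻ y, ‖expC y z / (√(sigma μ y) : ℂ)‖ₑ ^ 2 ∂dx < ⊤ := by
  rw [← lintegral_planePart hμ ha hrad 1]
  exact (memLp_two_iff (memLp_planePart hμ ha hrad 1 z).1).1 (memLp_planePart hμ ha hrad 1 z)

end

end

section

/-! ### Isometries from equal Gram matrices -/

theorem denseRange_linearCombination {ι E : Type*} [NormedAddCommGroup E] [InnerProductSpace ℂ E]
    [CompleteSpace E] {v : ι → E} (hv : ∀ f : E, (∀ i, inner ℂ (v i) f = 0) → f = 0) :
    DenseRange (Finsupp.linearCombination ℂ v) := by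
  rw [DenseRange, ← LinearMap.coe_range, Finsupp.range_linearCombination]
  rw [Submodule.dense_iff_topologicalClosure_eq_top,
    Submodule.topologicalClosure_eq_top_iff, Submodule.eq_bot_iff]
  intro f hf
  exact hv f fun i => (Submodule.mem_orthogonal _ f).1 hf _ (Submodule.subset_span ⟨i, rfl⟩)

/-- Two total families with the same Gram matrix are unitarily equivalent. -/
theorem exists_linearIsometryEquiv_of_inner_eq {ι E F : Type*} [NormedAddCommGroup E]
    [InnerProductSpace ℂ E] [CompleteSpace E] [NormedAddCommGroup F] [InnerProductSpace ℂ F]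
    [CompleteSpace F] {v : ι → E} {w : ι → F}
    (hvw : ∀ i j, inner ℂ (v i) (v j) = inner ℂ (w i) (w j))
    (hv : ∀ f : E, (∀ i, inner ℂ (v i) f = 0) → f = 0)
    (hw : ∀ f : F, (∀ i, inner ℂ (w i) f = 0) → f = 0) :
    ∃ J : E ≃ₗᵢ[ℂ] F, ∀ i, J (v i) = w i := by
  -- The norm of a finite linear combination depends only on the Gram matrix, so matching the
  -- combinations is isometric; totality makes both spans dense.
  have hn : ∀ x : ι →₀ ℂ, ‖Finsupp.linearCombination ℂ w (LinearEquiv.refl ℂ _ x)‖ =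
      ‖Finsupp.linearCombination ℂ v x‖ := fun x => by
    rw [@norm_eq_sqrt_re_inner ℂ, @norm_eq_sqrt_re_inner ℂ]
    congr 2
    simp only [LinearEquiv.refl_apply, Finsupp.linearCombination_apply, Finsupp.sum, sum_inner,
      inner_sum, inner_smul_left, inner_smul_right, hvw]
  refine ⟨(LinearEquiv.refl ℂ (ι →₀ ℂ)).extendOfIsometry (Finsupp.linearCombination ℂ v)
    (Finsupp.linearCombination ℂ w) (denseRange_linearCombination hv)
    (denseRange_linearCombination hw) hn, fun i => ?_⟩
  have := (LinearEquiv.refl ℂ (ι →₀ ℂ)).extendOfIsometry_eq (Finsupp.linearCombination ℂ v)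
    (Finsupp.linearCombination ℂ w) (denseRange_linearCombination hv)
    (denseRange_linearCombination hw) hn (Finsupp.single i 1)
  simpa using this

/-! ### The circle part of the kernel -/

/-- The Fourier coefficients of `circlePart`. -/
def circleCoeff (ν : Measure ℂˣ) (c : ℤ → ℂ) (w : ℂˣ) (n : ℤ) : ℂ :=
  (starRingEnd ℂ) (c n / (√(delta ν n) : ℂ) * (w : ℂ) ^ n)

/-- The function `u ↦ conj (χ (u⁻¹ w))`. -/
def circlePart (ν : Measure ℂˣ) (c : ℤ → ℂ) (w : ℂˣ) (u : Circle) : ℂ :=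
  (starRingEnd ℂ) (chi ν c ((Circle.toUnits u)⁻¹ * w))

theorem circlePart_eq (ν : Measure ℂˣ) (c : ℤ → ℂ) (w : ℂˣ) (u : Circle) :
    circlePart ν c w u = ∑' n, circleCoeff ν c w n * (u : ℂ) ^ n := by
  rw [circlePart, chi, Complex.conj_tsum]
  refine tsum_congr fun n => ?_
  rw [circleCoeff, ← map_inv, Units.val_mul, mul_zpow, Circle.toUnits_apply, Units.val_mk0]
  simp only [map_mul, map_div₀, map_zpow₀, ← Circle.coe_inv_eq_conj, inv_inv]
  ring

section

variable {ν : Measure ℂˣ} (hν : AdmissibleMeasure ν) {c : ℤ → ℂ} (hc : ∀ n, ‖c n‖ = 1)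
include hν hc

theorem summable_circleCoeff (w : ℂˣ) : Summable fun n => ‖circleCoeff ν c w n‖ := by
  simp only [circleCoeff, RCLike.norm_conj]
  exact hν.summable_zpow_div (fun n => (hc n).le) w.ne_zero

theorem continuous_circlePart (w : ℂˣ) : Continuous (circlePart ν c w) := by
  rw [funext (circlePart_eq ν c w)]
  exact continuous_tsum_zpow (summable_circleCoeff hν hc w)

/-- Parseval's formula; the factors `c n` cancel because they are unimodular. -/
theorem hasSum_inner_circlePart (w w' : ℂˣ) :
    HasSum (fun n : ℤ => (w : ℂ) ^ n * (starRingEnd ℂ) ((w' : ℂ) ^ n) / (delta ν n : ℂ))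
      (∫ u, circlePart ν c w' u * (starRingEnd ℂ) (circlePart ν c w u) ∂dα) := by
  have h := hasSum_parseval (summable_circleCoeff hν hc w') (summable_circleCoeff hν hc w)
  simp only [circlePart_eq]
  convert h using 2 with n
  have e : (√(delta ν n) : ℂ) * (√(delta ν n) : ℂ) = (delta ν n : ℂ) := by
    rw [← Complex.ofReal_mul, Real.mul_self_sqrt (hν.delta_pos n).le]
  have ec : c n * (starRingEnd ℂ) (c n) = 1 := by
    rw [Complex.mul_conj, Complex.normSq_eq_norm_sq, hc]; norm_num
  simp only [circleCoeff, Complex.conj_conj, map_mul, map_div₀, Complex.conj_ofReal]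
  calc _ = (c n * (starRingEnd ℂ) (c n)) * ((w : ℂ) ^ n * (starRingEnd ℂ) ((w' : ℂ) ^ n)) /
        ((√(delta ν n) : ℂ) * (√(delta ν n) : ℂ)) := by rw [e, ec, one_mul]
    _ = _ := by ring

/-- If all `circlePart`s integrate to zero against a square integrable function, the function
vanishes. -/
theorem ae_eq_zero_of_integral_circlePart {A : Circle → ℂ} (hA : MemLp A 2 dα)
    (h : ∀ w, ∫ u, circlePart ν c w u * A u ∂dα = 0) : A =ᵐ[dα] 0 := by
  have hi : Integrable A dα := hA.integrable (by norm_num)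
  set B : ℤ → ℂ := fun n => (starRingEnd ℂ) (c n / (√(delta ν n) : ℂ)) * ∫ u : Circle, (u : ℂ) ^ n * A u ∂dα
  -- Taking only `w = v⁻¹` on the unit circle, the hypothesis says that the Fourier series with
  -- coefficients `B` vanishes at `v`. Its coefficients are nonzero multiples of the Fourier
  -- coefficients of `A`.
  have hB : ∀ v : Circle, HasSum (fun n => B n * (v : ℂ) ^ n) 0 := fun v => by
    have := hasSum_integral_tsum_mul (summable_circleCoeff hν hc (Circle.toUnits v)⁻¹) hi
    simp only [← circlePart_eq] at this
    rw [h] at this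
    have hv : (((Circle.toUnits v)⁻¹ : ℂˣ) : ℂ) = (starRingEnd ℂ) (v : ℂ) := by
      rw [← map_inv, ← Circle.coe_inv_eq_conj]
      rfl
    convert this using 2 with n
    simp only [B, circleCoeff, map_mul, hv, map_zpow₀, Complex.conj_conj]
    ring
  have hBs : Summable fun n => ‖B n‖ := by
    have := (hB 1).summable.norm
    simpa using this
  refine ae_eq_zero_of_integral_zpow hA fun n => ?_
  have h1 := integral_tsum_mul_zpow hBs (-n)
  simp only [(hB _).tsum_eq, mul_zero, integral_zero] at h1
  refine (mul_eq_zero.1 h1.symm).resolve_left ?_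
  simp only [map_ne_zero]
  refine div_ne_zero (fun h0 => ?_) (hν.sqrt_delta_ne_zero _)
  simpa [h0] using hc (-n)

end

/-! ### The model kernel -/

/-- The function `(y, n) ↦ conj (e^{-i y·z} w^n / √(σ(y) δ(n)))`. -/
def modelKernel (μ : R2 → ℝ) (ν : Measure ℂˣ) (p : M2C) (q : R2 × ℤ) : ℂ :=
  (starRingEnd ℂ) (expC q.1 p.1 * (p.2 : ℂ) ^ q.2 *
    ((√(sigma μ q.1) : ℂ) * (√(delta ν q.2) : ℂ))⁻¹)

section

variable {μ : R2 → ℝ} (hμ : Admissible μ) {ν : Measure ℂˣ} (hν : AdmissibleMeasure ν)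
include hμ hν

theorem memLp_modelKernel (p : M2C) : MemLp (modelKernel μ ν p) 2 modelMeasure := by
  have hw0 : 0 < ‖(p.2 : ℂ)‖ := norm_pos_iff.2 p.2.ne_zero
  have hA : 0 < max ‖(p.2 : ℂ)‖ ‖(p.2 : ℂ)‖⁻¹ := lt_max_of_lt_left hw0
  refine (memLp_model_weight hμ hν ‖p.1‖ hA).mono
    (Complex.continuous_conj.measurable.comp
      ((measurable_kernel p.1 p.2).mul (measurable_model_denominator hμ))).aestronglyMeasurable
    (.of_forall fun q => ?_)
  have e : Real.exp (‖p.1‖ * ‖q.1‖) / √(sigma μ q.1) *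
      (max ‖(p.2 : ℂ)‖ ‖(p.2 : ℂ)‖⁻¹ ^ q.2.natAbs / √(delta ν q.2)) =
      Real.exp (‖p.1‖ * ‖q.1‖) * max ‖(p.2 : ℂ)‖ ‖(p.2 : ℂ)‖⁻¹ ^ q.2.natAbs *
        (√(sigma μ q.1) * √(delta ν q.2))⁻¹ := by
    rw [mul_inv]; ring
  rw [modelKernel, RCLike.norm_conj, Complex.norm_real, e, Real.norm_of_nonneg (by positivity),
    ← Complex.ofReal_mul, ← Complex.ofReal_inv, norm_mul, norm_mul, Complex.norm_real,
    Real.norm_of_nonneg (r := (√(sigma μ q.1) * √(delta ν q.2))⁻¹) (by positivity), norm_zpow]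
  gcongr
  · exact norm_expC_le _ _
  · exact zpow_le_pow_natAbs hw0 (le_max_left _ _) (le_max_right _ _) _

theorem inner_modelKernel (p : M2C) (h : Lp ℂ 2 modelMeasure) :
    inner ℂ ((memLp_modelKernel hμ hν p).toLp _) h = modelT μ ν h (p.1, (p.2 : ℂ)) := by
  rw [L2.inner_def, modelT]
  refine integral_congr_ae ?_
  filter_upwards [(memLp_modelKernel hμ hν p).coeFn_toLp] with q hq
  rw [hq, RCLike.inner_apply, modelKernel, Complex.conj_conj]
  simp only [div_eq_mul_inv]
  ring

/-- Orthogonality to all kernels says that the transform of `h` vanishes identically; by the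
isometry `h = 0`. -/
theorem modelKernel_total (h : Lp ℂ 2 modelMeasure)
    (h0 : ∀ p, inner ℂ ((memLp_modelKernel hμ hν p).toLp _) h = 0) : h = 0 := by
  have h1 := lintegral_modelT hμ hν (Lp.memLp h)
  simp only [← inner_modelKernel hμ hν, h0] at h1
  rw [← enorm_sq_eq_lintegral] at h1
  simpa using h1.symm

/-- The integrand is a product of functions of `y` and of `n`. The two factors are those that
Plancherel and Parseval produce on `M(2)`. -/
theorem inner_modelKernel_modelKernel {c : ℤ → ℂ} (hc : ∀ n, ‖c n‖ = 1) (p p' : M2C) :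
    inner ℂ ((memLp_modelKernel hμ hν p).toLp _) ((memLp_modelKernel hμ hν p').toLp _) =
      (∫ y, expC y p.1 * (starRingEnd ℂ) (expC y p'.1) / (sigma μ y : ℂ) ∂dx) *
        ∑' n : ℤ, (p.2 : ℂ) ^ n * (starRingEnd ℂ) ((p'.2 : ℂ) ^ n) / (delta ν n : ℂ) := by
  have e : ∀ r : ℝ, 0 < r → (√r : ℂ)⁻¹ * (√r : ℂ)⁻¹ = (r : ℂ)⁻¹ := fun r hr => by
    rw [← mul_inv, ← Complex.ofReal_mul, Real.mul_self_sqrt hr.le]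
  have h1 : ∀ q : R2 × ℤ, (starRingEnd ℂ) (modelKernel μ ν p q) * modelKernel μ ν p' q =
      (expC q.1 p.1 * (starRingEnd ℂ) (expC q.1 p'.1) / (sigma μ q.1 : ℂ)) *
        ((p.2 : ℂ) ^ q.2 * (starRingEnd ℂ) ((p'.2 : ℂ) ^ q.2) / (delta ν q.2 : ℂ)) := fun q => by
    simp only [modelKernel, map_mul, map_inv₀, Complex.conj_conj, Complex.conj_ofReal, mul_inv,
      div_eq_mul_inv, ← e _ (hμ.sigma_pos q.1), ← e _ (hν.delta_pos q.2)]
    ring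
  have hs := (hasSum_inner_circlePart hν hc p.2 p'.2).summable
  rw [L2.inner_def]
  calc _ = ∫ q, (starRingEnd ℂ) (modelKernel μ ν p q) * modelKernel μ ν p' q ∂modelMeasure := by
        refine integral_congr_ae ?_
        filter_upwards [(memLp_modelKernel hμ hν p).coeFn_toLp,
          (memLp_modelKernel hμ hν p').coeFn_toLp] with q hq hq'
        rw [hq, hq', RCLike.inner_apply, mul_comm]
    _ = ∫ q : R2 × ℤ, (expC q.1 p.1 * (starRingEnd ℂ) (expC q.1 p'.1) / (sigma μ q.1 : ℂ)) *
        ((p.2 : ℂ) ^ q.2 * (starRingEnd ℂ) ((p'.2 : ℂ) ^ q.2) / (delta ν q.2 : ℂ))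
          ∂dx.prod Measure.count := integral_congr_ae (.of_forall h1)
    _ = (∫ y, expC y p.1 * (starRingEnd ℂ) (expC y p'.1) / (sigma μ y : ℂ) ∂dx) *
        ∫ n : ℤ, (p.2 : ℂ) ^ n * (starRingEnd ℂ) ((p'.2 : ℂ) ^ n) / (delta ν n : ℂ)
          ∂Measure.count := integral_prod_mul
            (fun y => expC y p.1 * (starRingEnd ℂ) (expC y p'.1) / (sigma μ y : ℂ))
            (fun n : ℤ => (p.2 : ℂ) ^ n * (starRingEnd ℂ) ((p'.2 : ℂ) ^ n) / (delta ν n : ℂ))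
    _ = _ := by
        rw [integral_countable (integrable_count_iff.2 (hs.norm))]
        simp [Measure.real]

end

end

section

/-! ### The kernel of the transform as a total family in `L²(M(2))` -/

/-- Cauchy-Schwarz with values in `[0, ∞]`, usable on every fibre before square integrability is
known there. -/
theorem enorm_integral_mul_sq_le {X : Type*} [MeasurableSpace X] {m : Measure X} {f g : X → ℂ}
    (hf : AEMeasurable f m) (hg : AEMeasurable g m) :
    ‖∫ x, f x * g x ∂m‖ₑ ^ 2 ≤ (∫⁻ x, ‖f x‖ₑ ^ 2 ∂m) * ∫⁻ x, ‖g x‖ₑ ^ 2 ∂m := by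
  have h := ENNReal.lintegral_mul_le_Lp_mul_Lq m Real.HolderConjugate.two_two hf.enorm hg.enorm
  have h1 : ∀ x : ENNReal, (x ^ (1 / 2 : ℝ)) ^ 2 = x := fun x => by
    rw [← ENNReal.rpow_natCast, ← ENNReal.rpow_mul]; norm_num
  calc ‖∫ x, f x * g x ∂m‖ₑ ^ 2 ≤ (∫⁻ x, ‖f x * g x‖ₑ ∂m) ^ 2 := by
        gcongr; exact enorm_integral_le_lintegral_enorm _
    _ ≤ ((∫⁻ x, ‖f x‖ₑ ^ (2 : ℝ) ∂m) ^ (1 / 2 : ℝ) *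
        (∫⁻ x, ‖g x‖ₑ ^ (2 : ℝ) ∂m) ^ (1 / 2 : ℝ)) ^ 2 := by
        gcongr
        simpa only [enorm_mul, Pi.mul_apply] using h
    _ = _ := by
        rw [mul_pow, h1, h1]
        simp only [ENNReal.rpow_ofNat]

/-- The function `g ↦ conj (φ (g⁻¹ p))` on `M(2)`. -/
def groupKernel (μ a : R2 → ℝ) (ν : Measure ℂˣ) (c : ℤ → ℂ) (p : M2C) (g : R2 × Circle) : ℂ :=
  planePart μ a p.1 g * circlePart ν c p.2 g.2

theorem groupKernel_eq (μ a : R2 → ℝ) (ν : Measure ℂˣ) (c : ℤ → ℂ) (p : M2C) (g : M2) :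
    groupKernel μ a ν c p g = (starRingEnd ℂ) (phi μ a ν c ((toM2C g)⁻¹ * p)) := by
  have h1 : ((toM2C g)⁻¹ * p).1 = rotC (Circle.toUnits g.2)⁻¹ (p.1 - cpt g.1 0) := by
    have h2 := rotC_add (Circle.toUnits g.2)⁻¹ (p.1 - cpt g.1 0) (cpt g.1 0)
    rw [sub_add_cancel] at h2
    have h3 : (toM2C g).1 = cpt g.1 0 := by
      change !₂[((g.1 0 : ℝ) : ℂ), ((g.1 1 : ℝ) : ℂ)] = cpt g.1 0
      simp [cpt]
    change -rotC (Circle.toUnits g.2)⁻¹ (toM2C g).1 + rotC (Circle.toUnits g.2)⁻¹ p.1 = _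
    rw [h3, h2]
    abel
  have h2 : ((toM2C g)⁻¹ * p).2 = (Circle.toUnits g.2)⁻¹ * p.2 := rfl
  rw [phi, h1, h2, map_mul]
  rfl

section

variable {μ a : R2 → ℝ} (hμ : Admissible μ) (ha : Measurable a)
  (hrad : ∀ x y : R2, ‖x‖ = ‖y‖ → μ x = μ y)
include hμ ha hrad

/-- By Plancherel the pairing with `F` is the conjugate of a continuous Fourier-Laplace transform.
Vanishing on a dense set of real points makes it vanish on `ℝ²`, and Plancherel at height `0` kills
its density. A countable family is used so that exceptional null sets of rotations can be united. -/
theorem planePart_total (u : Circle) {F : R2 → ℂ} (hF : MemLp F 2 dx)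
    (h : ∀ n, ∫ ξ, planePart μ a (cpt (TopologicalSpace.denseSeq R2 n) 0) (ξ, u) *
      (starRingEnd ℂ) (F ξ) ∂dx = 0) : F =ᵐ[dx] 0 := by
  set g := fourierDx.symm (hF.toLp F) with hg
  set H : R2 → ℂ := fun y => g y * (starRingEnd ℂ) (phase a u y) with hHdef
  have hHm : AEStronglyMeasurable H dx := (Lp.aestronglyMeasurable g).mul
    (Complex.continuous_conj.measurable.comp (measurable_phase ha u)).aestronglyMeasurable
  have hHn : ∀ y, ‖H y‖ = ‖g y‖ := fun y => by
    rw [hHdef, norm_mul, RCLike.norm_conj, norm_phase, mul_one]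
  have hH : MemLp H 2 dx := (Lp.memLp g).mono hHm (.of_forall fun y => (hHn y).le)
  have h1 : ∀ z, ∫ ξ, planePart μ a z (ξ, u) * (starRingEnd ℂ) (F ξ) ∂dx =
      (starRingEnd ℂ) (planeE (fun y => H y / (√(sigma μ y) : ℂ)) z) := fun z => by
    have e1 : inner ℂ (hF.toLp F) (fourierDx ((memLp_planeKernel hμ ha u z).toLp _)) =
        inner ℂ g ((memLp_planeKernel hμ ha u z).toLp _) := by
      rw [← fourierDx.inner_map_map g, hg, LinearIsometryEquiv.apply_symm_apply]
    rw [L2.inner_def, L2.inner_def] at e1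
    rw [planeE, ← integral_conj]
    refine (Eq.trans ?_ e1).trans ?_
    · refine integral_congr_ae ?_
      filter_upwards [hF.coeFn_toLp, fourierDx_planeKernel hμ ha hrad u z] with ξ hξ hξ'
      rw [hξ, hξ', RCLike.inner_apply]
    · refine integral_congr_ae ?_
      filter_upwards [(memLp_planeKernel hμ ha u z).coeFn_toLp] with y hy
      rw [hy, RCLike.inner_apply, planeKernel]
      simp only [hHdef, map_mul, map_div₀, Complex.conj_conj, Complex.conj_ofReal]
      ring
  have h2 : (fun x => planeE (fun y => H y / (√(sigma μ y) : ℂ)) (cpt x 0)) = 0 := by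
    refine Continuous.ext_on (TopologicalSpace.denseRange_denseSeq R2)
      ((hμ.continuous_planeE_div hH).comp (continuous_cpt.comp (by fun_prop :
        Continuous fun x : R2 => (x, (0 : R2))))) continuous_const ?_
    rintro _ ⟨n, rfl⟩
    have := h n
    rw [h1] at this
    simpa using this
  have h3 := lintegral_planeE (hμ.integrable_mul_exp_inner hH 0) (hμ.memLp_mul_exp_inner hH 0)
  have h4 : ∫⁻ x, ‖planeE (fun y => H y / (√(sigma μ y) : ℂ)) (cpt x 0)‖ₑ ^ 2 ∂dx = 0 := by
    simp [fun x => congrFun h2 x]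
  rw [h4, eq_comm, lintegral_eq_zero_iff' ((hμ.aestronglyMeasurable_mul_exp_inner hH
    0).enorm.pow_const 2)] at h3
  have h5 : g = 0 := by
    refine Lp.ext ?_
    filter_upwards [h3, Lp.coeFn_zero ℂ 2 dx] with y hy h0
    rw [h0, Pi.zero_apply, ← norm_eq_zero, ← hHn]
    simpa [hμ.sqrt_sigma_ne_zero y] using hy
  have h6 : hF.toLp F = 0 := by
    rw [hg] at h5
    simpa using h5
  exact (hF.toLp_eq_toLp_iff MemLp.zero).1 (h6.trans (MemLp.toLp_zero _).symm)

variable {ν : Measure ℂˣ} (hν : AdmissibleMeasure ν) {c : ℤ → ℂ} (hc : ∀ n, ‖c n‖ = 1)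

include hν hc

theorem memLp_groupKernel (p : M2C) : MemLp (groupKernel μ a ν c p) 2 (dx.prod dα) := by
  have hX := continuous_circlePart hν hc p.2
  have hm : Continuous (groupKernel μ a ν c p) :=
    (continuous_planePart hμ ha p.1).mul (hX.comp continuous_snd)
  rw [memLp_two_iff hm.aestronglyMeasurable,
    lintegral_prod_symm _ (hm.measurable.enorm.pow_const 2).aemeasurable]
  have h1 : ∀ u, ∫⁻ ξ, ‖groupKernel μ a ν c p (ξ, u)‖ₑ ^ 2 ∂dx =
      (∫⁻ y, ‖expC y p.1 / (√(sigma μ y) : ℂ)‖ₑ ^ 2 ∂dx) * ‖circlePart ν c p.2 u‖ₑ ^ 2 :=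
    fun u => by
      simp only [groupKernel, enorm_mul, mul_pow]
      rw [lintegral_mul_const' _ _ (by simp), lintegral_planePart hμ ha hrad]
  simp only [h1]
  rw [lintegral_const_mul _ (hX.measurable.enorm.pow_const 2)]
  exact ENNReal.mul_lt_top (lintegral_planePart_lt_top hμ ha hrad p.1)
    ((memLp_two_iff hX.aestronglyMeasurable).1 (memLp_continuous_dα hX))

theorem inner_groupKernel (p : M2C) (f : Lp ℂ 2 (dx.prod dα)) :
    inner ℂ ((memLp_groupKernel hμ ha hrad hν hc p).toLp _) f =
      ∫ g, f g * (starRingEnd ℂ) (groupKernel μ a ν c p g) ∂(dx.prod dα) := by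
  rw [L2.inner_def]
  refine integral_congr_ae ?_
  filter_upwards [(memLp_groupKernel hμ ha hrad hν hc p).coeFn_toLp] with g hg
  rw [hg, RCLike.inner_apply]

/-- For each `u` the integral over `ξ` has the same value, so it factors out of the integral over
the circle, which Parseval evaluates. -/
theorem inner_groupKernel_groupKernel (p p' : M2C) :
    inner ℂ ((memLp_groupKernel hμ ha hrad hν hc p).toLp _)
      ((memLp_groupKernel hμ ha hrad hν hc p').toLp _) =
      inner ℂ ((memLp_modelKernel hμ hν p).toLp _) ((memLp_modelKernel hμ hν p').toLp _) := by
  have hi : Integrable (fun g =>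
      groupKernel μ a ν c p' g * (starRingEnd ℂ) (groupKernel μ a ν c p g)) (dx.prod dα) :=
    (memLp_groupKernel hμ ha hrad hν hc p').integrable_mul
      (memLp_groupKernel hμ ha hrad hν hc p).star
  rw [inner_modelKernel_modelKernel hμ hν hc, (hasSum_inner_circlePart hν hc p.2 p'.2).tsum_eq,
    inner_groupKernel hμ ha hrad hν hc]
  calc _ = ∫ g, groupKernel μ a ν c p' g * (starRingEnd ℂ) (groupKernel μ a ν c p g)
        ∂(dx.prod dα) := by
        refine integral_congr_ae ?_
        filter_upwards [(memLp_groupKernel hμ ha hrad hν hc p').coeFn_toLp] with g hg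
        rw [hg]
    _ = ∫ u, ∫ ξ, groupKernel μ a ν c p' (ξ, u) * (starRingEnd ℂ) (groupKernel μ a ν c p (ξ, u))
        ∂dx ∂dα := integral_prod_symm _ hi
    _ = _ := by
        rw [← integral_const_mul]
        refine integral_congr_ae (.of_forall fun u => ?_)
        simp only [← integral_planePart hμ ha hrad u p.1 p'.1]
        rw [← integral_mul_const]
        refine integral_congr_ae (.of_forall fun ξ => ?_)
        simp only [groupKernel, map_mul]
        ring

/-- Fubini separates the two factors. For fixed `z`, letting `w` vary shows that the plane pairing
vanishes for almost every `u`. Then countably many `z` give a common null set off which `f(·, u) =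
0`. -/
theorem groupKernel_total (f : Lp ℂ 2 (dx.prod dα))
    (h0 : ∀ p, inner ℂ ((memLp_groupKernel hμ ha hrad hν hc p).toLp _) f = 0) : f = 0 := by
  have hfm : StronglyMeasurable f := Lp.stronglyMeasurable f
  have hf2 : ∫⁻ u, ∫⁻ ξ, ‖f (ξ, u)‖ₑ ^ 2 ∂dx ∂dα < ⊤ := by
    rw [← lintegral_prod_symm _ (hfm.measurable.enorm.pow_const 2).aemeasurable]
    exact (memLp_two_iff hfm.aestronglyMeasurable).1 (Lp.memLp f)
  have hfu : ∀ u, StronglyMeasurable fun ξ => f (ξ, u) := fun u =>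
    hfm.comp_measurable measurable_prodMk_right
  have hmeas : Measurable fun u => ∫⁻ ξ, ‖f (ξ, u)‖ₑ ^ 2 ∂dx :=
    (hfm.measurable.enorm.pow_const 2).lintegral_prod_left'
  have hL2 : ∀ᵐ u ∂dα, MemLp (fun ξ => f (ξ, u)) 2 dx := by
    filter_upwards [ae_lt_top hmeas hf2.ne] with u hu
    exact (memLp_two_iff (hfu u).aestronglyMeasurable).2 hu
  have hB : ∀ z : C2, (fun u => ∫ ξ, planePart μ a z (ξ, u) * (starRingEnd ℂ) (f (ξ, u)) ∂dx)
      =ᵐ[dα] 0 := fun z => by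
    have hpm := continuous_planePart hμ ha z
    have hcm : StronglyMeasurable fun g => (starRingEnd ℂ) (f g) :=
      Complex.continuous_conj.comp_stronglyMeasurable hfm
    refine ae_eq_zero_of_integral_circlePart hν hc ?_ fun w => ?_
    · have hsm : StronglyMeasurable fun g => planePart μ a z g * (starRingEnd ℂ) (f g) :=
        hpm.stronglyMeasurable.mul hcm
      rw [memLp_two_iff hsm.integral_prod_left'.aestronglyMeasurable]
      refine lt_of_le_of_lt (lintegral_mono fun u => enorm_integral_mul_sq_le
        (hpm.measurable.comp measurable_prodMk_right).aemeasurable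
        (hcm.measurable.comp measurable_prodMk_right).aemeasurable) ?_
      simp only [lintegral_planePart hμ ha hrad, RCLike.enorm_conj]
      rw [lintegral_const_mul _ hmeas]
      exact ENNReal.mul_lt_top (lintegral_planePart_lt_top hμ ha hrad z) hf2
    · have h1 := h0 (pairC z w)
      have hi : Integrable (fun g => groupKernel μ a ν c (pairC z w) g *
          (starRingEnd ℂ) (f g)) (dx.prod dα) :=
        (memLp_groupKernel hμ ha hrad hν hc _).integrable_mul (Lp.memLp f).star
      rw [inner_groupKernel hμ ha hrad hν hc, ← map_eq_zero (starRingEnd ℂ), ← integral_conj] at h1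
      rw [← h1]
      symm
      calc _ = ∫ g, groupKernel μ a ν c (pairC z w) g * (starRingEnd ℂ) (f g)
            ∂(dx.prod dα) := by
            simp only [map_mul, Complex.conj_conj, mul_comm]
        _ = _ := by
            rw [integral_prod_symm _ hi]
            refine integral_congr_ae (.of_forall fun u => ?_)
            simp only [groupKernel, pairC]
            rw [← integral_const_mul]
            refine integral_congr_ae (.of_forall fun ξ => ?_)
            simp only
            ring
  -- The null set in `hB` depends on `z`; restricting to a dense sequence of real `z` leaves a
  -- countable union.
  have hz : ∀ᵐ u ∂dα, ∫⁻ ξ, ‖f (ξ, u)‖ₑ ^ 2 ∂dx = 0 := by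
    filter_upwards [hL2, ae_all_iff.2 fun n => hB (cpt (TopologicalSpace.denseSeq R2 n) 0)]
      with u hu hn
    have := planePart_total hμ ha hrad u hu hn
    rw [lintegral_congr_ae (g := 0) (by filter_upwards [this] with ξ hξ; simp [hξ])]
    simp
  have hfin := enorm_sq_eq_lintegral f
  rw [lintegral_prod_symm _ (hfm.measurable.enorm.pow_const 2).aemeasurable,
    lintegral_congr_ae hz] at hfin
  simpa using hfin

end

end

section

/-! ### The transform as an isometric isomorphism -/

theorem modelT_congr {μ : R2 → ℝ} {ν : Measure ℂˣ} {h h' : R2 × ℤ → ℂ}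
    (hh : h =ᵐ[modelMeasure] h') : modelT μ ν h = modelT μ ν h' := by
  funext p
  refine integral_congr_ae ?_
  filter_upwards [hh] with q hq
  rw [hq]

section

variable {μ : R2 → ℝ} (hμ : Admissible μ) {ν : Measure ℂˣ} (hν : AdmissibleMeasure ν)
include hμ hν

theorem memLp_modelT (h : Lp ℂ 2 modelMeasure) :
    MemLp (fun p : M2C => modelT μ ν h (p.1, (p.2 : ℂ))) 2 (targetMeasure μ ν) := by
  rw [memLp_two_iff (isHolomorphic_modelT hμ hν (Lp.memLp h)).measurable.aestronglyMeasurable,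
    lintegral_modelT hμ hν (Lp.memLp h)]
  exact (memLp_two_iff (Lp.aestronglyMeasurable h)).1 (Lp.memLp h)

/-- `modelT` as a linear isometry into the space of holomorphic square integrable functions. -/
def modelIsometry : Lp ℂ 2 modelMeasure →ₗᵢ[ℂ] holomorphicL2 (targetMeasure μ ν) where
  toFun h := ⟨(memLp_modelT hμ hν h).toLp _, _, isHolomorphic_modelT hμ hν (Lp.memLp h),
    (memLp_modelT hμ hν h).coeFn_toLp⟩
  map_add' h h' := by
    refine Subtype.ext ?_
    change (memLp_modelT hμ hν (h + h')).toLp _ = (memLp_modelT hμ hν h).toLp _ + (memLp_modelT hμ hν h').toLp _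
    rw [← MemLp.toLp_add]
    refine MemLp.toLp_congr _ _ (.of_forall fun p => ?_)
    simp only [Pi.add_apply, ← inner_modelKernel hμ hν, inner_add_right]
  map_smul' k h := by
    refine Subtype.ext ?_
    change (memLp_modelT hμ hν (k • h)).toLp _ = k • (memLp_modelT hμ hν h).toLp _
    rw [← MemLp.toLp_const_smul]
    refine MemLp.toLp_congr _ _ (.of_forall fun p => ?_)
    simp only [Pi.smul_apply, ← inner_modelKernel hμ hν, inner_smul_right, smul_eq_mul]
  norm_map' h := by
    change ‖(memLp_modelT hμ hν h).toLp _‖ = ‖h‖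
    have h1 : ‖(memLp_modelT hμ hν h).toLp _‖ₑ ^ 2 = ‖h‖ₑ ^ 2 := by
      rw [Lp.enorm_toLp, eLpNorm_two_sq, lintegral_modelT hμ hν (Lp.memLp h),
        enorm_sq_eq_lintegral]
    rw [← toReal_enorm, ← toReal_enorm h, (ENNReal.pow_right_strictMono two_ne_zero).injective h1]

theorem modelIsometry_ae_eq (h : Lp ℂ 2 modelMeasure) :
    ((modelIsometry hμ hν h : Lp ℂ 2 (targetMeasure μ ν)) : M2C → ℂ) =ᵐ[targetMeasure μ ν]
      fun p => modelT μ ν h (p.1, (p.2 : ℂ)) :=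
  (memLp_modelT hμ hν h).coeFn_toLp

theorem exists_Lp_modelT_eq {F : M2C → ℂ} (hF : IsHolomorphic F)
    (hF2 : MemLp F 2 (targetMeasure μ ν)) :
    ∃ h : Lp ℂ 2 modelMeasure, ∀ p : M2C, F p = modelT μ ν h (p.1, (p.2 : ℂ)) := by
  obtain ⟨h, hh, hFh⟩ := exists_modelT_eq hμ hν hF ((memLp_two_iff hF2.1).1 hF2)
  exact ⟨hh.toLp h, fun p => by rw [hFh, modelT_congr hh.coeFn_toLp]⟩

theorem modelIsometry_surjective : Function.Surjective (modelIsometry hμ hν) := by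
  rintro ⟨F, H, hH, hFH⟩
  obtain ⟨h, hh⟩ := exists_Lp_modelT_eq hμ hν hH ((memLp_congr_ae hFH).1 (Lp.memLp F))
  refine ⟨h, Subtype.ext (Lp.ext ?_)⟩
  filter_upwards [modelIsometry_ae_eq hμ hν h, hFH] with p h1 h2
  rw [h1, h2, hh]

theorem modelT_injective {h h' : Lp ℂ 2 modelMeasure}
    (he : ∀ p : M2C, modelT μ ν h (p.1, (p.2 : ℂ)) = modelT μ ν h' (p.1, (p.2 : ℂ))) : h = h' := by
  refine sub_eq_zero.1 (modelKernel_total hμ hν _ fun p => ?_)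
  rw [inner_sub_right, inner_modelKernel hμ hν, inner_modelKernel hμ hν, he, sub_self]

/-- The convolution transform factors through `modelT`. -/
theorem exists_groupConvolution_eq_modelT (hrad : ∀ x y : R2, ‖x‖ = ‖y‖ → μ x = μ y)
    {a : R2 → ℝ} (ha : Measurable a) {c : ℤ → ℂ} (hc : ∀ n, ‖c n‖ = 1) :
    ∃ J : Lp ℂ 2 haarM2 ≃ₗᵢ[ℂ] Lp ℂ 2 modelMeasure, ∀ (f : Lp ℂ 2 haarM2) (p : M2C),
      Integrable (fun g => f g * phi μ a ν c ((toM2C g)⁻¹ * p)) haarM2 ∧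
      groupConvolution (phi μ a ν c) f p = modelT μ ν (J f) (p.1, (p.2 : ℂ)) := by
  obtain ⟨J, hJ⟩ := exists_linearIsometryEquiv_of_inner_eq
    (inner_groupKernel_groupKernel hμ ha hrad hν hc) (groupKernel_total hμ ha hrad hν hc)
    (modelKernel_total hμ hν)
  refine ⟨J, fun f p => ?_⟩
  have hk : ∀ g : M2, phi μ a ν c ((toM2C g)⁻¹ * p) =
      (starRingEnd ℂ) (groupKernel μ a ν c p g) := fun g => by
    rw [groupKernel_eq, Complex.conj_conj]
  simp only [groupConvolution, hk]
  refine ⟨(Lp.memLp f).integrable_mul (memLp_groupKernel hμ ha hrad hν hc p).star, ?_⟩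
  -- Since `J` is unitary and carries the group kernel at `p` to the model kernel at `p`, both sides
  -- are the same scalar product.
  rw [← inner_modelKernel hμ hν p, ← hJ p]
  exact ((J.inner_map_map _ f).trans (inner_groupKernel hμ ha hrad hν hc p f)).symm

end

end

end M2SegalBargmann

end

theorem mainTheorem2
    (μ : R2 → ℝ)
    (hμ_radial : ∀ x y : R2, ‖x‖ = ‖y‖ → μ x = μ y)
    (hμ_pos : ∀ x, 0 < μ x)
    (hμ_loc : LocallyBoundedAwayFromZero μ)
    (hσ : ∀ x : R2, Integrable (fun y : R2 => Real.exp (2 * inner ℝ x y) * μ y) dx)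
    (a : R2 → ℝ) (ha : Measurable a)
    (ν : Measure ℂˣ)
    (hν_inv : ∀ u : Circle, ν.map (fun w => Circle.toUnits u * w) = ν)
    (hν_density : ∃ ρ : ℂˣ → ℝ, Measurable ρ ∧ (∀ w, 0 < ρ w) ∧ LocallyBoundedAwayFromZero ρ ∧
      ν = lebesgueCStar.withDensity fun w => ENNReal.ofReal (ρ w))
    (hδ : ∀ n : ℤ, Integrable (fun w : ℂˣ => ‖(w : ℂ)‖ ^ (2 * n)) ν)
    (c : ℤ → ℂ) (hc : ∀ n, ‖c n‖ = 1) :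
    (∃ T : Lp ℂ 2 haarM2 ≃ₗᵢ[ℂ] holomorphicL2 (targetMeasure μ ν),
      ∀ f : Lp ℂ 2 haarM2,
        (∀ p : M2C, Integrable (fun g => f g * phi μ a ν c ((toM2C g)⁻¹ * p)) haarM2) ∧
        IsHolomorphic (groupConvolution (phi μ a ν c) f) ∧
        ((T f : Lp ℂ 2 (targetMeasure μ ν)) : M2C → ℂ) =ᵐ[targetMeasure μ ν]
          groupConvolution (phi μ a ν c) f) ∧
    (∀ F : M2C → ℂ, IsHolomorphic F → MemLp F 2 (targetMeasure μ ν) →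
      ∃! f : Lp ℂ 2 haarM2, groupConvolution (phi μ a ν c) f = F) := by
  have hμ : Admissible μ := ⟨hμ_pos, hμ_loc, hσ⟩
  have hν : AdmissibleMeasure ν := by
    obtain ⟨ρ, h1, h2, -, h3⟩ := hν_density
    exact ⟨hν_inv, ⟨ρ, h1, h2, h3⟩, hδ⟩
  obtain ⟨J, hJ⟩ := exists_groupConvolution_eq_modelT hμ hν hμ_radial ha hc
  have hJ' : ∀ f : Lp ℂ 2 haarM2, groupConvolution (phi μ a ν c) f =
      fun p => modelT μ ν (J f) (p.1, (p.2 : ℂ)) := fun f => funext fun p => (hJ f p).2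
  refine ⟨⟨J.trans (LinearIsometryEquiv.ofSurjective _ (modelIsometry_surjective hμ hν)),
    fun f => ⟨fun p => (hJ f p).1, ?_, ?_⟩⟩, fun F hF hF2 => ?_⟩
  · rw [hJ']
    exact isHolomorphic_modelT hμ hν (Lp.memLp (J f))
  · rw [hJ']
    exact modelIsometry_ae_eq hμ hν (J f)
  · obtain ⟨h, hh⟩ := exists_Lp_modelT_eq hμ hν hF hF2
    refine ⟨J.symm h, ?_, fun f hf => ?_⟩
    · funext p
      rw [hJ', LinearIsometryEquiv.apply_symm_apply, hh]
    · rw [LinearIsometryEquiv.eq_symm_apply]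
      refine modelT_injective hμ hν fun p => ?_
      rw [← hh, ← hf, hJ']
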